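/- **Theorem (existence of an optimal $\psi$-relaxed control for classical CTMDPs).** *Data.* Let $T>0$, let $S$ be a countable set with the discrete topology, let $U\subset\mathbb R^k$ be non-empty and let $\mathcal P(U)$ be the set of Borel probability measures on $U$, with the Wasserstein distance $W_1(\mu,\nu)=\inf_\pi\int|x-y|\,\pi(dx,dy)$ ($\pi$ ranging over the couplings of $\mu,\nu$). For $u\in U$ let $q(\theta;u)\in[0,\infty)$ and let $q(\theta,\cdot\,;u)$ be a measure on $S$ ($\theta\in S$). For $m\in\mathcal P(U)$ put $q(\theta;m)=\int_U q(\theta;u)\,m(du)$, $q(\theta,A;m)=\int_U q(\theta,A;u)\,m(du)$. Assume: * (H1) $U$ is compact. * (H2) For each $u\in U$, $(q(\theta;u),q(\theta,A;u))$ is a conservative $q$-pair: it is measurable in $\theta$, $q(\theta,\{\theta\};u)=0$ and $q(\theta,S;u)=q(\theta;u)$. Moreover $\sup_{u\in U}\sup_{\theta\in S}q(\theta,S;u)<\infty$. * (H3) For all $\theta\in S$ and $A\subset S$, $u\mapsto q(\theta,A;u)$ is continuous on $U$; for all $A\subset S$, $u\in U$, $\theta\mapsto q(\theta,A;u)$ is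 continuous. * (H4) There are $\Phi:S\to[1,\infty)$ all of whose sublevel sets $\{\Phi\le a\}$, $a>0$, are compact, a compact set $B_0\subset S$, and constants $\lambda>0$, $\kappa_0<\infty$ such that for all $\theta\in S$, $u\in U$ the integral below is finite and $$\int_S\Phi(\gamma)\,q(\theta,d\gamma;u)-q(\theta;u)\Phi(\theta)\le\lambda\Phi(\theta)+\kappa_0\mathbf 1_{B_0}(\theta).$$ Let $\psi:[0,T]\to[0,\infty)$ be nondecreasing with $\lim_{r\downarrow0}\psi(r)=0$. *Controls.* For $(s,\theta)\in[0,T]\times S$, a *$\psi$-relaxed control* with initial value $(s,\theta)$ consists of a probability space $(\Omega,\mathcal F,P)$ with a filtration $(\mathcal F_t)_{t\in[0,T]}$ satisfying the usual conditions (right-continuous, each $\mathcal F_t$ containing the $P$-null events of $\mathcal F$), an $S$-valued process $(\Lambda_t)_{t\in[s,T]}$ and a $\mathcal P(U)$-valued process $(\mu_t)_{t\in[s,T]}$ such that 1. $\mu_t$ is $\sigma(\Lambda_t)$-measurable for every $t$; a.s. $t\mapsto\mu_t$ is right-continuous with left limits for $W_1$; and for every $\theta'\in S$ there is a curve $t\mapsto\nu_t(\cdot,\theta')\in\mathcal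 P(U)$, $t\in[0,T]$, such that $\nu_t(\cdot,\theta')=\mu_t(\cdot\mid\Lambda_t=\theta')$ for all $t\in[s,T]$ with $P(\Lambda_t=\theta')>0$, and $$\sup_{t,r\in[t_1,t_2)}W_1(\nu_t(\cdot,\theta'),\nu_r(\cdot,\theta'))\le\psi(t_2-t_1),\qquad 0\le t_1<t_2\le T;$$ 2. $(\Lambda_t)$ is $(\mathcal F_t)$-adapted, a.s. $\Lambda_s=\theta$ and $t\mapsto\Lambda_t$ is right-continuous with left limits in the discrete space $S$ (so it is a jump process with finitely many jumps), and $$P(\Lambda_{t+\delta}\in A\mid\Lambda_t=\theta',\mu_t=m)-\mathbf 1_A(\theta')=\bigl(q(\theta',A;m)-q(\theta';m)\mathbf 1_A(\theta')\bigr)\delta+o(\delta),\qquad\delta\downarrow0,$$ whenever $P(\Lambda_t=\theta',\mu_t=m)>0$, where $s\le t<t+\delta\le T$ and, for fixed $\theta'\in S$ and $A\subset S$, $o(\delta)$ is uniform in $t$. *Cost.* Let $f:[0,T]\times S\times U\to\mathbb R$ and $g:S\to\mathbb R$ be lower semicontinuous and bounded below. For $s<T$ and a $\psi$-relaxed control $\alpha$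 with initial value $(s,\theta)$ put $$J(s,\theta,\alpha)=E\Bigl[\int_s^T\!\!\int_U f(t,\Lambda_t,u)\,\mu_t(du)\,dt+g(\Lambda_T)\Bigr]\in(-\infty,\infty],\qquad V(s,\theta)=\inf_\alpha J(s,\theta,\alpha),$$ the infimum being over all $\psi$-relaxed controls with initial value $(s,\theta)$. *Conclusion.* For every $s\in[0,T)$ and $\theta\in S$ there exists an optimal $\psi$-relaxed control, i.e. a $\psi$-relaxed control $\alpha^*$ with initial value $(s,\theta)$ such that $J(s,\theta,\alpha^*)=V(s,\theta)$. Moreover, $\alpha^*$ can be chosen such that its state process $(\Lambda_t)$ is a Markov process with respect to $(\mathcal F_t)$. -/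

import Mathlib

open Set Filter Topology MeasureTheory ProbabilityTheory
open scoped NNReal ENNReal

universe u v w

noncomputable section

namespace CTMDP

/-! ### The Wasserstein distance and path regularity -/

/-- The `L¹`-Wasserstein distance `W₁(μ, ν)`: the infimum of `∫ |x - y| π(dx, dy)` over all
couplings `π` of `μ` and `ν`. -/
def W1 {X : Type*} [MeasurableSpace X] [PseudoEMetricSpace X] (μ ν : ProbabilityMeasure X) :
    ℝ≥0∞ :=
  ⨅ (π : ProbabilityMeasure (X × X))
    (_ : (π : Measure (X × X)).map Prod.fst = (μ : Measure X) ∧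
      (π : Measure (X × X)).map Prod.snd = (ν : Measure X)),
    ∫⁻ p, edist p.1 p.2 ∂(π : Measure (X × X))

/-- The oscillation `w_ν([a,b)) = sup {W₁(ν_t, ν_r) : t, r ∈ [a,b)}`. -/
def oscIco {X : Type*} [MeasurableSpace X] [PseudoEMetricSpace X]
    (ν : ℝ → ProbabilityMeasure X) (a b : ℝ) : ℝ≥0∞ :=
  ⨆ t ∈ Ico a b, ⨆ r ∈ Ico a b, W1 (ν t) (ν r)

/-- `x` restricted to `[s,T]` is right-continuous with left limits. -/
def IsCadlagOn {X : Type*} [TopologicalSpace X] (x : ℝ → X) (s T : ℝ) : Prop :=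
  (∀ t ∈ Ico s T, Tendsto x (𝓝[>] t) (𝓝 (x t))) ∧
    ∀ t ∈ Ioc s T, ∃ l, Tendsto x (𝓝[<] t) (𝓝 l)

/-- The curve `m` of probability measures, restricted to `[s,T]`, is right-continuous with left
limits with respect to `W₁`. -/
def IsCadlagW1On {X : Type*} [MeasurableSpace X] [PseudoEMetricSpace X]
    (m : ℝ → ProbabilityMeasure X) (s T : ℝ) : Prop :=
  (∀ t ∈ Ico s T, Tendsto (fun r => W1 (m r) (m t)) (𝓝[>] t) (𝓝 0)) ∧
    ∀ t ∈ Ioc s T, ∃ l, Tendsto (fun r => W1 (m r) l) (𝓝[<] t) (𝓝 0)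

/-! ### Transition rates -/

/-- `(q(θ), q(θ, A))` is a conservative `q`-pair on `S`. -/
structure IsConservativeQPair {S : Type*} [MeasurableSpace S] (q : S → ℝ≥0) (Q : S → Measure S) :
    Prop where
  measurable_rate : Measurable q
  measurable_kernel : ∀ A, MeasurableSet A → Measurable fun θ => Q θ A
  no_self_jump : ∀ θ, Q θ {θ} = 0
  conservative : ∀ θ, Q θ univ = q θ

/-- `h` is a compact function: all sublevel sets `{h ≤ a}`, `a > 0`, are compact. -/
def IsCompactFunction {S : Type*} [TopologicalSpace S] (h : S → ℝ) : Prop :=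
  ∀ a : ℝ, 0 < a → IsCompact {θ | h θ ≤ a}

/-- The Lyapunov drift condition: for some compact function `Φ : S → [1,∞)`, compact `B₀`,
`λ > 0` and `κ₀ < ∞`, one has
`∫ Φ(γ) q(θ,dγ;u) - q(θ;u) Φ(θ) ≤ λ Φ(θ) + κ₀ 1_{B₀}(θ)` for all `θ` and `u`.
The integral is required to be finite. -/
def DriftCondition {S A : Type*} [MeasurableSpace S] [TopologicalSpace S]
    (q : A → S → ℝ≥0) (Q : A → S → Measure S) : Prop :=
  ∃ (Φ : S → ℝ) (B₀ : Set S) (lam κ₀ : ℝ),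
    (∀ θ, 1 ≤ Φ θ) ∧ IsCompactFunction Φ ∧ IsCompact B₀ ∧ MeasurableSet B₀ ∧ 0 < lam ∧
    ∀ θ a, Integrable Φ (Q a θ) ∧
      ∫ γ, Φ γ ∂(Q a θ) - q a θ * Φ θ ≤ lam * Φ θ + κ₀ * B₀.indicator (fun _ => (1 : ℝ)) θ

/-- `q(θ;m) = ∫ q(θ;u) m(du)` for a probability measure `m` on the action space. -/
def rateAvg {S A : Type*} [MeasurableSpace A] (q : A → S → ℝ≥0)
    (θ : S) (m : ProbabilityMeasure A) : ℝ :=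
  (∫⁻ a, (q a θ : ℝ≥0∞) ∂(m : Measure A)).toReal

/-- `q(θ,B;m) = ∫ q(θ,B;u) m(du)` for a probability measure `m` on the action space. -/
def kernelAvg {S A : Type*} [MeasurableSpace S] [MeasurableSpace A] (Q : A → S → Measure S)
    (θ : S) (B : Set S) (m : ProbabilityMeasure A) : ℝ :=
  (∫⁻ a, Q a θ B ∂(m : Measure A)).toReal

/-! ### `ψ`-relaxed controls -/

/-- The conditional law `μ_t(· | Λ_t = θ') = E[μ_t(·) | Λ_t = θ']` given the event
`{Λ_t = θ'}`, for a random probability measure `m = μ_t` and a random state `x = Λ_t`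
(meaningful when the event has positive probability). -/
def condLaw {Ω S A : Type*} [MeasurableSpace Ω] [MeasurableSpace A] (P : Measure Ω)
    (x : Ω → S) (m : Ω → ProbabilityMeasure A) (θ' : S) : Measure A :=
  (P[|{ω | x ω = θ'}]).bind fun ω => (m ω : Measure A)

/-- A `ψ`-relaxed control `(Ω, 𝓕, 𝓕_t, P, Λ_t, μ_t, s, θ)` with action space `A`. The processes
live on `[s,T]` (only these times matter). -/
structure RelaxedControl {S : Type u} [TopologicalSpace S] [MeasurableSpace S]
    {A : Type w} [MeasurableSpace A] [PseudoEMetricSpace A]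
    (T : ℝ) (ψ : ℝ → ℝ) (q : A → S → ℝ≥0) (Q : A → S → Measure S) (s : ℝ) (θ : S) where
  time_mem : s ∈ Icc 0 T
  Ω : Type v
  [mΩ : MeasurableSpace Ω]
  P : Measure Ω
  [prob : IsProbabilityMeasure P]
  /-- the filtration `(𝓕_t)`, `t ∈ [0,T]`, which satisfies the usual conditions -/
  F : Filtration (Icc (0 : ℝ) T) mΩ
  rightCont : F.IsRightContinuous
  null_mem : ∀ N, MeasurableSet N → P N = 0 → ∀ t, MeasurableSet[F t] N
  /-- the controlled state process `Λ_t` -/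
  state : ℝ → Ω → S
  /-- the control process `μ_t` -/
  ctrl : ℝ → Ω → ProbabilityMeasure A
  /-- `μ_t` is measurable with respect to `σ(Λ_t)` -/
  ctrl_adapted : ∀ t ∈ Icc s T, Measurable[MeasurableSpace.comap (state t) inferInstance] (ctrl t)
  ctrl_cadlag : ∀ᵐ ω ∂P, IsCadlagW1On (fun t => ctrl t ω) s T
  /-- There is a version `ν_t(·, θ')` of the conditional law `μ_t(· | Λ_t = θ')` (which is
  determined by `P` only if `P(Λ_t = θ') > 0`) with
  `w_{ν(·,θ')}([t₁,t₂)) ≤ ψ(t₂ - t₁)` for all `0 ≤ t₁ < t₂ ≤ T`. -/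
  ctrl_regular : ∀ θ' : S, ∃ ν : ℝ → ProbabilityMeasure A,
    (∀ t ∈ Icc s T, P {ω | state t ω = θ'} ≠ 0 →
      (ν t : Measure A) = condLaw P (state t) (ctrl t) θ') ∧
    ∀ t₁ t₂, 0 ≤ t₁ → t₁ < t₂ → t₂ ≤ T → oscIco ν t₁ t₂ ≤ ENNReal.ofReal (ψ (t₂ - t₁))
  state_adapted : ∀ t : Icc (0 : ℝ) T, s ≤ t → Measurable[F t] (state t)
  /-- `Λ` is a jump process: in the discrete space `S` a càdlàg path on `[s,T]` is a step function
  with finitely many jumps -/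
  state_cadlag : ∀ᵐ ω ∂P, IsCadlagOn (fun t => state t ω) s T
  state_init : ∀ᵐ ω ∂P, state s ω = θ
  /-- `P(Λ_{t+δ} ∈ B | Λ_t = θ', μ_t = m) - 1_B(θ')
  = (q(θ',B;m) - q(θ';m) 1_B(θ')) δ + o(δ)` as `δ ↓ 0`, where for given `θ'` and `B` the
  `o(δ)` is uniform in `t` -/
  transition : ∀ (θ' : S) (B : Set S), MeasurableSet B → ∀ ε > (0 : ℝ), ∃ δ₀ > (0 : ℝ),
    ∀ t δ : ℝ, s ≤ t → 0 < δ → δ ≤ δ₀ → t + δ ≤ T → ∀ m : ProbabilityMeasure A,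
      P {ω | state t ω = θ' ∧ ctrl t ω = m} ≠ 0 →
      |(P[{ω | state (t + δ) ω ∈ B} | {ω | state t ω = θ' ∧ ctrl t ω = m}]).toReal
          - B.indicator (fun _ => (1 : ℝ)) θ'
          - (kernelAvg Q θ' B m - rateAvg q θ' m * B.indicator (fun _ => (1 : ℝ)) θ') * δ|
        ≤ ε * δ

attribute [instance] RelaxedControl.mΩ RelaxedControl.prob

/-! ### Cost, value and optimality -/

/-- The extended-real integral `∫ h⁺ - ∫ h⁻` (well defined as soon as one of the two is finite, in
particular if `h` is bounded below and the measure is finite). -/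
def extIntegral {X : Type*} [MeasurableSpace X] (m : Measure X) (h : X → EReal) : EReal :=
  ((∫⁻ x, (h x).toENNReal ∂m : ℝ≥0∞) : EReal) - ((∫⁻ x, (-h x).toENNReal ∂m : ℝ≥0∞) : EReal)

section

variable {S : Type u} [TopologicalSpace S] [MeasurableSpace S]
  {A : Type w} [MeasurableSpace A] [PseudoEMetricSpace A]
  {T : ℝ} {ψ : ℝ → ℝ} {q : A → S → ℝ≥0} {Q : A → S → Measure S} {s : ℝ} {θ : S}

/-- The expected cost `J(s,θ,α) = E[∫_s^T f(t,Λ_t,μ_t) dt + g(Λ_T)]`, where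
`f(t,θ',m) = ∫ f(t,θ',u) m(du)`. -/
def cost (f : ℝ → S → A → ℝ) (g : S → ℝ) (α : RelaxedControl.{u, v, w} T ψ q Q s θ) : EReal :=
  extIntegral α.P fun ω =>
    extIntegral (volume.restrict (Icc s T)) (fun t =>
      extIntegral (α.ctrl t ω : Measure A) fun a => (f t (α.state t ω) a : EReal))
    + (g (α.state T ω) : EReal)

/-- The value `V(s,θ)`, the infimum of the expected cost over all `ψ`-relaxed controls. -/
def value (T : ℝ) (ψ : ℝ → ℝ) (q : A → S → ℝ≥0) (Q : A → S → Measure S)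
    (f : ℝ → S → A → ℝ) (g : S → ℝ) (s : ℝ) (θ : S) : EReal :=
  ⨅ α : RelaxedControl.{u, v, w} T ψ q Q s θ, cost f g α

/-- `α` is optimal: its expected cost equals the value. -/
def RelaxedControl.IsOptimal (α : RelaxedControl.{u, v, w} T ψ q Q s θ)
    (f : ℝ → S → A → ℝ) (g : S → ℝ) : Prop :=
  value.{u, v, w} T ψ q Q f g s θ = cost f g α

/-- The state process of `α` is a Markov process with respect to the filtration of `α`:
`P(Λ_r ∈ B | 𝓕_t) = P(Λ_r ∈ B | Λ_t)` a.s. for `s ≤ t ≤ r ≤ T`. -/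
def RelaxedControl.IsMarkov (α : RelaxedControl.{u, v, w} T ψ q Q s θ) : Prop :=
  ∀ t r : Icc (0 : ℝ) T, s ≤ t → t ≤ r → ∀ B : Set S, MeasurableSet B →
    α.P⟦{ω | α.state r ω ∈ B} | α.F t⟧ =ᵐ[α.P]
      α.P⟦{ω | α.state r ω ∈ B} | MeasurableSpace.comap (α.state t) inferInstance⟧

end

end CTMDP

end

/-!
The proof is the direct method, with controls replaced by their feedbacks. Since `μ_t` is
`σ(Λ_t)`-measurable, a control is given before time `T` by curves `ν(x, t)`, one for each state `x`,
whose modulus of continuity in the Wasserstein distance is `ψ` (`RelaxedControl.exists_feedback`).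
As the action space is compact and `ψ` vanishes at `0`, sequences of countable families of such
curves have pointwise convergent subsequences, and the limits again have modulus `ψ`
(`exists_subseq_tendsto_of_hasModulus`).

Conversely, every such family is the feedback of a control with Markovian state process
(`exists_relaxedControl`). The rates are bounded by some `M`, so the state process can be built by
uniformization: jumps are attempted at the times of a Poisson process of rate `M`, and the next
state is drawn from a probability kernel, which may leave the state unchanged. The Markov property
follows from the renewal identity at the first jump and the lack of memory of the exponential law
(`jumpState_markov`); right-continuity of the paths extends it to the right-continuous augmented
filtration (`setLIntegral_rightCont`).

What links the two directions is that the state probabilities `p_t(x) = P(Λ_t = x)` of any control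
solve the Kolmogorov forward equation of its feedback (`RelaxedControl.forwardMap_expProb`). The
transition condition is uniform in time but not in the state, so that it gives directly only the
inequality in which the inflow from finitely many states is counted; passing to all states and
comparing total masses turns this into an equality. For the weighted probabilities
`exp (M t) p_t(x)` the equation has nonnegative coefficients. Hence, by Fatou's lemma, lower limits
of solutions along convergent feedbacks are supersolutions for the limit (`forwardMap_liminf_le`),
and by a Gronwall argument solutions lie below supersolutions (`le_of_forwardMap_le`). Therefore
`p_t(x)` is lower semicontinuous in the feedback (`RelaxedControl.stateProb_le_liminf`).

Up to additive constants the expected cost is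
`∫ ∑ₓ p_t(x) f(t, x, ν(x, t)) dt + ∑ₓ p_T(x) g(x)` with nonnegative `f` and `g`
(`RelaxedControl.cost_eq_distCost`). Lower semicontinuity of `f` in the action passes to relaxed
actions by the portmanteau theorem, so the cost is lower semicontinuous in the feedback
(`RelaxedControl.distCost_le_liminf`), and the control built from the limit of a minimizing sequence
of feedbacks is optimal. Compactness is needed for the feedbacks only: as the limiting state
probabilities have total mass one, the lower bound by comparison already excludes that mass escapes
to infinity along the minimizing sequence.
-/

noncomputable section
namespace CTMDP

set_option linter.unusedSectionVars false

/-! ### Curves of probability measures with a given modulus -/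

section Wasserstein

variable {A : Type*} [MetricSpace A] [CompactSpace A] [MeasurableSpace A] [BorelSpace A]

/-- The set of pairs at Wasserstein distance at most `c` is weakly closed: it is an intersection of
images of compact sets of couplings. -/
theorem isClosed_setOf_W1_le (c : ℝ≥0∞) :
    IsClosed {p : ProbabilityMeasure A × ProbabilityMeasure A | W1 p.1 p.2 ≤ c} := by
  rcases eq_or_ne c ∞ with rfl | hc
  · simp
  let marg : ProbabilityMeasure (A × A) → ProbabilityMeasure A × ProbabilityMeasure A := fun π =>
    (π.map (f := Prod.fst) (by fun_prop), π.map (f := Prod.snd) (by fun_prop))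
  have hmarg : Continuous marg := by
    refine Continuous.prodMk ?_ ?_
    · exact ProbabilityMeasure.continuous_map continuous_fst
    · exact ProbabilityMeasure.continuous_map continuous_snd
  let φ : BoundedContinuousFunction (A × A) ℝ≥0 :=
    BoundedContinuousFunction.mkOfCompact ⟨fun p => nndist p.1 p.2, by fun_prop⟩
  have hφ : ∀ π : ProbabilityMeasure (A × A),
      ∫⁻ p, edist p.1 p.2 ∂(π : Measure (A × A)) = ∫⁻ p, φ p ∂(π : Measure (A × A)) := by
    intro π
    exact lintegral_congr fun p => edist_nndist _ _
  have hcl : ∀ d : ℝ≥0∞, IsClosed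
      {π : ProbabilityMeasure (A × A) | ∫⁻ p, edist p.1 p.2 ∂(π : Measure (A × A)) ≤ d} := by
    intro d
    simp_rw [hφ]
    refine isClosed_le ?_ continuous_const
    refine continuous_iff_continuousAt.2 fun π => ?_
    exact (ProbabilityMeasure.tendsto_iff_forall_lintegral_tendsto.1 tendsto_id) φ
  have heq : {p : ProbabilityMeasure A × ProbabilityMeasure A | W1 p.1 p.2 ≤ c} =
      ⋂ n : ℕ, marg '' {π | ∫⁻ p, edist p.1 p.2 ∂(π : Measure (A × A)) ≤ c + (n + 1 : ℝ≥0∞)⁻¹} := by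
    ext ⟨μ, ν⟩
    simp only [mem_ofPred_eq, mem_iInter, mem_image]
    have hm : ∀ π : ProbabilityMeasure (A × A), marg π = (μ, ν) ↔
        (π : Measure (A × A)).map Prod.fst = (μ : Measure A) ∧
          (π : Measure (A × A)).map Prod.snd = (ν : Measure A) := by
      intro π
      rw [Prod.mk.injEq]
      exact and_congr (Subtype.ext_iff (a1 := π.map _)) (Subtype.ext_iff (a1 := π.map _))
    constructor
    · intro h n
      have h1 : W1 μ ν < c + (n + 1 : ℝ≥0∞)⁻¹ :=
        h.trans_lt (ENNReal.lt_add_right hc (by simp))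
      simp only [W1, iInf_lt_iff] at h1
      obtain ⟨π, hπ, hlt⟩ := h1
      exact ⟨π, hlt.le, (hm π).2 hπ⟩
    · intro h
      have h2 : Tendsto (fun n : ℕ => c + (n + 1 : ℝ≥0∞)⁻¹) atTop (𝓝 (c + 0)) := by
        refine tendsto_const_nhds.add ?_
        have := (tendsto_add_atTop_iff_nat 1).2 ENNReal.tendsto_inv_nat_nhds_zero
        simpa using this
      rw [add_zero] at h2
      refine ge_of_tendsto' h2 fun n => ?_
      obtain ⟨π, hle, hπ⟩ := h n
      exact (iInf₂_le π ((hm π).1 hπ)).trans hle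
  rw [heq]
  exact isClosed_iInter fun n => ((hcl _).isCompact.image hmarg).isClosed

/-- The easy half of Kantorovich duality. -/
theorem ofReal_abs_integral_sub_le_W1 {φ : A → ℝ} {L : ℝ≥0} (hφ : LipschitzWith L φ) (hL : L ≠ 0)
    (μ ν : ProbabilityMeasure A) :
    ENNReal.ofReal |∫ a, φ a ∂(μ : Measure A) - ∫ a, φ a ∂(ν : Measure A)| ≤ L * W1 μ ν := by
  have hint : ∀ (m : Measure (A × A)) [IsFiniteMeasure m] (g : A × A → ℝ), Continuous g →
      Integrable g m := fun m _ g hg =>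
    BoundedContinuousFunction.integrable m (BoundedContinuousFunction.mkOfCompact ⟨g, hg⟩)
  simp_rw [W1, ENNReal.mul_iInf_of_ne (ENNReal.coe_ne_zero.2 hL) ENNReal.coe_ne_top]
  refine le_iInf₂ fun π hπ => ?_
  have hc := hφ.continuous
  rw [← hπ.1, ← hπ.2, integral_map measurable_fst.aemeasurable hc.aestronglyMeasurable,
    integral_map measurable_snd.aemeasurable hc.aestronglyMeasurable,
    ← integral_sub (hint _ _ (by fun_prop)) (hint _ _ (by fun_prop)),
    ← lintegral_const_mul _ (by fun_prop), ← Real.norm_eq_abs, ofReal_norm]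
  refine (enorm_integral_le_lintegral_enorm _).trans (lintegral_mono fun p => ?_)
  rw [← edist_eq_enorm_sub]
  exact hφ p.1 p.2

theorem tendsto_of_tendsto_W1 {ι : Type*} {l : Filter ι} [l.IsCountablyGenerated]
    {μ : ι → ProbabilityMeasure A} {ν : ProbabilityMeasure A}
    (h : Tendsto (fun i => W1 (μ i) ν) l (𝓝 0)) : Tendsto μ l (𝓝 ν) := by
  rw [tendsto_iff_forall_lipschitz_integral_tendsto]
  rintro φ - ⟨L', hL'⟩
  obtain ⟨L, hL, hL0⟩ : ∃ L, LipschitzWith L φ ∧ L ≠ 0 :=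
    ⟨L' + 1, hL'.weaken (by simp), by simp⟩
  rw [tendsto_iff_dist_tendsto_zero]
  have h1 : Tendsto (fun i => (L : ℝ≥0∞) * W1 (μ i) ν) l (𝓝 0) := by
    simpa using ENNReal.Tendsto.const_mul h (Or.inr ENNReal.coe_ne_top)
  have h2 := tendsto_of_tendsto_of_tendsto_of_le_of_le tendsto_const_nhds h1 (fun _ => zero_le)
    (fun i => ofReal_abs_integral_sub_le_W1 hL hL0 (μ i) ν)
  have h3 := (ENNReal.tendsto_toReal ENNReal.zero_ne_top).comp h2
  simpa [Function.comp_def, Real.dist_eq, abs_nonneg] using h3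

/-- The global form of the regularity condition on control curves: `W₁(ν_t, ν_r) ≤ ψ(h)` as soon
as `|t - r| < h ≤ T`, for all real times `t`, `r`. -/
def HasModulus (T : ℝ) (ψ : ℝ → ℝ) (ν : ℝ → ProbabilityMeasure A) : Prop :=
  ∀ t r h, |t - r| < h → h ≤ T → W1 (ν t) (ν r) ≤ ENNReal.ofReal (ψ h)

theorem tendsto_ofReal_nhdsGT_zero {ψ : ℝ → ℝ} (hψ : Tendsto ψ (𝓝[>] 0) (𝓝 0)) :
    Tendsto (fun h => ENNReal.ofReal (ψ h)) (𝓝[>] 0) (𝓝 0) := by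
  simpa [Function.comp_def] using (ENNReal.continuous_ofReal.tendsto 0).comp hψ

/-- Small moduli are attained by some admissible step `h ≤ T`. -/
theorem exists_modulus_lt {T : ℝ} (hT : 0 < T) {ψ : ℝ → ℝ} (hψ : Tendsto ψ (𝓝[>] 0) (𝓝 0))
    {ε : ℝ≥0∞} (hε : 0 < ε) : ∃ h, 0 < h ∧ h ≤ T ∧ ENNReal.ofReal (ψ h) < ε := by
  have h1 := (tendsto_ofReal_nhdsGT_zero hψ).eventually_lt_const hε
  have h2 : ∀ᶠ h in 𝓝[>] (0 : ℝ), 0 < h ∧ h ≤ T := by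
    filter_upwards [Ioc_mem_nhdsGT hT] with h hh using ⟨hh.1, hh.2⟩
  obtain ⟨h, hh, hh'⟩ := (h1.and h2).exists
  exact ⟨h, hh'.1, hh'.2, hh⟩

theorem HasModulus.tendsto_W1 {T : ℝ} (hT : 0 < T) {ψ : ℝ → ℝ} (hψ : Tendsto ψ (𝓝[>] 0) (𝓝 0))
    {ν : ℝ → ProbabilityMeasure A} (hν : HasModulus T ψ ν) (t : ℝ) :
    Tendsto (fun r => W1 (ν r) (ν t)) (𝓝 t) (𝓝 0) := by
  refine ENNReal.tendsto_nhds_zero.2 fun ε hε => ?_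
  obtain ⟨h, h0, hT', hlt⟩ := exists_modulus_lt hT hψ hε
  filter_upwards [Metric.ball_mem_nhds t h0] with r hr
  exact (hν r t h (by simpa [Real.dist_eq] using hr) hT').trans hlt.le

theorem HasModulus.continuous {T : ℝ} (hT : 0 < T) {ψ : ℝ → ℝ} (hψ : Tendsto ψ (𝓝[>] 0) (𝓝 0))
    {ν : ℝ → ProbabilityMeasure A} (hν : HasModulus T ψ ν) : Continuous ν :=
  continuous_iff_continuousAt.2 fun t => tendsto_of_tendsto_W1 (hν.tendsto_W1 hT hψ t)

theorem HasModulus.oscIco_le {T : ℝ} {ψ : ℝ → ℝ} {ν : ℝ → ProbabilityMeasure A}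
    (hν : HasModulus T ψ ν) {t₁ t₂ : ℝ} (h : t₂ - t₁ ≤ T) :
    oscIco ν t₁ t₂ ≤ ENNReal.ofReal (ψ (t₂ - t₁)) := by
  refine iSup₂_le fun t ht => iSup₂_le fun r hr => hν t r _ ?_ h
  rw [abs_lt]
  constructor <;> linarith [ht.1, ht.2, hr.1, hr.2]

theorem W1_self (μ : ProbabilityMeasure A) : W1 μ μ = 0 := by
  refine le_antisymm ?_ zero_le
  refine (iInf₂_le (⟨(μ : Measure A).map fun a => (a, a),
    Measure.isProbabilityMeasure_map (by fun_prop)⟩ : ProbabilityMeasure (A × A)) ⟨?_, ?_⟩).trans ?_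
  · change ∫⁻ p, edist p.1 p.2 ∂((μ : Measure A).map fun a => (a, a)) ≤ 0
    rw [lintegral_map (by fun_prop) (by fun_prop)]
    simp
  · change ((μ : Measure A).map fun a => (a, a)).map Prod.fst = _
    rw [Measure.map_map (by fun_prop) (by fun_prop)]
    exact Measure.map_id
  · change ((μ : Measure A).map fun a => (a, a)).map Prod.snd = _
    rw [Measure.map_map (by fun_prop) (by fun_prop)]
    exact Measure.map_id

theorem hasModulus_const (T : ℝ) (ψ : ℝ → ℝ) (μ : ProbabilityMeasure A) :
    HasModulus T ψ fun _ => μ := fun _ _ _ _ _ => by simp [W1_self]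

/-- A limit of curves with modulus `ψ` along an arbitrary filter has modulus `ψ`. -/
theorem hasModulus_of_tendsto {ι : Type*} {l : Filter ι} [l.NeBot] {T : ℝ} {ψ : ℝ → ℝ}
    {ν : ι → ℝ → ProbabilityMeasure A} {ν' : ℝ → ProbabilityMeasure A}
    (hν : ∀ i, HasModulus T ψ (ν i)) (h : ∀ t, Tendsto (fun i => ν i t) l (𝓝 (ν' t))) :
    HasModulus T ψ ν' := fun t r d hd hT =>
  (isClosed_setOf_W1_le (ENNReal.ofReal (ψ d))).mem_of_tendsto ((h t).prodMk_nhds (h r))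
    (Eventually.of_forall fun i => hν i t r d hd hT)

/-- A curve on `[0,T]` whose oscillation is controlled on half-open intervals agrees on `[0,T)` with
a curve on the whole line with modulus `ψ`: it is continued to `T` by its left limit and
constantly outside `[0,T]`. -/
theorem exists_hasModulus_of_oscIco_le {T : ℝ} (hT : 0 < T) {ψ : ℝ → ℝ}
    {ν : ℝ → ProbabilityMeasure A}
    (hν : ∀ t₁ t₂, 0 ≤ t₁ → t₁ < t₂ → t₂ ≤ T → oscIco ν t₁ t₂ ≤ ENNReal.ofReal (ψ (t₂ - t₁))) :
    ∃ ν', HasModulus T ψ ν' ∧ ∀ t ∈ Ico 0 T, ν' t = ν t := by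
  -- the curves stopped at times increasing to `T`
  have hfrozen : ∀ b ∈ Ico 0 T, HasModulus T ψ fun t => ν (max 0 (min t b)) := by
    intro b hb t r h hlt hh
    set t' := max 0 (min t b)
    set r' := max 0 (min r b)
    have h1 : |t' - r'| < h := by
      refine lt_of_le_of_lt ?_ hlt
      refine (abs_max_sub_max_le_max _ _ _ _).trans ?_
      rw [sub_self, abs_zero, max_eq_right (abs_nonneg _)]
      refine (abs_min_sub_min_le_max _ _ _ _).trans ?_
      simp
    have h2 : ∀ x, max 0 (min x b) ∈ Ico 0 T := fun x =>
      ⟨le_max_left _ _, max_lt (hb.1.trans_lt hb.2) ((min_le_right _ _).trans_lt hb.2)⟩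
    have ht := h2 t
    have hr := h2 r
    have h0 : 0 < h := (abs_nonneg _).trans_lt hlt
    rw [abs_lt] at h1
    have key : ∀ t₂, t₂ ≤ T → h ≤ t₂ → t' < t₂ → r' < t₂ → t₂ ≤ t' + h → t₂ ≤ r' + h →
        W1 (ν t') (ν r') ≤ ENNReal.ofReal (ψ h) := by
      intro t₂ h3 h4 h5 h6 h7 h8
      have := hν (t₂ - h) t₂ (by linarith) (by linarith) h3
      rw [sub_sub_cancel] at this
      refine le_trans ?_ this
      exact le_iSup₂_of_le t' ⟨by linarith, h5⟩ (le_iSup₂_of_le r' ⟨by linarith, h6⟩ le_rfl)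
    rcases le_total t' r' with hle | hle
    · refine key (min T (t' + h)) (min_le_left _ _) (le_min hh (by linarith [ht.1]))
        (lt_min ht.2 (by linarith)) (lt_min hr.2 (by linarith)) (min_le_right _ _)
        ((min_le_right _ _).trans (by linarith))
    · refine key (min T (r' + h)) (min_le_left _ _) (le_min hh (by linarith [hr.1]))
        (lt_min ht.2 (by linarith)) (lt_min hr.2 (by linarith))
        ((min_le_right _ _).trans (by linarith)) (min_le_right _ _)
  let b : ℕ → ℝ := fun n => T - T * (n + 1 : ℝ)⁻¹
  have hn : ∀ n : ℕ, (0 : ℝ) < (n + 1 : ℝ)⁻¹ ∧ (n + 1 : ℝ)⁻¹ ≤ 1 := fun n =>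
    ⟨by positivity, inv_le_one_of_one_le₀ (by linarith [n.cast_nonneg (α := ℝ)])⟩
  have hb : ∀ n, b n ∈ Ico 0 T := fun n =>
    ⟨by simp only [b]; nlinarith [(hn n).2], by simp only [b]; nlinarith [(hn n).1]⟩
  have hbT : Tendsto b atTop (𝓝 T) := by
    have : Tendsto (fun n : ℕ => T - T * (n + 1 : ℝ)⁻¹) atTop (𝓝 (T - T * 0)) := by
      refine tendsto_const_nhds.sub (tendsto_const_nhds.mul ?_)
      simpa using tendsto_one_div_add_atTop_nhds_zero_nat (𝕜 := ℝ)
    simpa using this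
  let l : Ultrafilter ℕ := Ultrafilter.of atTop
  have hl : (l : Filter ℕ) ≤ atTop := Ultrafilter.of_le _
  have hlim : ∀ t, ∃ μ, Tendsto (fun n => ν (max 0 (min t (b n)))) l (𝓝 μ) := fun t => by
    obtain ⟨μ, -, hμ⟩ := isCompact_univ.ultrafilter_le_nhds
      (l.map fun n => ν (max 0 (min t (b n)))) (by simp)
    exact ⟨μ, hμ⟩
  choose ν' hν' using hlim
  refine ⟨ν', hasModulus_of_tendsto (fun n => hfrozen (b n) (hb n)) hν', fun t ht => ?_⟩
  refine tendsto_nhds_unique (hν' t) (Tendsto.congr' ?_ tendsto_const_nhds)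
  filter_upwards [hl (hbT.eventually_const_lt ht.2)] with n hn
  rw [min_eq_left hn.le, max_eq_right ht.1]

/-- Compactness of the set of families of curves with modulus `ψ`. -/
theorem exists_subseq_tendsto_of_hasModulus {S : Type*} [Countable S] {T : ℝ} (hT : 0 < T)
    {ψ : ℝ → ℝ} (hψ : Tendsto ψ (𝓝[>] 0) (𝓝 0)) {ν : ℕ → S → ℝ → ProbabilityMeasure A}
    (hν : ∀ n x, HasModulus T ψ (ν n x)) :
    ∃ ν' : S → ℝ → ProbabilityMeasure A, (∀ x, HasModulus T ψ (ν' x)) ∧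
      ∃ φ : ℕ → ℕ, StrictMono φ ∧ ∀ x t, Tendsto (fun n => ν (φ n) x t) atTop (𝓝 (ν' x t)) := by
  let ρ : ℕ → S × ℚ → ProbabilityMeasure A := fun n p => ν n p.1 p.2
  obtain ⟨ρ', φ, hφ, hρ⟩ := CompactSpace.tendsto_subseq ρ
  rw [tendsto_pi_nhds] at hρ
  -- Along an ultrafilter the limit exists at all times; by equicontinuity it is a limit
  -- along the sequence.
  let l : Ultrafilter ℕ := Ultrafilter.of atTop
  have hl : (l : Filter ℕ) ≤ atTop := Ultrafilter.of_le _
  have hlim : ∀ x t, ∃ μ, Tendsto (fun n => ν (φ n) x t) l (𝓝 μ) := fun x t => by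
    obtain ⟨μ, -, hμ⟩ := isCompact_univ.ultrafilter_le_nhds (l.map fun n => ν (φ n) x t) (by simp)
    exact ⟨μ, hμ⟩
  choose ν' hν' using hlim
  have hmod : ∀ x, HasModulus T ψ (ν' x) := fun x =>
    hasModulus_of_tendsto (fun n => hν (φ n) x) (hν' x)
  refine ⟨ν', hmod, φ, hφ, fun x t => ?_⟩
  rw [tendsto_iff_forall_lipschitz_integral_tendsto]
  rintro f - ⟨L', hL'⟩
  obtain ⟨L, hL, hL0⟩ : ∃ L, LipschitzWith L f ∧ L ≠ 0 :=
    ⟨L' + 1, hL'.weaken (by simp), by simp⟩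
  rw [Metric.tendsto_atTop]
  intro ε hε
  obtain ⟨h, h0, hhT, hlt⟩ := exists_modulus_lt hT hψ
    (ε := ENNReal.ofReal (ε / 3) / L) (ENNReal.div_pos (by simpa using hε) ENNReal.coe_ne_top)
  obtain ⟨p, hp1, hp2⟩ := exists_rat_btwn (show t < t + h by linarith)
  have hclose : ∀ m : ℝ → ProbabilityMeasure A, HasModulus T ψ m →
      |∫ a, f a ∂(m t : Measure A) - ∫ a, f a ∂(m p : Measure A)| < ε / 3 := by
    intro m hm
    have h1 : W1 (m t) (m p) < ENNReal.ofReal (ε / 3) / L := by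
      refine (hm t p h ?_ hhT).trans_lt hlt
      rw [abs_lt]; constructor <;> linarith
    have h2 := (ofReal_abs_integral_sub_le_W1 hL hL0 (m t) (m p)).trans_lt
      ((ENNReal.mul_lt_mul_iff_right (ENNReal.coe_ne_zero.2 hL0) ENNReal.coe_ne_top).2 h1)
    rw [ENNReal.mul_div_cancel (ENNReal.coe_ne_zero.2 hL0) ENNReal.coe_ne_top] at h2
    exact (ENNReal.ofReal_lt_ofReal_iff (by positivity)).1 h2
  have hrat : ν' x p = ρ' (x, p) := tendsto_nhds_unique (hν' x p) ((hρ (x, p)).mono_left hl)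
  have hconv := (tendsto_iff_forall_lipschitz_integral_tendsto.1 (hρ (x, p))) f
    ⟨L * Metric.diam (univ : Set A), fun y z => ?_⟩ ⟨L, hL⟩
  · rw [Metric.tendsto_atTop] at hconv
    obtain ⟨N, hN⟩ := hconv (ε / 3) (by positivity)
    refine ⟨N, fun n hn => ?_⟩
    have h1 := hclose _ (hν (φ n) x)
    have h2 := hclose _ (hmod x)
    have h3 := hN n hn
    rw [← hrat] at h3
    simp only [Real.dist_eq, Function.comp, ρ] at h3 ⊢
    rw [abs_lt] at *
    constructor <;> linarith [h1.1, h1.2, h2.1, h2.2, h3.1, h3.2]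
  · refine (hL.dist_le_mul y z).trans ?_
    have := Metric.dist_le_diam_of_mem (isCompact_univ (X := A)).isBounded (mem_univ y) (mem_univ z)
    exact mul_le_mul_of_nonneg_left this L.coe_nonneg

end Wasserstein

/-! ### Uniformized transition rates -/

section Rates

variable {S : Type*} [Countable S] [MeasurableSpace S] [MeasurableSingletonClass S]
  {A : Type*} [MetricSpace A] [CompactSpace A] [MeasurableSpace A] [BorelSpace A]

/-- The averaged jump measure `q(x, ·; m) = ∫ q(x, ·; a) m(da)`. -/
def avgQ (Q : A → S → Measure S) (x : S) (m : ProbabilityMeasure A) : Measure S :=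
  (m : Measure A).bind fun a => Q a x

/-- The uniformized jump measure `q(x, ·; m) + (M - q(x; m)) δ_x`, of total mass `M`. -/
def uniQ (M : ℝ≥0) (Q : A → S → Measure S) (x : S) (m : ProbabilityMeasure A) : Measure S :=
  avgQ Q x m + (M - avgQ Q x m univ) • Measure.dirac x

/-- The uniformized transition probability `uniQ / M`. -/
def uniK (M : ℝ≥0) (Q : A → S → Measure S) (x : S) (m : ProbabilityMeasure A) : Measure S :=
  (M : ℝ≥0∞)⁻¹ • uniQ M Q x m

variable {M : ℝ≥0} {Q : A → S → Measure S}

theorem avgQ_apply (hQ : ∀ x B, MeasurableSet B → Continuous fun a => Q a x B) (x : S)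
    (m : ProbabilityMeasure A) (B : Set S) : avgQ Q x m B = ∫⁻ a, Q a x B ∂(m : Measure A) :=
  Measure.bind_apply .of_discrete
    (Measure.measurable_of_measurable_coe _ fun B hB => (hQ x B hB).measurable).aemeasurable

theorem avgQ_univ_le (hQ : ∀ x B, MeasurableSet B → Continuous fun a => Q a x B)
    (hM : ∀ a x, Q a x univ ≤ M) (x : S) (m : ProbabilityMeasure A) : avgQ Q x m univ ≤ M := by
  rw [avgQ_apply hQ]
  exact (lintegral_mono fun a => hM a x).trans (by simp)

theorem continuous_avgQ (hQ : ∀ x B, MeasurableSet B → Continuous fun a => Q a x B)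
    (hM : ∀ a x, Q a x univ ≤ M) (x : S) (B : Set S) : Continuous fun m => avgQ Q x m B := by
  have hfin : ∀ a, Q a x B ≠ ∞ := fun a =>
    ((measure_mono (subset_univ B)).trans (hM a x)).trans_lt ENNReal.coe_lt_top |>.ne
  let φ : BoundedContinuousFunction A ℝ≥0 := BoundedContinuousFunction.mkOfCompact
    ⟨fun a => (Q a x B).toNNReal, continuous_iff_continuousAt.2 fun a =>
      (ENNReal.tendsto_toNNReal (hfin a)).comp (hQ x B .of_discrete).continuousAt⟩
  have h : ∀ m, avgQ Q x m B = ∫⁻ a, φ a ∂(m : Measure A) := fun m => by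
    rw [avgQ_apply hQ]
    exact lintegral_congr fun a => (ENNReal.coe_toNNReal (hfin a)).symm
  simp_rw [h]
  refine continuous_iff_continuousAt.2 fun m => ?_
  exact (ProbabilityMeasure.tendsto_iff_forall_lintegral_tendsto.1 tendsto_id) φ

theorem uniQ_apply (x : S) (m : ProbabilityMeasure A) (B : Set S) :
    uniQ M Q x m B = avgQ Q x m B + (M - avgQ Q x m univ) * B.indicator 1 x := by
  simp [uniQ]

theorem uniQ_univ (hQ : ∀ x B, MeasurableSet B → Continuous fun a => Q a x B)
    (hM : ∀ a x, Q a x univ ≤ M) (x : S) (m : ProbabilityMeasure A) : uniQ M Q x m univ = M := by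
  rw [uniQ_apply]
  simp [add_tsub_cancel_of_le (avgQ_univ_le hQ hM x m)]

theorem continuous_uniQ (hQ : ∀ x B, MeasurableSet B → Continuous fun a => Q a x B)
    (hM : ∀ a x, Q a x univ ≤ M) (x : S) (B : Set S) : Continuous fun m => uniQ M Q x m B := by
  simp_rw [uniQ_apply]
  refine (continuous_avgQ hQ hM x B).add ?_
  refine (ENNReal.continuous_mul_const ?_).comp ((ENNReal.continuous_sub_left
    ENNReal.coe_ne_top).comp (continuous_avgQ hQ hM x univ))
  by_cases h : x ∈ B <;> simp [h]

theorem uniQ_apply_ne_top (hQ : ∀ x B, MeasurableSet B → Continuous fun a => Q a x B)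
    (hM : ∀ a x, Q a x univ ≤ M) (x : S) (m : ProbabilityMeasure A) (B : Set S) :
    uniQ M Q x m B ≠ ∞ :=
  ((measure_mono (subset_univ B)).trans (uniQ_univ hQ hM x m).le).trans_lt
    ENNReal.coe_lt_top |>.ne

theorem uniK_apply (x : S) (m : ProbabilityMeasure A) (B : Set S) :
    uniK M Q x m B = (M : ℝ≥0∞)⁻¹ * uniQ M Q x m B := rfl

theorem isProbabilityMeasure_uniK (hQ : ∀ x B, MeasurableSet B → Continuous fun a => Q a x B)
    (hM : ∀ a x, Q a x univ ≤ M) (hM0 : M ≠ 0) (x : S) (m : ProbabilityMeasure A) :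
    IsProbabilityMeasure (uniK M Q x m) :=
  ⟨by rw [uniK_apply, uniQ_univ hQ hM, ENNReal.inv_mul_cancel (by simpa) (by simp)]⟩

theorem continuous_uniK (hQ : ∀ x B, MeasurableSet B → Continuous fun a => Q a x B)
    (hM : ∀ a x, Q a x univ ≤ M) (hM0 : M ≠ 0) (x : S) (B : Set S) :
    Continuous fun m => uniK M Q x m B := by
  simp_rw [uniK_apply]
  exact ENNReal.continuous_const_mul (by simpa) |>.comp (continuous_uniQ hQ hM x B)

/-- The relation between the uniformized rates and the rates in the transition condition of a
relaxed control. -/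
theorem toReal_uniQ (hQ : ∀ x B, MeasurableSet B → Continuous fun a => Q a x B)
    (hM : ∀ a x, Q a x univ ≤ M) {q : A → S → ℝ≥0} (hq : ∀ a x, Q a x univ = q a x)
    (x : S) (m : ProbabilityMeasure A) (B : Set S) :
    (uniQ M Q x m B).toReal =
      kernelAvg Q x B m + (M - rateAvg q x m) * B.indicator (fun _ => (1 : ℝ)) x := by
  have h1 : rateAvg q x m = (avgQ Q x m univ).toReal := by
    rw [avgQ_apply hQ, rateAvg]
    simp_rw [hq]
  have hle := avgQ_univ_le hQ hM x m
  have h2 : avgQ Q x m B ≠ ∞ :=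
    ((measure_mono (subset_univ B)).trans hle).trans_lt ENNReal.coe_lt_top |>.ne
  have h3 : kernelAvg Q x B m = (avgQ Q x m B).toReal := by rw [avgQ_apply hQ, kernelAvg]
  rw [uniQ_apply, h1, h3, ENNReal.toReal_add h2, ENNReal.toReal_mul,
    ENNReal.toReal_sub_of_le hle ENNReal.coe_ne_top, ENNReal.coe_toReal]
  · by_cases h : x ∈ B <;> simp [h]
  · refine ENNReal.mul_ne_top (ENNReal.sub_ne_top ENNReal.coe_ne_top) ?_
    by_cases h : x ∈ B <;> simp [h]

/-- The jump kernel `(t, x) ↦ uniK x (ν x t)` of the uniformized chain controlled by the feedback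
`ν`. -/
def jumpKernel (M : ℝ≥0) (Q : A → S → Measure S) (hQ : ∀ x B, MeasurableSet B →
    Continuous fun a => Q a x B) (hM : ∀ a x, Q a x univ ≤ M) (hM0 : M ≠ 0)
    (ν : S → ℝ → ProbabilityMeasure A) (hν : ∀ x, Continuous (ν x)) : Kernel (ℝ × S) S where
  toFun p := uniK M Q p.2 (ν p.2 p.1)
  measurable' := by
    refine measurable_from_prod_countable_left fun x => ?_
    exact Measure.measurable_of_measurable_coe _ fun B _ =>
      ((continuous_uniK hQ hM hM0 x B).comp (hν x)).measurable

end Rates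

/-! ### Random inputs of the jump process -/

section Noise

/-- The random input used at one jump: a waiting time and a uniform variable for the choice of the
next state. -/
abbrev Noise : Type v := ULift.{v} (ℝ × unitInterval)

/-- The law of the input of one jump: an exponential time of rate `M` and an independent uniform
variable. -/
def noise (M : ℝ) : Measure Noise.{v} :=
  ((expMeasure M).prod (volume : Measure unitInterval)).map ULift.up

/-- The law of an i.i.d. sequence of jump inputs. -/
def noiseSeq (M : ℝ) : Measure (ℕ → Noise.{v}) := Measure.infinitePi fun _ => noise M

/-- Prepend an element to a sequence. -/
def consSeq {E : Type*} (e : E) (ω : ℕ → E) : ℕ → E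
  | 0 => e
  | n + 1 => ω n

theorem measurable_consSeq {E : Type*} [MeasurableSpace E] :
    Measurable fun p : E × (ℕ → E) => consSeq p.1 p.2 := by
  refine measurable_pi_lambda _ fun n => ?_
  cases n with
  | zero => exact measurable_fst
  | succ n => exact (measurable_pi_apply n).comp measurable_snd

variable {M : ℝ}

theorem measurable_up : Measurable (ULift.up : ℝ × unitInterval → Noise.{v}) :=
  MeasurableEquiv.ulift.symm.measurable

theorem measurable_down : Measurable (ULift.down : Noise.{v} → ℝ × unitInterval) :=
  MeasurableEquiv.ulift.measurable

theorem isProbabilityMeasure_noise (hM : 0 < M) : IsProbabilityMeasure (noise.{v} M) := by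
  have := isProbabilityMeasure_expMeasure hM
  exact Measure.isProbabilityMeasure_map measurable_up.aemeasurable

theorem isProbabilityMeasure_noiseSeq (hM : 0 < M) : IsProbabilityMeasure (noiseSeq.{v} M) := by
  have := isProbabilityMeasure_noise.{v} hM
  exact inferInstanceAs (IsProbabilityMeasure (Measure.infinitePi _))

theorem map_consSeq (hM : 0 < M) :
    ((noise.{v} M).prod (noiseSeq M)).map (fun p => consSeq p.1 p.2) = noiseSeq M := by
  have := isProbabilityMeasure_noise.{v} hM
  have := isProbabilityMeasure_noiseSeq.{v} hM
  refine Measure.eq_infinitePi _ fun s t ht => ?_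
  classical
  rw [Measure.map_apply measurable_consSeq (MeasurableSet.pi s.countable_toSet fun i _ => ht i)]
  let s' : Finset ℕ := s.preimage Nat.succ Nat.succ_injective.injOn
  have h1 : (fun p : Noise.{v} × (ℕ → Noise.{v}) => consSeq p.1 p.2) ⁻¹' (s : Set ℕ).pi t =
      (if 0 ∈ s then t 0 else univ) ×ˢ (s' : Set ℕ).pi fun n => t (n + 1) := by
    ext ⟨e, ω⟩
    simp only [mem_preimage, Set.mem_pi, SetLike.mem_coe, mem_prod, s', Finset.mem_preimage]
    constructor
    · refine fun h => ⟨?_, fun i hi => h (i + 1) hi⟩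
      split_ifs with h0
      · exact h 0 h0
      · trivial
    · rintro ⟨h0, h⟩ i hi
      cases i with
      | zero => simpa [hi, consSeq] using h0
      | succ i => exact h i hi
  rw [h1, Measure.prod_prod, noiseSeq, Measure.infinitePi_pi _ fun i _ => ht (i + 1)]
  have h2 : s.erase 0 = s'.map ⟨Nat.succ, Nat.succ_injective⟩ := by
    ext i
    cases i <;> simp [s']
  by_cases h0 : 0 ∈ s
  · rw [if_pos h0, ← Finset.mul_prod_erase s _ h0, h2, Finset.prod_map]
    rfl
  · rw [if_neg h0, measure_univ, one_mul, ← Finset.erase_eq_of_notMem h0, h2, Finset.prod_map]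
    simp only [s']
    rfl

/-- Integration over the first input and the remaining ones. -/
theorem lintegral_noiseSeq (hM : 0 < M) {F : (ℕ → Noise.{v}) → ℝ≥0∞} (hF : Measurable F) :
    ∫⁻ ω, F ω ∂noiseSeq.{v} M = ∫⁻ e, ∫⁻ ω, F (consSeq e ω) ∂noiseSeq.{v} M ∂noise.{v} M := by
  have := isProbabilityMeasure_noise.{v} hM
  have := isProbabilityMeasure_noiseSeq.{v} hM
  conv_lhs => rw [← map_consSeq hM]
  rw [lintegral_map hF measurable_consSeq]
  exact lintegral_prod _ (hF.comp measurable_consSeq).aemeasurable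

theorem lintegral_noise (hM : 0 < M) {Φ : Noise.{v} → ℝ≥0∞} (hΦ : Measurable Φ) :
    ∫⁻ e, Φ e ∂noise.{v} M = ∫⁻ b, ∫⁻ a, Φ ⟨(a, b)⟩ ∂expMeasure M := by
  have := isProbabilityMeasure_expMeasure hM
  rw [noise, lintegral_map hΦ measurable_up]
  exact lintegral_prod_symm _ (hΦ.comp measurable_up).aemeasurable

theorem lintegral_noise_swap (hM : 0 < M) {Φ : Noise.{v} → ℝ≥0∞} (hΦ : Measurable Φ) :
    ∫⁻ e, Φ e ∂noise.{v} M = ∫⁻ a, ∫⁻ b, Φ ⟨(a, b)⟩ ∂volume ∂expMeasure M := by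
  have := isProbabilityMeasure_expMeasure hM
  rw [noise, lintegral_map hΦ measurable_up]
  exact lintegral_prod _ (hΦ.comp measurable_up).aemeasurable

theorem expMeasure_eq_withDensity (M : ℝ) :
    expMeasure M = volume.withDensity (exponentialPDF M) := rfl

/-- The exponential law has no memory. -/
theorem setLIntegral_Ioi_expMeasure {h : ℝ} (hh : 0 ≤ h) {φ : ℝ → ℝ≥0∞}
    (hφ : Measurable φ) :
    ∫⁻ x in Ioi h, φ x ∂expMeasure M =
      ENNReal.ofReal (Real.exp (-(M * h))) * ∫⁻ x, φ (x + h) ∂expMeasure M := by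
  have hm : Measurable (exponentialPDF M) :=
    ENNReal.measurable_ofReal.comp (measurable_exponentialPDFReal M)
  have hφ' : Measurable fun x => φ (x + h) := hφ.comp (measurable_add_const h)
  rw [expMeasure_eq_withDensity, ← lintegral_indicator measurableSet_Ioi,
    lintegral_withDensity_eq_lintegral_mul _ hm (hφ.indicator measurableSet_Ioi),
    lintegral_withDensity_eq_lintegral_mul _ hm hφ', ← lintegral_const_mul _ (hm.mul hφ'),
    ← lintegral_add_right_eq_self _ h]
  refine lintegral_congr_ae ?_
  filter_upwards [Measure.ae_ne volume (0 : ℝ)] with x hx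
  simp only [Pi.mul_apply, indicator_apply, mem_Ioi, exponentialPDF_eq]
  rcases lt_or_gt_of_ne hx with hx | hx
  · simp [hx.not_gt, hx.not_ge]
  · have h1 : M * Real.exp (-(M * (x + h))) =
        Real.exp (-(M * h)) * (M * Real.exp (-(M * x))) := by
      rw [show -(M * (x + h)) = -(M * h) + -(M * x) by ring, Real.exp_add]; ring
    rw [if_pos (by linarith), if_pos hx.le, if_pos (by linarith), h1,
      ENNReal.ofReal_mul (Real.exp_pos _).le, mul_assoc]

theorem expMeasure_Ioi (hM : 0 < M) {h : ℝ} (hh : 0 ≤ h) :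
    expMeasure M (Ioi h) = ENNReal.ofReal (Real.exp (-(M * h))) := by
  have := isProbabilityMeasure_expMeasure hM
  simpa using setLIntegral_Ioi_expMeasure (M := M) hh (φ := fun _ => 1) measurable_const

theorem ae_expMeasure_pos (hM : 0 < M) : ∀ᵐ a ∂expMeasure M, 0 < a := by
  have := isProbabilityMeasure_expMeasure hM
  have h := expMeasure_Ioi hM le_rfl
  rw [mul_zero, neg_zero, Real.exp_zero, ENNReal.ofReal_one] at h
  exact (prob_compl_eq_zero_iff measurableSet_Ioi).2 h

/-- The exponential law of the waiting time has no memory. -/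
theorem setLIntegral_noise_gt (hM : 0 < M) {h : ℝ} (hh : 0 ≤ h) {Φ : Noise.{v} → ℝ≥0∞}
    (hΦ : Measurable Φ) :
    ∫⁻ e in {e | h < e.down.1}, Φ e ∂noise.{v} M =
      ENNReal.ofReal (Real.exp (-(M * h))) *
        ∫⁻ e, Φ ⟨(e.down.1 + h, e.down.2)⟩ ∂noise.{v} M := by
  have hmeas : MeasurableSet {e : Noise.{v} | h < e.down.1} :=
    measurableSet_lt measurable_const (measurable_fst.comp measurable_down)
  have h1 : Measurable fun e : Noise.{v} => Φ ⟨(e.down.1 + h, e.down.2)⟩ := by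
    refine hΦ.comp (measurable_up.comp ?_)
    exact ((measurable_fst.comp measurable_down).add_const h).prodMk
      (measurable_snd.comp measurable_down)
  rw [← lintegral_indicator hmeas, lintegral_noise hM (hΦ.indicator hmeas), lintegral_noise hM h1,
    ← lintegral_const_mul' _ _ ENNReal.ofReal_ne_top]
  refine lintegral_congr fun b => ?_
  have h2 : Measurable fun a : ℝ => Φ ⟨(a, b)⟩ :=
    hΦ.comp (measurable_up.comp (measurable_id.prodMk measurable_const))
  refine Eq.trans ?_ (setLIntegral_Ioi_expMeasure hh h2)
  rw [← lintegral_indicator measurableSet_Ioi]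
  rfl

theorem noise_gt (hM : 0 < M) {h : ℝ} (hh : 0 ≤ h) :
    noise.{v} M {e | h < e.down.1} = ENNReal.ofReal (Real.exp (-(M * h))) := by
  have := isProbabilityMeasure_noise.{v} hM
  have h1 := setLIntegral_noise_gt.{v} hM hh (Φ := fun _ => 1) measurable_const
  rwa [setLIntegral_one, lintegral_one, measure_univ, mul_one] at h1

theorem noise_le (hM : 0 < M) {h : ℝ} (hh : 0 ≤ h) :
    noise.{v} M {e | e.down.1 ≤ h} = ENNReal.ofReal (1 - Real.exp (-(M * h))) := by
  have := isProbabilityMeasure_noise.{v} hM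
  have hmeas : MeasurableSet {e : Noise.{v} | h < e.down.1} :=
    measurableSet_lt measurable_const (measurable_fst.comp measurable_down)
  have h1 : {e : Noise.{v} | e.down.1 ≤ h} = {e | h < e.down.1}ᶜ := by ext; simp
  rw [h1, prob_compl_eq_one_sub hmeas, noise_gt hM hh, ENNReal.ofReal_sub _ (Real.exp_pos _).le,
    ENNReal.ofReal_one]

theorem ae_noise_pos (hM : 0 < M) : ∀ᵐ e ∂noise.{v} M, 0 < e.down.1 := by
  have := noise_le.{v} hM le_rfl
  rw [ae_iff]
  simpa using this

end Noise

/-! ### The jump process as a function of its inputs -/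

section Chain

variable {S : Type u}

/-- One jump of the uniformized chain: from state `z.2` at time `z.1`, wait for the time prescribed
by the input and select the next state by means of `G`. -/
def jumpStep (G : ℝ × S → unitInterval → S) (z : ℝ × S) (e : Noise.{v}) : ℝ × S :=
  (z.1 + e.down.1, G (z.1 + e.down.1, z.2) e.down.2)

/-- The sequence of (time, state) pairs visited by the uniformized chain. -/
def jumpChain (G : ℝ × S → unitInterval → S) : ℕ → ℝ × S → (ℕ → Noise.{v}) → ℝ × S
  | 0, z, _ => z
  | n + 1, z, ω => jumpChain G n (jumpStep G z (ω 0)) fun k => ω (k + 1)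

open scoped Classical in
/-- The state at time `r` of the jump process which starts at time `z.1` in state `z.2`; an
arbitrary state if infinitely many jumps occur before time `r`. -/
def jumpState [Nonempty S] (G : ℝ × S → unitInterval → S) (r : ℝ) (z : ℝ × S)
    (ω : ℕ → Noise.{v}) : S :=
  if h : ∃ n, r < (jumpChain G (n + 1) z ω).1 then (jumpChain G (Nat.find h) z ω).2
  else Classical.arbitrary S

variable {G : ℝ × S → unitInterval → S} [Nonempty S]

theorem jumpState_eq_of_lt {r : ℝ} {z : ℝ × S} {ω : ℕ → Noise.{v}} {n : ℕ}
    (h : r < (jumpChain G (n + 1) z ω).1) (h' : ∀ k < n, (jumpChain G (k + 1) z ω).1 ≤ r) :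
    jumpState G r z ω = (jumpChain G n z ω).2 := by
  classical
  have hex : ∃ n, r < (jumpChain G (n + 1) z ω).1 := ⟨n, h⟩
  have hn : Nat.find hex = n :=
    (Nat.find_eq_iff hex).2 ⟨h, fun k hk => (h' k hk).not_gt⟩
  rw [jumpState, dif_pos hex]
  -- the decidability instance in the definition is the classical one
  convert rfl
  exact hn.symm

theorem jumpState_eq_arbitrary {r : ℝ} {z : ℝ × S} {ω : ℕ → Noise.{v}}
    (h : ∀ n, (jumpChain G (n + 1) z ω).1 ≤ r) :
    jumpState G r z ω = Classical.arbitrary S :=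
  dif_neg fun ⟨n, hn⟩ => (h n).not_gt hn

theorem jumpState_consSeq_of_lt {r : ℝ} {z : ℝ × S} {e : Noise.{v}} {ω : ℕ → Noise.{v}}
    (h : r < z.1 + e.down.1) : jumpState G r z (consSeq e ω) = z.2 :=
  jumpState_eq_of_lt (n := 0) h (by simp)

/-- The renewal identity. -/
theorem jumpState_consSeq_of_le {r : ℝ} {z : ℝ × S} {e : Noise.{v}} {ω : ℕ → Noise.{v}}
    (h : z.1 + e.down.1 ≤ r) :
    jumpState G r z (consSeq e ω) = jumpState G r (jumpStep G z e) ω := by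
  classical
  have h0 : (jumpChain G 1 z (consSeq e ω)).1 ≤ r := h
  have hs : ∀ n, jumpChain G (n + 1) z (consSeq e ω) = jumpChain G n (jumpStep G z e) ω :=
    fun _ => rfl
  by_cases hex : ∃ n, r < (jumpChain G (n + 1) (jumpStep G z e) ω).1
  · rw [jumpState_eq_of_lt (Nat.find_spec hex) fun k hk => not_lt.1 (Nat.find_min hex hk), ← hs]
    refine jumpState_eq_of_lt (Nat.find_spec hex) fun k hk => ?_
    cases k with
    | zero => exact h0
    | succ k => exact not_lt.1 (Nat.find_min hex (by omega : k < Nat.find hex))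
  · push Not at hex
    rw [jumpState_eq_arbitrary hex]
    refine jumpState_eq_arbitrary fun n => ?_
    cases n with
    | zero => exact h0
    | succ n => exact hex n

theorem jumpChain_fst (n : ℕ) (z : ℝ × S) (ω : ℕ → Noise.{v}) :
    (jumpChain G n z ω).1 = z.1 + ∑ i ∈ Finset.range n, (ω i).down.1 := by
  induction n generalizing z ω with
  | zero => simp [jumpChain]
  | succ n ih =>
    rw [jumpChain, ih, Finset.sum_range_succ', jumpStep]
    ring

section Measurability

variable [Countable S] [MeasurableSpace S] [MeasurableSingletonClass S]

theorem measurable_jumpStep (hG : Measurable (Function.uncurry G)) :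
    Measurable fun p : (ℝ × S) × Noise.{v} => jumpStep G p.1 p.2 := by
  have h1 : Measurable fun p : (ℝ × S) × Noise.{v} => p.2.down.1 :=
    measurable_fst.comp (measurable_down.comp measurable_snd)
  have h2 : Measurable fun p : (ℝ × S) × Noise.{v} => p.2.down.2 :=
    measurable_snd.comp (measurable_down.comp measurable_snd)
  have h3 : Measurable fun p : (ℝ × S) × Noise.{v} => p.1.1 + p.2.down.1 :=
    measurable_fst.fst.add h1
  exact h3.prodMk (hG.comp ((h3.prodMk measurable_fst.snd).prodMk h2))

theorem measurable_jumpChain (hG : Measurable (Function.uncurry G)) (n : ℕ) :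
    Measurable fun p : (ℝ × S) × (ℕ → Noise.{v}) => jumpChain G n p.1 p.2 := by
  induction n with
  | zero => exact measurable_fst
  | succ n ih =>
    refine ih.comp (Measurable.prodMk ((measurable_jumpStep hG).comp
      (measurable_fst.prodMk ((measurable_pi_apply 0).comp measurable_snd))) ?_)
    exact measurable_pi_lambda _ fun k => (measurable_pi_apply (k + 1)).comp measurable_snd

theorem measurable_jumpState (hG : Measurable (Function.uncurry G)) (r : ℝ) :
    Measurable fun p : (ℝ × S) × (ℕ → Noise.{v}) => jumpState G r p.1 p.2 := by
  classical
  refine measurable_to_countable' fun y => ?_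
  have hset : (fun p : (ℝ × S) × (ℕ → Noise.{v}) => jumpState G r p.1 p.2) ⁻¹' {y} =
      (⋃ n, ({p | r < (jumpChain G (n + 1) p.1 p.2).1} ∩
        (⋂ k ∈ {k | k < n}, {p | (jumpChain G (k + 1) p.1 p.2).1 ≤ r})) ∩
          {p | (jumpChain G n p.1 p.2).2 = y}) ∪
      (⋂ n, {p | (jumpChain G (n + 1) p.1 p.2).1 ≤ r}) ∩ {_p | Classical.arbitrary S = y} := by
    ext p
    simp only [mem_preimage, mem_singleton_iff, mem_union, mem_iUnion, mem_inter_iff, mem_iInter,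
      mem_ofPred_eq]
    constructor
    · intro hp
      by_cases hex : ∃ n, r < (jumpChain G (n + 1) p.1 p.2).1
      · have h1 := Nat.find_spec hex
        have h2 : ∀ k < Nat.find hex, (jumpChain G (k + 1) p.1 p.2).1 ≤ r := fun k hk =>
          not_lt.1 (Nat.find_min hex hk)
        exact Or.inl ⟨Nat.find hex, ⟨h1, h2⟩, (jumpState_eq_of_lt h1 h2).symm.trans hp⟩
      · push Not at hex
        exact Or.inr ⟨hex, (jumpState_eq_arbitrary hex).symm.trans hp⟩
    · rintro (⟨n, ⟨h1, h2⟩, rfl⟩ | ⟨h1, rfl⟩)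
      · exact jumpState_eq_of_lt h1 h2
      · exact jumpState_eq_arbitrary h1
  have hc : ∀ n, Measurable fun p : (ℝ × S) × (ℕ → Noise.{v}) => jumpChain G n p.1 p.2 :=
    measurable_jumpChain hG
  rw [hset]
  refine (MeasurableSet.iUnion fun n => ?_).union ((MeasurableSet.iInter fun n =>
    measurableSet_le (hc _).fst measurable_const).inter (.const _))
  refine ((measurableSet_lt measurable_const (hc _).fst).inter ?_).inter
    ((hc n).snd (measurableSet_singleton y))
  exact MeasurableSet.biInter (to_countable _) fun k _ =>
    measurableSet_le (hc _).fst measurable_const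

end Measurability

end Chain

/-! ### The Markov property with respect to the past -/

section Markov

variable {S : Type u} [Countable S] [MeasurableSpace S] [MeasurableSingletonClass S] [Nonempty S]
  {G : ℝ × S → unitInterval → S} {M : ℝ}

/-- The probability that the jump process which starts from `z` is in `B` at time `r`. -/
def transProb (M : ℝ) (G : ℝ × S → unitInterval → S) (r : ℝ) (B : Set S) (z : ℝ × S) : ℝ≥0∞ :=
  noiseSeq.{v} M {ω | jumpState G r z ω ∈ B}

theorem measurable_jumpState_right (hG : Measurable (Function.uncurry G)) (r : ℝ) (z : ℝ × S) :
    Measurable fun ω : ℕ → Noise.{v} => jumpState G r z ω :=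
  (measurable_jumpState hG r).comp (measurable_const.prodMk measurable_id)

theorem measurable_transProb (hM : 0 < M) (hG : Measurable (Function.uncurry G)) (r : ℝ)
    (B : Set S) : Measurable (transProb.{u, v} M G r B) := by
  have := isProbabilityMeasure_noiseSeq.{v} hM
  exact measurable_measure_prodMk_left (measurable_jumpState hG r (.of_discrete (s := B)))

theorem transProb_le_one (hM : 0 < M) (r : ℝ) (B : Set S) (z : ℝ × S) :
    transProb.{u, v} M G r B z ≤ 1 := by
  have := isProbabilityMeasure_noiseSeq.{v} hM
  exact prob_le_one

/-- A functional of the starting point and of the input sequence which satisfies the renewal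
identity at jumps up to time `t`. -/
structure IsRenewal (G : ℝ × S → unitInterval → S) (t : ℝ)
    (Θ : ℝ × S → (ℕ → Noise.{v}) → ℝ≥0∞) : Prop where
  measurable : Measurable (Function.uncurry Θ)
  le_one : ∀ z ω, Θ z ω ≤ 1
  renew : ∀ z e ω, z.1 + e.down.1 ≤ t → Θ z (consSeq e ω) = Θ (jumpStep G z e) ω

theorem isRenewal_indicator (hG : Measurable (Function.uncurry G)) {t r : ℝ} (htr : t ≤ r)
    (B : Set S) : IsRenewal.{u, v} G t fun z ω => B.indicator 1 (jumpState G r z ω) where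
  measurable := (measurable_of_countable (B.indicator (1 : S → ℝ≥0∞))).comp
    (measurable_jumpState hG r)
  le_one z ω := indicator_le_self' (fun _ _ => zero_le) _
  renew z e ω h := by simp only [jumpState_consSeq_of_le (h.trans htr)]

theorem isRenewal_transProb (hM : 0 < M) (hG : Measurable (Function.uncurry G)) (t r : ℝ)
    (B : Set S) :
    IsRenewal.{u, v} G t fun z ω => transProb.{u, v} M G r B (t, jumpState G t z ω) where
  measurable := (measurable_transProb hM hG r B).comp
    (measurable_const.prodMk (measurable_jumpState hG t))
  le_one _ _ := transProb_le_one hM _ _ _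
  renew z e ω h := by simp only [jumpState_consSeq_of_le h]

variable {ι : Type*}

theorem measurable_jumpState_path (hG : Measurable (Function.uncurry G)) (τ : ι → ℝ) (z : ℝ × S) :
    Measurable fun (ω : ℕ → Noise.{v}) i => jumpState G (τ i) z ω :=
  measurable_pi_lambda _ fun i => measurable_jumpState_right hG (τ i) z

/-- The event about the path after the first jump that corresponds to the event `C` about the path
observed at the times `τ`, if the state is `x` until a first jump at time `a`. -/
def pathAfter (τ : ι → ℝ) (a : ℝ) (x : S) (C : Set (ι → S)) : Set (ι → S) :=
  {y | (fun i => if τ i < a then x else y i) ∈ C}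

theorem measurableSet_pathAfter {τ : ι → ℝ} {a : ℝ} {x : S} {C : Set (ι → S)}
    (hC : MeasurableSet C) : MeasurableSet (pathAfter τ a x C) := by
  refine measurableSet_preimage (measurable_pi_lambda _ fun i => ?_) hC
  by_cases h : τ i < a
  · simp only [h, if_true]; exact measurable_const
  · simp only [h, if_false]; exact measurable_pi_apply i

/-- Decomposition of the integral of a renewal functional over an event about the past according to
whether the first jump takes place after time `t` or not. -/
theorem setLIntegral_path_eq (hM : 0 < M) (hG : Measurable (Function.uncurry G)) {t : ℝ}
    {τ : ι → ℝ} (hτ : ∀ i, τ i ≤ t) {Θ : ℝ × S → (ℕ → Noise.{v}) → ℝ≥0∞} (hΘ : IsRenewal G t Θ)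
    (z : ℝ × S) {C : Set (ι → S)} (hC : MeasurableSet C) :
    ∫⁻ ω in {ω | (fun i => jumpState G (τ i) z ω) ∈ C}, Θ z ω ∂noiseSeq.{v} M =
      C.indicator 1 (fun _ => z.2) *
          ∫⁻ e in {e | t - z.1 < e.down.1}, ∫⁻ ω, Θ z (consSeq e ω) ∂noiseSeq.{v} M ∂noise.{v} M +
        ∫⁻ e in {e | e.down.1 ≤ t - z.1},
          ∫⁻ ω in {ω | (fun i => jumpState G (τ i) (jumpStep G z e) ω) ∈
            pathAfter τ (z.1 + e.down.1) z.2 C}, Θ (jumpStep G z e) ω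
              ∂noiseSeq.{v} M ∂noise.{v} M := by
  have hset : ∀ (z : ℝ × S) {C : Set (ι → S)}, MeasurableSet C →
      MeasurableSet {ω : ℕ → Noise.{v} | (fun i => jumpState G (τ i) z ω) ∈ C} :=
    fun z _ hC => measurable_jumpState_path hG τ z hC
  have hΘz : ∀ z, Measurable (Θ z) := fun z => hΘ.measurable.comp measurable_prodMk_left
  have hlt : MeasurableSet {e : Noise.{v} | t - z.1 < e.down.1} :=
    measurableSet_lt measurable_const (measurable_fst.comp measurable_down)
  have hcompl : {e : Noise.{v} | t - z.1 < e.down.1}ᶜ = {e | e.down.1 ≤ t - z.1} := by ext; simp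
  rw [← lintegral_indicator (hset z hC), lintegral_noiseSeq hM ((hΘz z).indicator (hset z hC)),
    ← lintegral_add_compl _ hlt, hcompl]
  congr 1
  · rw [← lintegral_const_mul' _ _ (by by_cases h : (fun _ => z.2) ∈ C <;> simp [h])]
    refine setLIntegral_congr_fun hlt fun e he => ?_
    rw [← lintegral_const_mul' _ _ (by by_cases h : (fun _ => z.2) ∈ C <;> simp [h])]
    refine lintegral_congr fun ω => ?_
    have hconst : (fun i => jumpState G (τ i) z (consSeq e ω)) = fun _ => z.2 := by
      ext i
      refine jumpState_consSeq_of_lt ?_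
      have := hτ i
      have he' : t - z.1 < e.down.1 := he
      linarith
    by_cases h : (fun _ : ι => z.2) ∈ C <;> simp [indicator, hconst, h]
  · refine setLIntegral_congr_fun (hcompl ▸ hlt.compl) fun e he => ?_
    have he' : z.1 + e.down.1 ≤ t := by
      have : e.down.1 ≤ t - z.1 := he
      linarith
    rw [← lintegral_indicator (hset _ (measurableSet_pathAfter hC))]
    refine lintegral_congr fun ω => ?_
    have hpath : (fun i => jumpState G (τ i) z (consSeq e ω)) ∈ C ↔
        (fun i => jumpState G (τ i) (jumpStep G z e) ω) ∈
          pathAfter τ (z.1 + e.down.1) z.2 C := by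
      have : (fun i => jumpState G (τ i) z (consSeq e ω)) = fun i => if τ i < z.1 + e.down.1
          then z.2 else jumpState G (τ i) (jumpStep G z e) ω := by
        ext i
        split_ifs with h
        · exact jumpState_consSeq_of_lt h
        · exact jumpState_consSeq_of_le (not_lt.1 h)
      rw [this]
      rfl
    by_cases h : (fun i => jumpState G (τ i) z (consSeq e ω)) ∈ C
    · simp [indicator, h, hpath.1 h, hΘ.renew z e ω he']
    · simp [indicator, h, mt hpath.2 h]

/-- Comparison of the integrals of two renewal functionals over an event about the past: it is
enough to compare the contributions of the event that there is no jump up to time `t`. -/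
theorem setLIntegral_path_le (hM : 0 < M) (hG : Measurable (Function.uncurry G)) {t : ℝ}
    {τ : ι → ℝ} (hτ : ∀ i, τ i ≤ t) {Θ Θ' : ℝ × S → (ℕ → Noise.{v}) → ℝ≥0∞}
    (hΘ : IsRenewal G t Θ) (hΘ' : IsRenewal G t Θ')
    (h : ∀ z : ℝ × S, z.1 ≤ t →
      ∫⁻ e in {e | t - z.1 < e.down.1}, ∫⁻ ω, Θ z (consSeq e ω) ∂noiseSeq.{v} M ∂noise.{v} M ≤
      ∫⁻ e in {e | t - z.1 < e.down.1}, ∫⁻ ω, Θ' z (consSeq e ω) ∂noiseSeq.{v} M ∂noise.{v} M)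
    (z : ℝ × S) (hz : z.1 ≤ t) {C : Set (ι → S)} (hC : MeasurableSet C) :
    ∫⁻ ω in {ω | (fun i => jumpState G (τ i) z ω) ∈ C}, Θ z ω ∂noiseSeq.{v} M ≤
    ∫⁻ ω in {ω | (fun i => jumpState G (τ i) z ω) ∈ C}, Θ' z ω ∂noiseSeq.{v} M := by
  have := isProbabilityMeasure_noise.{v} hM
  have := isProbabilityMeasure_noiseSeq.{v} hM
  set c := noise.{v} M {e | e.down.1 ≤ t - z.1} with hc
  have hc1 : c < 1 := by
    rw [hc, noise_le hM (by linarith), ← ENNReal.ofReal_one]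
    refine (ENNReal.ofReal_lt_ofReal_iff one_pos).2 ?_
    linarith [Real.exp_pos (-(M * (t - z.1)))]
  -- the difference contracts by the probability `c` of a jump before time `t`
  have key : ∀ n : ℕ, ∀ z' : ℝ × S, z.1 ≤ z'.1 → z'.1 ≤ t → ∀ C : Set (ι → S), MeasurableSet C →
      ∫⁻ ω in {ω | (fun i => jumpState G (τ i) z' ω) ∈ C}, Θ z' ω ∂noiseSeq.{v} M ≤
      ∫⁻ ω in {ω | (fun i => jumpState G (τ i) z' ω) ∈ C}, Θ' z' ω ∂noiseSeq.{v} M + c ^ n := by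
    intro n
    induction n with
    | zero =>
      intro z' _ _ C _
      rw [pow_zero]
      refine le_add_left ((lintegral_mono (hΘ.le_one z')).trans ?_)
      rw [setLIntegral_one]
      exact prob_le_one
    | succ n ih =>
      intro z' hz' hz't C hC
      rw [setLIntegral_path_eq hM hG hτ hΘ z' hC, setLIntegral_path_eq hM hG hτ hΘ' z' hC,
        add_assoc]
      refine add_le_add (mul_le_mul_right (h z' hz't) _) ?_
      have hle : noise.{v} M {e | e.down.1 ≤ t - z'.1} ≤ c :=
        measure_mono fun e (he : e.down.1 ≤ t - z'.1) => he.trans (by linarith)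
      have hms : MeasurableSet {e : Noise.{v} | e.down.1 ≤ t - z'.1} :=
        measurableSet_le (measurable_fst.comp measurable_down) measurable_const
      calc _ ≤ ∫⁻ e in {e | e.down.1 ≤ t - z'.1},
            ((∫⁻ ω in {ω | (fun i => jumpState G (τ i) (jumpStep G z' e) ω) ∈
              pathAfter τ (z'.1 + e.down.1) z'.2 C}, Θ' (jumpStep G z' e) ω
                ∂noiseSeq.{v} M) + c ^ n) ∂noise.{v} M := by
            refine lintegral_mono_ae ?_
            filter_upwards [ae_restrict_mem hms, ae_restrict_of_ae (ae_noise_pos hM)] with e he he0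
            have he' : e.down.1 ≤ t - z'.1 := he
            exact ih (jumpStep G z' e) (by simp only [jumpStep]; linarith)
              (by simp only [jumpStep]; linarith) _ (measurableSet_pathAfter hC)
        _ ≤ _ := by
            rw [lintegral_add_right _ measurable_const, lintegral_const,
              Measure.restrict_apply_univ, pow_succ]
            gcongr
  refine ge_of_tendsto' (f := fun n : ℕ => _ + c ^ n) (x := atTop) ?_
    fun n => key n z le_rfl hz C hC
  simpa using tendsto_const_nhds.add (ENNReal.tendsto_pow_atTop_nhds_zero_of_lt_one hc1)

theorem setLIntegral_path_congr (hM : 0 < M) (hG : Measurable (Function.uncurry G)) {t : ℝ}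
    {τ : ι → ℝ} (hτ : ∀ i, τ i ≤ t) {Θ Θ' : ℝ × S → (ℕ → Noise.{v}) → ℝ≥0∞}
    (hΘ : IsRenewal G t Θ) (hΘ' : IsRenewal G t Θ')
    (h : ∀ z : ℝ × S, z.1 ≤ t →
      ∫⁻ e in {e | t - z.1 < e.down.1}, ∫⁻ ω, Θ z (consSeq e ω) ∂noiseSeq.{v} M ∂noise.{v} M =
      ∫⁻ e in {e | t - z.1 < e.down.1}, ∫⁻ ω, Θ' z (consSeq e ω) ∂noiseSeq.{v} M ∂noise.{v} M)
    (z : ℝ × S) (hz : z.1 ≤ t) {C : Set (ι → S)} (hC : MeasurableSet C) :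
    ∫⁻ ω in {ω | (fun i => jumpState G (τ i) z ω) ∈ C}, Θ z ω ∂noiseSeq.{v} M =
    ∫⁻ ω in {ω | (fun i => jumpState G (τ i) z ω) ∈ C}, Θ' z ω ∂noiseSeq.{v} M :=
  (setLIntegral_path_le hM hG hτ hΘ hΘ' (fun z hz => (h z hz).le) z hz hC).antisymm
    (setLIntegral_path_le hM hG hτ hΘ' hΘ (fun z hz => (h z hz).ge) z hz hC)

theorem transProb_eq_lintegral (hG : Measurable (Function.uncurry G)) (r : ℝ) (B : Set S)
    (z : ℝ × S) : transProb.{u, v} M G r B z =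
      ∫⁻ ω, B.indicator 1 (jumpState G r z ω) ∂noiseSeq.{v} M := by
  have h : MeasurableSet {ω : ℕ → Noise.{v} | jumpState G r z ω ∈ B} :=
    measurable_jumpState_right.{u, v} hG r z (.of_discrete (s := B))
  rw [transProb, ← lintegral_indicator_one h]
  rfl

/-- The contribution of the event that there is no jump up to time `t`, by lack of memory. -/
theorem setLIntegral_no_jump (hM : 0 < M) (hG : Measurable (Function.uncurry G)) {t r : ℝ}
    (B : Set S) {z : ℝ × S} (hz : z.1 ≤ t) :
    ∫⁻ e in {e | t - z.1 < e.down.1}, ∫⁻ ω, B.indicator 1 (jumpState G r z (consSeq e ω))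
      ∂noiseSeq.{v} M ∂noise.{v} M =
    ENNReal.ofReal (Real.exp (-(M * (t - z.1)))) * transProb.{u, v} M G r B (t, z.2) := by
  have := isProbabilityMeasure_noiseSeq.{v} hM
  have hmeas : ∀ z : ℝ × S, Measurable fun ω : ℕ → Noise.{v} =>
      B.indicator (1 : S → ℝ≥0∞) (jumpState G r z ω) := fun z =>
    (measurable_of_countable (B.indicator (1 : S → ℝ≥0∞))).comp (measurable_jumpState_right hG r z)
  have hm2 : Measurable fun e : Noise.{v} => ∫⁻ ω, B.indicator (1 : S → ℝ≥0∞)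
      (jumpState G r z (consSeq e ω)) ∂noiseSeq.{v} M :=
    ((hmeas z).comp measurable_consSeq).lintegral_prod_right'
  rw [setLIntegral_noise_gt hM (by linarith) hm2, transProb_eq_lintegral hG,
    lintegral_noiseSeq hM (hmeas _)]
  congr 1
  refine lintegral_congr fun e => lintegral_congr fun ω => ?_
  congr 1
  have hstep : jumpStep G z ⟨(e.down.1 + (t - z.1), e.down.2)⟩ = jumpStep G (t, z.2) e := by
    simp only [jumpStep]
    rw [show z.1 + (e.down.1 + (t - z.1)) = t + e.down.1 by ring]
  rcases lt_or_ge r (t + e.down.1) with h | h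
  · rw [jumpState_consSeq_of_lt (by simp only; linarith), jumpState_consSeq_of_lt]
    simp only
    linarith
  · rw [jumpState_consSeq_of_le (by simp only; linarith), jumpState_consSeq_of_le, hstep]
    simp only
    linarith

/-- The Markov property of the jump process with respect to its own past. -/
theorem jumpState_markov (hM : 0 < M) (hG : Measurable (Function.uncurry G)) {t r : ℝ}
    (htr : t ≤ r) {τ : ι → ℝ} (hτ : ∀ i, τ i ≤ t) (B : Set S) (z : ℝ × S) (hz : z.1 ≤ t)
    {C : Set (ι → S)} (hC : MeasurableSet C) :
    ∫⁻ ω in {ω | (fun i => jumpState G (τ i) z ω) ∈ C}, B.indicator 1 (jumpState G r z ω)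
      ∂noiseSeq.{v} M =
    ∫⁻ ω in {ω | (fun i => jumpState G (τ i) z ω) ∈ C},
      transProb.{u, v} M G r B (t, jumpState G t z ω) ∂noiseSeq.{v} M := by
  have := isProbabilityMeasure_noiseSeq.{v} hM
  refine setLIntegral_path_congr hM hG hτ (isRenewal_indicator hG htr B)
    (isRenewal_transProb hM hG t r B) (fun z hz => ?_) z hz hC
  have hlt : MeasurableSet {e : Noise.{v} | t - z.1 < e.down.1} :=
    measurableSet_lt measurable_const (measurable_fst.comp measurable_down)
  rw [setLIntegral_no_jump hM hG B hz, ← noise_gt.{v} hM (by linarith), mul_comm,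
    ← setLIntegral_const]
  refine setLIntegral_congr_fun hlt fun e he => ?_
  have he' : t < z.1 + e.down.1 := by
    have : t - z.1 < e.down.1 := he
    linarith
  simp [jumpState_consSeq_of_lt he']

/-- The backward equation in integrated form: decomposition according to the first jump. -/
theorem transProb_eq_add (hM : 0 < M) (hG : Measurable (Function.uncurry G)) {t r : ℝ}
    (htr : t ≤ r) (B : Set S) (z : ℝ × S) (hz : z.1 ≤ t) :
    transProb.{u, v} M G r B z =
      ENNReal.ofReal (Real.exp (-(M * (t - z.1)))) * transProb.{u, v} M G r B (t, z.2) +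
        ∫⁻ e in {e | e.down.1 ≤ t - z.1}, transProb.{u, v} M G r B (jumpStep G z e)
          ∂noise.{v} M := by
  have h := setLIntegral_path_eq hM hG (τ := fun i : Empty => i.elim) (t := t) (fun i => i.elim)
    (isRenewal_indicator.{u, v} hG htr B) z (C := univ) .univ
  simp only [setLIntegral_no_jump hM hG B hz, mem_univ, indicator_univ, Pi.one_apply, one_mul,
    pathAfter, ofPred_true, Measure.restrict_univ] at h
  simp_rw [transProb_eq_lintegral hG] at h ⊢
  exact h

end Markov

/-! ### Transition probabilities over short times -/

section Estimates

variable {S : Type u} [Countable S] [MeasurableSpace S] [MeasurableSingletonClass S] [Nonempty S]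
  {G : ℝ × S → unitInterval → S} {M : ℝ}

theorem transProb_self (hM : 0 < M) (hG : Measurable (Function.uncurry G)) (r : ℝ) (B : Set S)
    (x : S) : transProb.{u, v} M G r B (r, x) = B.indicator 1 x := by
  have := isProbabilityMeasure_noise.{v} hM
  have := isProbabilityMeasure_noiseSeq.{v} hM
  have hm : Measurable fun ω : ℕ → Noise.{v} =>
      B.indicator (1 : S → ℝ≥0∞) (jumpState G r (r, x) ω) :=
    (measurable_of_countable (B.indicator (1 : S → ℝ≥0∞))).comp (measurable_jumpState_right hG r _)
  rw [transProb_eq_lintegral hG, lintegral_noiseSeq hM hm]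
  have h : ∀ᵐ e ∂noise.{v} M, (∫⁻ ω, B.indicator (1 : S → ℝ≥0∞)
      (jumpState G r (r, x) (consSeq e ω)) ∂noiseSeq.{v} M) = B.indicator 1 x := by
    filter_upwards [ae_noise_pos hM] with e he
    have : ∀ ω : ℕ → Noise.{v}, jumpState G r (r, x) (consSeq e ω) = x := fun ω =>
      jumpState_consSeq_of_lt (by simpa using he)
    simp [this]
  rw [lintegral_congr_ae h]
  simp

theorem transProb_le_add (hM : 0 < M) (hG : Measurable (Function.uncurry G)) {a r : ℝ}
    (har : a ≤ r) (B : Set S) (x : S) :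
    transProb.{u, v} M G r B (a, x) ≤ B.indicator 1 x + ENNReal.ofReal (M * (r - a)) := by
  rw [transProb_eq_add hM hG le_rfl B (a, x) har, transProb_self hM hG]
  refine add_le_add ?_ ?_
  · refine mul_le_of_le_one_left' (ENNReal.ofReal_le_one.2 (Real.exp_le_one_iff.2 ?_))
    simp only [Left.neg_nonpos_iff]
    exact mul_nonneg hM.le (by linarith)
  · refine (lintegral_mono fun e => transProb_le_one hM _ _ _).trans ?_
    rw [setLIntegral_one, noise_le hM (by simpa using har)]
    refine ENNReal.ofReal_le_ofReal ?_
    linarith [Real.add_one_le_exp (-(M * (r - a)))]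

/-- Transition probabilities are Lipschitz continuous in the initial time. -/
theorem abs_transProb_sub_le (hM : 0 < M) (hG : Measurable (Function.uncurry G)) {a t r : ℝ}
    (hat : a ≤ t) (htr : t ≤ r) (B : Set S) (x : S) :
    |(transProb.{u, v} M G r B (a, x)).toReal - (transProb.{u, v} M G r B (t, x)).toReal| ≤
      M * (t - a) := by
  set I := ∫⁻ e in {e | e.down.1 ≤ t - a}, transProb.{u, v} M G r B (jumpStep G (a, x) e)
    ∂noise.{v} M with hI
  have h1 : I ≤ ENNReal.ofReal (1 - Real.exp (-(M * (t - a)))) := by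
    refine (lintegral_mono fun e => transProb_le_one hM _ _ _).trans ?_
    rw [setLIntegral_one, noise_le hM (by linarith)]
  have hexp : Real.exp (-(M * (t - a))) ≤ 1 :=
    Real.exp_le_one_iff.2 (by simpa using mul_nonneg hM.le (by linarith))
  have h2 : I.toReal ≤ 1 - Real.exp (-(M * (t - a))) :=
    ENNReal.toReal_le_of_le_ofReal (by linarith) h1
  have hfin : ∀ z, transProb.{u, v} M G r B z ≠ ∞ := fun z =>
    ((transProb_le_one hM r B z).trans_lt ENNReal.one_lt_top).ne
  have h3 : (transProb.{u, v} M G r B (a, x)).toReal = Real.exp (-(M * (t - a))) *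
      (transProb.{u, v} M G r B (t, x)).toReal + I.toReal := by
    rw [transProb_eq_add hM hG htr B (a, x) hat, ENNReal.toReal_add (ENNReal.mul_ne_top
      ENNReal.ofReal_ne_top (hfin _)) (h1.trans_lt ENNReal.ofReal_lt_top).ne, ENNReal.toReal_mul,
      ENNReal.toReal_ofReal (Real.exp_pos _).le]
  have h4 : (transProb.{u, v} M G r B (t, x)).toReal ≤ 1 :=
    ENNReal.toReal_le_of_le_ofReal zero_le_one (by simpa using transProb_le_one hM r B _)
  have h5 : 0 ≤ (transProb.{u, v} M G r B (t, x)).toReal := ENNReal.toReal_nonneg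
  have h6 : 0 ≤ I.toReal := ENNReal.toReal_nonneg
  have h7 := Real.add_one_le_exp (-(M * (t - a)))
  rw [h3, abs_le]
  constructor <;> nlinarith

variable {K : Kernel (ℝ × S) S}

theorem lintegral_indicator_select (hG : Measurable (Function.uncurry G))
    (hGK : ∀ z, volume.map (G z) = K z) (B : Set S) (z : ℝ × S) :
    ∫⁻ b, B.indicator (1 : S → ℝ≥0∞) (G z b) = K z B := by
  have h : MeasurableSet (G z ⁻¹' B) := (hG.comp measurable_prodMk_left) .of_discrete
  have hm : Measurable (G z) := hG.comp measurable_prodMk_left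
  rw [← hGK, Measure.map_apply hm .of_discrete, ← lintegral_indicator_one h]
  rfl

/-- An upper bound for the transition probability over a time step `δ`: no jump, or a first jump
into `B`, up to the probability `M * δ` of a further jump. -/
theorem toReal_transProb_le (hM : 0 < M) (hG : Measurable (Function.uncurry G))
    (hGK : ∀ z, volume.map (G z) = K z) {t δ : ℝ} (hδ : 0 ≤ δ) (B : Set S) (x : S) {κ : ℝ}
    (hκ0 : 0 ≤ κ) (hκ : ∀ a ∈ Icc 0 δ, K (t + a, x) B ≤ ENNReal.ofReal κ) :
    (transProb.{u, v} M G (t + δ) B (t, x)).toReal ≤ Real.exp (-(M * δ)) *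
      B.indicator (fun _ => (1 : ℝ)) x + (1 - Real.exp (-(M * δ))) * (κ + M * δ) := by
  have := isProbabilityMeasure_expMeasure hM
  have hle : t ≤ t + δ := by linarith
  have hexp : Real.exp (-(M * δ)) ≤ 1 :=
    Real.exp_le_one_iff.2 (by simpa using mul_nonneg hM.le hδ)
  have hMδ : 0 ≤ M * δ := mul_nonneg hM.le hδ
  have hms : MeasurableSet {e : Noise.{v} | e.down.1 ≤ δ} :=
    measurableSet_le (measurable_fst.comp measurable_down) measurable_const
  have hind : Measurable fun e : Noise.{v} =>
      B.indicator (1 : S → ℝ≥0∞) (jumpStep G (t, x) e).2 :=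
    (measurable_of_countable (B.indicator (1 : S → ℝ≥0∞))).comp
      ((measurable_jumpStep hG).comp measurable_prodMk_left).snd
  have h1 : ∫⁻ e in {e | e.down.1 ≤ δ}, B.indicator (1 : S → ℝ≥0∞) (jumpStep G (t, x) e).2
      ∂noise.{v} M ≤ ENNReal.ofReal κ * ENNReal.ofReal (1 - Real.exp (-(M * δ))) := by
    rw [← noise_le.{v} hM hδ, ← setLIntegral_const]
    rw [← lintegral_indicator hms, ← lintegral_indicator hms,
      lintegral_noise_swap hM (hind.indicator hms),
      lintegral_noise_swap hM (measurable_const.indicator hms)]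
    refine lintegral_mono_ae ?_
    filter_upwards [ae_expMeasure_pos hM] with a ha
    by_cases hle : a ≤ δ
    · have h3 : ∀ b, (⟨(a, b)⟩ : Noise.{v}) ∈ {e : Noise.{v} | e.down.1 ≤ δ} := fun _ => hle
      simp only [indicator_of_mem (h3 _), jumpStep, lintegral_indicator_select hG hGK]
      simpa using hκ a ⟨ha.le, hle⟩
    · have h3 : ∀ b, (⟨(a, b)⟩ : Noise.{v}) ∉ {e : Noise.{v} | e.down.1 ≤ δ} := fun _ => hle
      simp [indicator_of_notMem (h3 _)]
  have h2 : transProb.{u, v} M G (t + δ) B (t, x) ≤ ENNReal.ofReal (Real.exp (-(M * δ)) *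
      B.indicator (fun _ => (1 : ℝ)) x + (1 - Real.exp (-(M * δ))) * (κ + M * δ)) := by
    have h0 : (0 : ℝ) ≤ B.indicator (fun _ => (1 : ℝ)) x := indicator_nonneg (by simp) _
    have h0' : (B.indicator 1 x : ℝ≥0∞) = ENNReal.ofReal (B.indicator (fun _ => (1 : ℝ)) x) := by
      by_cases h : x ∈ B <;> simp [h]
    rw [transProb_eq_add hM hG le_rfl B (t, x) hle, transProb_self hM hG,
      ENNReal.ofReal_add (mul_nonneg (Real.exp_pos _).le h0)
        (mul_nonneg (by linarith) (by linarith)), ENNReal.ofReal_mul (Real.exp_pos _).le, h0']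
    simp only [add_sub_cancel_left]
    refine add_le_add le_rfl ?_
    calc _ ≤ ∫⁻ e in {e | e.down.1 ≤ δ}, (B.indicator (1 : S → ℝ≥0∞) (jumpStep G (t, x) e).2 +
          ENNReal.ofReal (M * δ)) ∂noise.{v} M := by
          refine lintegral_mono_ae ?_
          filter_upwards [ae_restrict_mem hms, ae_restrict_of_ae (ae_noise_pos hM)] with e he he0
          have he' : e.down.1 ≤ δ := he
          refine (transProb_le_add hM hG (a := t + e.down.1) (by linarith) B _).trans ?_
          refine add_le_add le_rfl (ENNReal.ofReal_le_ofReal ?_)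
          nlinarith
      _ ≤ _ := by
          rw [lintegral_add_right _ measurable_const, setLIntegral_const, noise_le hM hδ,
            mul_comm (1 - _), ENNReal.ofReal_mul (p := κ + M * δ) (by linarith),
            ENNReal.ofReal_add hκ0 hMδ, add_mul]
          exact add_le_add h1 le_rfl
  refine ENNReal.toReal_le_of_le_ofReal ?_ h2
  exact add_nonneg (mul_nonneg (Real.exp_pos _).le (indicator_nonneg (by simp) _))
    (mul_nonneg (by linarith) (by linarith))

theorem toReal_transProb_compl (hM : 0 < M) (hG : Measurable (Function.uncurry G)) (r : ℝ)
    (B : Set S) (z : ℝ × S) : (transProb.{u, v} M G r Bᶜ z).toReal =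
      1 - (transProb.{u, v} M G r B z).toReal := by
  have := isProbabilityMeasure_noiseSeq.{v} hM
  exact probReal_compl_eq_one_sub (μ := noiseSeq.{v} M)
    (measurable_jumpState_right hG r z (.of_discrete (s := B)))

/-- The infinitesimal description of the jump process, with an explicit error. -/
theorem abs_transProb_sub_indicator_le [IsMarkovKernel K] (hM : 0 < M)
    (hG : Measurable (Function.uncurry G)) (hGK : ∀ z, volume.map (G z) = K z) {t δ ε : ℝ}
    (hδ : 0 ≤ δ) (hε : 0 ≤ ε) (B : Set S) (x : S)
    (hK : ∀ a ∈ Icc 0 δ, |(K (t + a, x) B).toReal - (K (t, x) B).toReal| ≤ ε) :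
    |(transProb.{u, v} M G (t + δ) B (t, x)).toReal - B.indicator (fun _ => (1 : ℝ)) x -
      M * ((K (t, x) B).toReal - B.indicator (fun _ => (1 : ℝ)) x) * δ| ≤
      M * δ * (ε + 2 * (M * δ)) := by
  have hbd : ∀ (a : ℝ) (κ : ℝ) (C : Set S), (K (t + a, x) C).toReal ≤ κ →
      K (t + a, x) C ≤ ENNReal.ofReal κ := fun a κ C h => by
    rw [← ENNReal.ofReal_toReal (measure_ne_top (K (t + a, x)) C)]
    exact ENNReal.ofReal_le_ofReal h
  have hcompl : ∀ z, (K z Bᶜ).toReal = 1 - (K z B).toReal := fun z =>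
    probReal_compl_eq_one_sub .of_discrete
  have hk0 : 0 ≤ (K (t, x) B).toReal := ENNReal.toReal_nonneg
  have hk1 : (K (t, x) B).toReal ≤ 1 :=
    ENNReal.toReal_le_of_le_ofReal zero_le_one (by simpa using prob_le_one)
  -- the lower bound for `B` is the upper bound for the complement
  have h1 := toReal_transProb_le.{u, v} hM hG hGK (t := t) hδ B x
    (κ := (K (t, x) B).toReal + ε) (by positivity)
    fun a ha => hbd a _ _ (by linarith [(abs_le.1 (hK a ha)).2])
  have h2 := toReal_transProb_le.{u, v} hM hG hGK (t := t) hδ Bᶜ x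
    (κ := 1 - (K (t, x) B).toReal + ε) (by linarith)
    fun a ha => hbd a _ _ (by rw [hcompl]; linarith [(abs_le.1 (hK a ha)).1])
  rw [toReal_transProb_compl hM hG] at h2
  have hi : Bᶜ.indicator (fun _ => (1 : ℝ)) x = 1 - B.indicator (fun _ => (1 : ℝ)) x := by
    by_cases h : x ∈ B <;> simp [h]
  have hi0 : (0 : ℝ) ≤ B.indicator (fun _ => (1 : ℝ)) x := indicator_nonneg (by simp) _
  have hi1 : B.indicator (fun _ => (1 : ℝ)) x ≤ 1 := by
    by_cases h : x ∈ B <;> simp [h]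
  rw [hi] at h2
  set p := (transProb.{u, v} M G (t + δ) B (t, x)).toReal
  set k := (K (t, x) B).toReal
  set i := B.indicator (fun _ => (1 : ℝ)) x
  have hm : 0 ≤ M * δ := mul_nonneg hM.le hδ
  set c := 1 - Real.exp (-(M * δ)) with hc
  have he : Real.exp (-(M * δ)) = 1 - c := by rw [hc]; ring
  have hc1 : c ≤ M * δ := by linarith [Real.add_one_le_exp (-(M * δ))]
  have hc2 : M * δ - (M * δ) ^ 2 ≤ c := by
    have h3 := Real.add_one_le_exp (M * δ)
    have h4 : Real.exp (-(M * δ)) * Real.exp (M * δ) = 1 := by rw [← Real.exp_add]; simp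
    have h5 : Real.exp (-(M * δ)) * (1 + M * δ) ≤ 1 := by
      rw [← h4]; exact mul_le_mul_of_nonneg_left (by linarith) (Real.exp_pos _).le
    rw [he] at h5
    nlinarith
  have hc0 : 0 ≤ c := by
    have : Real.exp (-(M * δ)) ≤ 1 := Real.exp_le_one_iff.2 (by linarith)
    linarith
  rw [he] at h1 h2
  have hki : |k - i| ≤ 1 := by rw [abs_le]; constructor <;> linarith
  have h3 : |(M * δ - c) * (k - i)| ≤ (M * δ) ^ 2 := by
    rw [abs_mul, abs_of_nonneg (by linarith : 0 ≤ M * δ - c)]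
    nlinarith [abs_nonneg (k - i)]
  have h4 : c * (ε + M * δ) ≤ M * δ * (ε + M * δ) :=
    mul_le_mul_of_nonneg_right hc1 (by linarith)
  rw [abs_le] at h3 ⊢
  constructor <;> nlinarith

end Estimates

/-! ### Regularity of the paths -/

section Paths

variable {S : Type u} [Nonempty S] {G : ℝ × S → unitInterval → S} {M : ℝ}

/-- The process jumps only finitely often in bounded time intervals. -/
theorem ae_noiseSeq_regular (hM : 0 < M) : ∀ᵐ ω ∂noiseSeq.{v} M,
    (∀ i, 0 < (ω i).down.1) ∧ ∀ r, ∃ n, r < ∑ i ∈ Finset.range n, (ω i).down.1 := by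
  have := isProbabilityMeasure_noise.{v} hM
  have := isProbabilityMeasure_noiseSeq.{v} hM
  have hev : ∀ i, (noiseSeq.{v} M).map (fun ω => ω i) = noise M := fun i =>
    Measure.infinitePi_map_eval _ i
  have hpos : ∀ᵐ ω ∂noiseSeq.{v} M, ∀ i, 0 < (ω i).down.1 := by
    refine ae_all_iff.2 fun i => ?_
    have h := ae_noise_pos.{v} hM
    rw [← hev i] at h
    exact ae_of_ae_map (measurable_pi_apply i).aemeasurable h
  let E : Set Noise.{v} := {e | 1 < e.down.1}
  have hE : MeasurableSet E := measurableSet_lt measurable_const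
    (measurable_fst.comp measurable_down)
  have hindep : iIndepSet (fun i => {ω : ℕ → Noise.{v} | ω i ∈ E}) (noiseSeq M) := by
    refine (iIndepSet_iff_meas_biInter fun i => (measurable_pi_apply i) hE).2 fun s => ?_
    have h1 : ∀ i, noiseSeq.{v} M {ω | ω i ∈ E} = noise M E := fun i => by
      rw [← hev i, Measure.map_apply (measurable_pi_apply i) hE]
      rfl
    have h2 : (⋂ i ∈ s, {ω : ℕ → Noise.{v} | ω i ∈ E}) = (s : Set ℕ).pi fun _ => E := by
      ext; simp
    refine Eq.trans ?_ (Finset.prod_congr rfl fun i _ => (h1 i).symm)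
    refine (congrArg _ h2).trans ?_
    rw [noiseSeq, Measure.infinitePi_pi _ fun _ _ => hE]
  have hlim : ∀ᵐ ω ∂noiseSeq.{v} M, ∃ᶠ i in atTop, ω i ∈ E := by
    have h1 := measure_limsup_eq_one (fun i => (measurable_pi_apply i) hE) hindep ?_
    · have h2 : ∀ᵐ ω ∂noiseSeq.{v} M, ω ∈ limsup (fun i => {ω : ℕ → Noise.{v} | ω i ∈ E}) atTop :=
        (prob_compl_eq_zero_iff
          (MeasurableSet.measurableSet_limsup fun i => (measurable_pi_apply i) hE)).2 h1
      filter_upwards [h2] with ω hω using mem_limsup_iff_frequently_mem.1 hω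
    · have h2 : ∀ i, noiseSeq.{v} M {ω | ω i ∈ E} = ENNReal.ofReal (Real.exp (-(M * 1))) := by
        intro i
        rw [← noise_gt.{v} hM zero_le_one, ← hev i,
          Measure.map_apply (measurable_pi_apply i) hE]
        rfl
      refine (tsum_congr h2).trans ?_
      exact ENNReal.tsum_const_eq_top_of_ne_zero (by simp [Real.exp_pos])
  filter_upwards [hpos, hlim] with ω h1 h2
  refine ⟨h1, fun r => ?_⟩
  have hns : ¬ Summable fun i => (ω i).down.1 := fun hs => by
    have h3 := hs.tendsto_atTop_zero.eventually_lt_const one_pos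
    obtain ⟨i, hi, hi'⟩ := (h2.and_eventually h3).exists
    exact lt_asymm hi hi'
  rw [not_summable_iff_tendsto_nat_atTop_of_nonneg fun i => (h1 i).le] at hns
  exact (hns.eventually_gt_atTop r).exists

/-- The paths are step functions. -/
theorem jumpState_step {z : ℝ × S} {ω : ℕ → Noise.{v}} (h1 : ∀ i, 0 < (ω i).down.1)
    (h2 : ∀ r, ∃ n, r < ∑ i ∈ Finset.range n, (ω i).down.1) :
    (∀ t, z.1 ≤ t → ∀ᶠ r in 𝓝[>] t, jumpState G r z ω = jumpState G t z ω) ∧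
      ∀ t, z.1 < t → ∃ y, ∀ᶠ r in 𝓝[<] t, jumpState G r z ω = y := by
  classical
  have hmono : Monotone fun n => (jumpChain G n z ω).1 := monotone_nat_of_le_succ fun n => by
    simp only [jumpChain_fst, Finset.sum_range_succ]
    linarith [h1 n]
  have hz : (jumpChain G 0 z ω).1 = z.1 := rfl
  have hun : ∀ r, ∃ n, r < (jumpChain G n z ω).1 := fun r => by
    obtain ⟨n, hn⟩ := h2 (r - z.1)
    exact ⟨n, by rw [jumpChain_fst]; linarith⟩
  have heq : ∀ n r, (jumpChain G n z ω).1 ≤ r → r < (jumpChain G (n + 1) z ω).1 →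
      jumpState G r z ω = (jumpChain G n z ω).2 := fun n r h h' =>
    jumpState_eq_of_lt h' fun k hk => (hmono hk).trans h
  constructor
  · intro t ht
    have hex := hun t
    obtain ⟨n, hn⟩ : ∃ n, Nat.find hex = n + 1 := Nat.exists_eq_succ_of_ne_zero fun h0 => by
      have := Nat.find_spec hex
      rw [h0, hz] at this
      linarith
    have h3 := Nat.find_spec hex
    have h4 := not_lt.1 (Nat.find_min hex (m := n) (by omega))
    rw [hn] at h3
    filter_upwards [Ioo_mem_nhdsGT h3] with r hr
    rw [heq n r (h4.trans hr.1.le) hr.2, heq n t h4 h3]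
  · intro t ht
    have hex : ∃ n, t ≤ (jumpChain G n z ω).1 := (hun t).imp fun _ h => h.le
    obtain ⟨n, hn⟩ : ∃ n, Nat.find hex = n + 1 := Nat.exists_eq_succ_of_ne_zero fun h0 => by
      have := Nat.find_spec hex
      rw [h0, hz] at this
      linarith
    have h3 := Nat.find_spec hex
    have h4 := not_le.1 (Nat.find_min hex (m := n) (by omega))
    rw [hn] at h3
    refine ⟨(jumpChain G n z ω).2, ?_⟩
    filter_upwards [Ioo_mem_nhdsLT h4] with r hr
    exact heq n r hr.1.le (hr.2.trans_le h3)

theorem ae_jumpState_self [Countable S] [MeasurableSpace S] [MeasurableSingletonClass S]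
    (hM : 0 < M) (hG : Measurable (Function.uncurry G)) (z : ℝ × S) :
    ∀ᵐ ω ∂noiseSeq.{v} M, jumpState G z.1 z ω = z.2 := by
  have := isProbabilityMeasure_noiseSeq.{v} hM
  have h := transProb_self.{u, v} hM hG z.1 {z.2} z.2
  have hms : MeasurableSet {ω : ℕ → Noise.{v} | jumpState G z.1 z ω ∈ ({z.2} : Set S)} :=
    measurable_jumpState_right hG _ _ .of_discrete
  have h' : noiseSeq.{v} M {ω | jumpState G z.1 z ω ∈ ({z.2} : Set S)} = 1 := by
    simpa [transProb] using h
  exact (prob_compl_eq_zero_iff hms).2 h'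

end Paths

/-! ### The Markov property with respect to the augmented filtration -/

section Filtration

variable {S : Type u} [Countable S] [MeasurableSpace S] [MeasurableSingletonClass S] [Nonempty S]
  {G : ℝ × S → unitInterval → S} {M : ℝ}

/-- The σ-algebra generated by the jump process up to time `t`. -/
@[reducible]
def pastAlgebra (G : ℝ × S → unitInterval → S) (z : ℝ × S) (t : ℝ) :
    MeasurableSpace (ℕ → Noise.{v}) :=
  MeasurableSpace.comap (fun ω (a : Iic t) => jumpState G a z ω) MeasurableSpace.pi

theorem pastAlgebra_mono (z : ℝ × S) {t r : ℝ} (h : t ≤ r) :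
    pastAlgebra.{u, v} G z t ≤ pastAlgebra G z r := by
  rintro _ ⟨C, hC, rfl⟩
  refine ⟨(fun (y : Iic r → S) (a : Iic t) => y ⟨a, a.2.trans h⟩) ⁻¹' C, ?_, rfl⟩
  exact (measurable_pi_lambda _ fun a => measurable_pi_apply _) hC

/-- The filtration generated by the jump process, augmented by the measurable null events. -/
def augmentedFiltration (M : ℝ) (G : ℝ × S → unitInterval → S) (z : ℝ × S) (T : ℝ) :
    Filtration (Icc (0 : ℝ) T) (MeasurableSpace.pi : MeasurableSpace (ℕ → Noise.{v})) where
  seq t := @eventuallyMeasurableSpace _ (pastAlgebra G z t) (ae (noiseSeq M)) _ ⊓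
    MeasurableSpace.pi
  mono' t r h := by
    rintro A ⟨⟨A', hA', hAA'⟩, hA⟩
    exact ⟨⟨A', pastAlgebra_mono z h _ hA', hAA'⟩, hA⟩
  le' _ := inf_le_right

theorem measurableSet_augmentedFiltration {z : ℝ × S} {T : ℝ} {t : Icc (0 : ℝ) T}
    {A : Set (ℕ → Noise.{v})} : MeasurableSet[augmentedFiltration M G z T t] A ↔
      (∃ A', MeasurableSet[pastAlgebra G z t] A' ∧ A =ᵐ[noiseSeq M] A') ∧ MeasurableSet A :=
  Iff.rfl

theorem setLIntegral_augmentedFiltration (hM : 0 < M) (hG : Measurable (Function.uncurry G))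
    {z : ℝ × S} {T : ℝ} {t : Icc (0 : ℝ) T} {r : ℝ} (hz : z.1 ≤ t) (htr : t ≤ r) (B : Set S)
    {A : Set (ℕ → Noise.{v})} (hA : MeasurableSet[augmentedFiltration M G z T t] A) :
    ∫⁻ ω in A, B.indicator 1 (jumpState G r z ω) ∂noiseSeq.{v} M =
      ∫⁻ ω in A, transProb.{u, v} M G r B (t, jumpState G t z ω) ∂noiseSeq.{v} M := by
  obtain ⟨⟨_, ⟨C, hC, rfl⟩, hA'⟩, -⟩ := measurableSet_augmentedFiltration.1 hA
  rw [setLIntegral_congr hA', setLIntegral_congr hA']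
  exact jumpState_markov hM hG htr (fun a : Iic (t : ℝ) => a.2) B z hz hC

theorem transProb_ne_top (hM : 0 < M) (r : ℝ) (B : Set S) (z : ℝ × S) :
    transProb.{u, v} M G r B z ≠ ∞ :=
  ((transProb_le_one hM r B z).trans_lt ENNReal.one_lt_top).ne

theorem tendsto_transProb (hM : 0 < M) (hG : Measurable (Function.uncurry G)) {t r : ℝ}
    (htr : t < r) (B : Set S) (x : S) :
    Tendsto (fun a => transProb.{u, v} M G r B (a, x)) (𝓝[>] t)
      (𝓝 (transProb.{u, v} M G r B (t, x))) := by
  rw [← ENNReal.tendsto_toReal_iff (fun _ => transProb_ne_top hM _ _ _) (transProb_ne_top hM _ _ _),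
    tendsto_iff_dist_tendsto_zero]
  have h0 : Tendsto (fun a => M * (a - t)) (𝓝[>] t) (𝓝 0) := by
    have : Continuous fun a : ℝ => M * (a - t) := by fun_prop
    simpa using (this.tendsto t).mono_left nhdsWithin_le_nhds
  refine squeeze_zero' (Eventually.of_forall fun _ => dist_nonneg) ?_ h0
  filter_upwards [Ioc_mem_nhdsGT htr] with a ha
  rw [dist_comm, Real.dist_eq]
  exact abs_transProb_sub_le hM hG ha.1.le ha.2 B x

/-- The Markov property with respect to the right-continuous augmented filtration. -/
theorem setLIntegral_rightCont (hM : 0 < M) (hG : Measurable (Function.uncurry G))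
    {z : ℝ × S} {T : ℝ} {t r : Icc (0 : ℝ) T} (hz : z.1 ≤ t) (htr : t ≤ r) (B : Set S)
    {A : Set (ℕ → Noise.{v})}
    (hA : MeasurableSet[(augmentedFiltration M G z T).rightCont t] A) :
    ∫⁻ ω in A, B.indicator 1 (jumpState G r z ω) ∂noiseSeq.{v} M =
      ∫⁻ ω in A, transProb.{u, v} M G r B (t, jumpState G t z ω) ∂noiseSeq.{v} M := by
  have := isProbabilityMeasure_noiseSeq.{v} hM
  rcases eq_or_lt_of_le htr with rfl | hlt
  · simp_rw [transProb_self hM hG]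
  rw [Filtration.rightCont_eq_of_not_isMax _ (not_isMax_iff.2 ⟨r, hlt⟩)] at hA
  have hlt' : (t : ℝ) < r := hlt
  -- approximate `t` by later times
  obtain ⟨a, -, ha, hat⟩ := exists_seq_strictAnti_tendsto' hlt'
  have heq : ∀ n, ∫⁻ ω in A, transProb.{u, v} M G r B (a n, jumpState G (a n) z ω)
      ∂noiseSeq.{v} M = ∫⁻ ω in A, B.indicator 1 (jumpState G r z ω) ∂noiseSeq.{v} M := fun n => by
    let b : Icc (0 : ℝ) T := ⟨a n, t.2.1.trans (ha n).1.le, (ha n).2.le.trans r.2.2⟩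
    have hb : t < b := (ha n).1
    refine (setLIntegral_augmentedFiltration hM hG (t := b) (hz.trans hb.le) (ha n).2.le B ?_).symm
    have hle : (⨅ j > t, augmentedFiltration.{u, v} M G z T j) ≤ augmentedFiltration M G z T b :=
      iInf₂_le b hb
    exact hle _ hA
  have hgt : Tendsto a atTop (𝓝[>] (t : ℝ)) :=
    tendsto_nhdsWithin_iff.2 ⟨hat, Eventually.of_forall fun n => (ha n).1⟩
  have hlim : Tendsto (fun n => ∫⁻ ω in A, transProb.{u, v} M G r B (a n, jumpState G (a n) z ω)
      ∂noiseSeq.{v} M) atTop (𝓝 (∫⁻ ω in A, transProb.{u, v} M G r B (t, jumpState G t z ω)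
      ∂noiseSeq.{v} M)) := by
    refine tendsto_lintegral_of_dominated_convergence (fun _ => 1) (fun n => ?_) (fun n => ?_) ?_ ?_
    · exact (measurable_transProb hM hG r B).comp
        (measurable_const.prodMk (measurable_jumpState_right hG _ z))
    · exact Eventually.of_forall fun ω => transProb_le_one hM _ _ _
    · simp
    · refine ae_restrict_of_ae ?_
      filter_upwards [ae_noiseSeq_regular hM] with ω hω
      have h1 := (jumpState_step (G := G) (z := z) hω.1 hω.2).1 t hz
      refine ((tendsto_transProb hM hG hlt' B _).comp hgt).congr' ?_
      filter_upwards [hgt.eventually h1] with n hn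
      rw [hn]
      rfl
  simp_rw [heq] at hlim
  exact tendsto_nhds_unique tendsto_const_nhds hlim

/-- The Markov property as a conditional expectation given any σ-algebra between `σ(Λ_t)` and the
past up to time `t`. -/
theorem condExp_jumpState (hM : 0 < M) (hG : Measurable (Function.uncurry G))
    {z : ℝ × S} {T : ℝ} {t r : Icc (0 : ℝ) T} (hz : z.1 ≤ t) (htr : t ≤ r) (B : Set S)
    {m : MeasurableSpace (ℕ → Noise.{v})}
    (hm : m ≤ (augmentedFiltration M G z T).rightCont t)
    (hm' : MeasurableSpace.comap (jumpState G t z) inferInstance ≤ m) :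
    (fun ω => (transProb.{u, v} M G r B (t, jumpState G t z ω)).toReal) =ᵐ[noiseSeq.{v} M]
      (noiseSeq.{v} M)⟦{ω | jumpState G r z ω ∈ B} | m⟧ := by
  have := isProbabilityMeasure_noiseSeq.{v} hM
  have hmm : m ≤ MeasurableSpace.pi := hm.trans (Filtration.le _ t)
  have hB : MeasurableSet[MeasurableSpace.pi] {ω : ℕ → Noise.{v} | jumpState G r z ω ∈ B} :=
    measurable_jumpState_right hG r z .of_discrete
  have hstate : Measurable[m] (jumpState G t z : (ℕ → Noise.{v}) → S) :=
    (comap_measurable _).mono hm' le_rfl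
  have hg : Measurable[m] fun ω : ℕ → Noise.{v} =>
      (transProb.{u, v} M G r B (t, jumpState G t z ω)).toReal :=
    (measurable_of_countable fun x : S => (transProb.{u, v} M G r B (t, x)).toReal).comp hstate
  have hint : Integrable (fun ω : ℕ → Noise.{v} =>
      (transProb.{u, v} M G r B (t, jumpState G t z ω)).toReal) (noiseSeq M) := by
    refine Integrable.of_bound (hg.mono hmm le_rfl).aestronglyMeasurable 1
      (Eventually.of_forall fun ω => ?_)
    rw [Real.norm_of_nonneg ENNReal.toReal_nonneg]
    exact ENNReal.toReal_le_of_le_ofReal zero_le_one (by simpa using transProb_le_one hM _ _ _)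
  refine ae_eq_condExp_of_forall_setIntegral_eq hmm ?_ (fun _ _ _ => hint.integrableOn) ?_
    hg.stronglyMeasurable.aestronglyMeasurable
  · exact (integrable_const (1 : ℝ)).indicator hB
  · intro A hA _
    have hind : Measurable[MeasurableSpace.pi] fun ω : ℕ → Noise.{v} =>
        B.indicator (1 : S → ℝ≥0∞) (jumpState G r z ω) :=
      (measurable_of_countable (B.indicator (1 : S → ℝ≥0∞))).comp
        (measurable_jumpState_right hG r z)
    have h1 : ∀ ω : ℕ → Noise.{v}, {ω | jumpState G r z ω ∈ B}.indicator (fun _ => (1 : ℝ)) ω =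
        (B.indicator (1 : S → ℝ≥0∞) (jumpState G r z ω)).toReal := fun ω => by
      by_cases h : jumpState G r z ω ∈ B <;> simp [indicator, h]
    simp_rw [h1]
    rw [integral_toReal, integral_toReal hind.aemeasurable,
      setLIntegral_rightCont hM hG hz htr B (hm _ hA)]
    · exact Eventually.of_forall fun ω => (isRenewal_indicator hG le_rfl B).le_one z ω |>.trans_lt
        ENNReal.one_lt_top
    · exact ((measurable_transProb hM hG r B).comp
        (measurable_const.prodMk (measurable_jumpState_right hG t z))).aemeasurable
    · exact Eventually.of_forall fun ω => (transProb_ne_top hM _ _ _).lt_top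

/-- The transition probabilities of the jump process are given by `transProb`. -/
theorem cond_jumpState (hM : 0 < M) (hG : Measurable (Function.uncurry G)) {z : ℝ × S} {t r : ℝ}
    (hz : z.1 ≤ t) (htr : t ≤ r) (B : Set S) (x : S)
    (hx : noiseSeq.{v} M {ω | jumpState G t z ω = x} ≠ 0) :
    (noiseSeq.{v} M)[{ω | jumpState G r z ω ∈ B} | {ω | jumpState G t z ω = x}] =
      transProb.{u, v} M G r B (t, x) := by
  have := isProbabilityMeasure_noiseSeq.{v} hM
  have hB : MeasurableSet {ω : ℕ → Noise.{v} | jumpState G r z ω ∈ B} :=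
    measurable_jumpState_right hG r z .of_discrete
  have hD : MeasurableSet {ω : ℕ → Noise.{v} | jumpState G t z ω = x} :=
    measurable_jumpState_right hG t z (measurableSet_singleton x)
  have hC : MeasurableSet {y : Unit → S | y () = x} :=
    measurableSet_eq_fun (measurable_pi_apply ()) measurable_const
  have h := jumpState_markov.{u, v} hM hG htr (τ := fun _ : Unit => t) (fun _ => le_rfl) B z hz hC
  simp only [mem_ofPred_eq] at h
  have h1 : ∫⁻ ω in {ω | jumpState G t z ω = x}, B.indicator 1 (jumpState G r z ω)
      ∂noiseSeq.{v} M = noiseSeq M ({ω | jumpState G t z ω = x} ∩ {ω | jumpState G r z ω ∈ B}) := by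
    rw [inter_comm, ← Measure.restrict_apply hB, ← lintegral_indicator_one hB]
    rfl
  have h2 : ∫⁻ ω in {ω | jumpState G t z ω = x}, transProb.{u, v} M G r B
      (t, jumpState G t z ω) ∂noiseSeq.{v} M =
      transProb.{u, v} M G r B (t, x) * noiseSeq M {ω | jumpState G t z ω = x} := by
    rw [← setLIntegral_const]
    refine setLIntegral_congr_fun hD fun ω hω => ?_
    have : jumpState G t z ω = x := hω
    simp only [this]
  rw [h1, h2] at h
  rw [cond_apply hD, h, mul_comm, mul_assoc, ENNReal.mul_inv_cancel hx (measure_ne_top _ _),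
    mul_one]

end Filtration

/-! ### Relaxed controls from feedbacks -/

section Construction

variable {S : Type u} [Countable S] [TopologicalSpace S] [DiscreteTopology S] [MeasurableSpace S]
  [MeasurableSingletonClass S]
  {A : Type w} [MetricSpace A] [CompactSpace A] [MeasurableSpace A] [BorelSpace A]
  {M : ℝ≥0} {Q : A → S → Measure S} {q : A → S → ℝ≥0}

theorem measurable_comp_state {Ω β : Type*} [MeasurableSpace Ω] [MeasurableSpace β] (x : Ω → S)
    (h : S → β) : Measurable[MeasurableSpace.comap x inferInstance] fun ω => h (x ω) :=
  (measurable_of_countable h).comp (comap_measurable x)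

/-- Every family of curves with modulus `ψ` is the feedback of a relaxed control whose state
process is Markov: the uniformized jump process controlled by the feedback. -/
theorem exists_relaxedControl (hQ : ∀ x B, MeasurableSet B → Continuous fun a => Q a x B)
    (hM : ∀ a x, Q a x univ ≤ M) (hM0 : M ≠ 0) (hq : ∀ a x, Q a x univ = q a x)
    {T : ℝ} {ψ : ℝ → ℝ} (hψ : Tendsto ψ (𝓝[>] 0) (𝓝 0)) {ν : S → ℝ → ProbabilityMeasure A}
    (hν : ∀ x, HasModulus T ψ (ν x)) {s : ℝ} (hs : s ∈ Ico 0 T) (θ : S) :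
    ∃ α : RelaxedControl.{u, v, w} T ψ q Q s θ,
      α.IsMarkov ∧ ∀ t ω, α.ctrl t ω = ν (α.state t ω) t := by
  have hT : 0 < T := hs.1.trans_lt hs.2
  have : Nonempty S := ⟨θ⟩
  have hMr : (0 : ℝ) < M := NNReal.coe_pos.2 (pos_iff_ne_zero.2 hM0)
  have hνc : ∀ x, Continuous (ν x) := fun x => (hν x).continuous hT hψ
  let K := jumpKernel M Q hQ hM hM0 ν hνc
  have hKp : ∀ p, K p = uniK M Q p.2 (ν p.2 p.1) := fun _ => rfl
  have : IsMarkovKernel K := ⟨fun p => isProbabilityMeasure_uniK hQ hM hM0 _ _⟩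
  obtain ⟨G, hG, hGK⟩ := Kernel.exists_measurable_map_eq_unitInterval K
  have := isProbabilityMeasure_noiseSeq.{v} hMr
  let P := noiseSeq.{v} M
  let st : ℝ → (ℕ → Noise.{v}) → S := fun t => jumpState G t (s, θ)
  have hst : ∀ t, Measurable (st t) := fun t => measurable_jumpState_right hG t _
  have hstep : ∀ᵐ ω ∂P, (∀ t, s ≤ t → ∀ᶠ r in 𝓝[>] t, st r ω = st t ω) ∧
      ∀ t, s < t → ∃ y, ∀ᶠ r in 𝓝[<] t, st r ω = y := by
    filter_upwards [ae_noiseSeq_regular hMr] with ω hω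
    exact jumpState_step (G := G) (z := (s, θ)) hω.1 hω.2
  let F := (augmentedFiltration.{u, v} M G (s, θ) T).rightCont
  have hFle : ∀ t, augmentedFiltration.{u, v} M G (s, θ) T t ≤ F t :=
    Filtration.le_rightCont _
  have hadapt : ∀ t : Icc (0 : ℝ) T, MeasurableSpace.comap (st t) inferInstance ≤ F t := by
    rintro t _ ⟨C, hC, rfl⟩
    refine hFle t _ (measurableSet_augmentedFiltration.2 ⟨⟨_, ?_, ae_eq_refl _⟩, hst t hC⟩)
    let i : Iic (t : ℝ) := ⟨t, mem_Iic.2 le_rfl⟩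
    have hi : Measurable fun y : Iic (t : ℝ) → S => y i := measurable_pi_apply i
    exact ⟨_, hi hC, rfl⟩
  have htrans : ∀ (x : S) (B : Set S), MeasurableSet B → ∀ ε > (0 : ℝ), ∃ δ₀ > (0 : ℝ),
      ∀ t δ : ℝ, s ≤ t → 0 < δ → δ ≤ δ₀ → t + δ ≤ T → ∀ m : ProbabilityMeasure A,
      P {ω | st t ω = x ∧ ν (st t ω) t = m} ≠ 0 →
      |(P[{ω | st (t + δ) ω ∈ B} | {ω | st t ω = x ∧ ν (st t ω) t = m}]).toReal
          - B.indicator (fun _ => (1 : ℝ)) x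
          - (kernelAvg Q x B m - rateAvg q x m * B.indicator (fun _ => (1 : ℝ)) x) * δ|
        ≤ ε * δ := by
    intro x B hB ε hε
    -- the jump probabilities are uniformly continuous in time
    have hcont : Continuous fun t => (uniK M Q x (ν x t) B).toReal := by
      refine continuous_iff_continuousAt.2 fun t => ?_
      have := isProbabilityMeasure_uniK hQ hM hM0 x (ν x t)
      exact (ENNReal.tendsto_toReal (measure_ne_top _ _)).comp
        ((continuous_uniK hQ hM hM0 x B).comp (hνc x)).continuousAt
    have huc := isCompact_Icc (a := (0 : ℝ)) (b := T) |>.uniformContinuousOn_of_continuous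
      hcont.continuousOn
    obtain ⟨δ₁, hδ₁, hun⟩ := Metric.uniformContinuousOn_iff.1 huc (ε / (2 * M)) (by positivity)
    -- half of `ε` for the variation of the jump probabilities, half for several jumps in one step
    refine ⟨min (δ₁ / 2) (ε / (4 * M ^ 2)), by positivity, fun t δ hst' hδ hδ₀ htT m hm => ?_⟩
    have hmeq : m = ν x t := by
      by_contra hne
      refine hm ?_
      convert measure_empty (μ := P)
      ext ω
      simp only [mem_ofPred_eq, mem_empty_iff_false, iff_false, not_and]
      rintro rfl h
      exact hne h.symm
    subst hmeq
    have hset : {ω | st t ω = x ∧ ν (st t ω) t = ν x t} = {ω | st t ω = x} := by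
      ext ω
      simp only [mem_ofPred_eq, and_iff_left_iff_imp]
      rintro rfl
      rfl
    rw [hset] at hm ⊢
    have hc := cond_jumpState.{u, v} hMr hG (z := (s, θ)) hst' (le_add_of_nonneg_right hδ.le) B x hm
    have hb := abs_transProb_sub_indicator_le.{u, v} hMr hG hGK (t := t) (δ := δ)
      (ε := ε / (2 * M)) hδ.le (by positivity) B x fun a ha => by
        have h1 := hun (t + a) ⟨by linarith [hs.1, ha.1], by linarith [ha.2]⟩ t
          ⟨by linarith [hs.1], by linarith⟩ (by
            rw [Real.dist_eq, add_sub_cancel_left, abs_of_nonneg ha.1]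
            linarith [ha.2, hδ₀.trans (min_le_left _ _)])
        exact h1.le
    have hrate : M * ((K (t, x) B).toReal - B.indicator (fun _ => (1 : ℝ)) x) =
        kernelAvg Q x B (ν x t) - rateAvg q x (ν x t) * B.indicator (fun _ => (1 : ℝ)) x := by
      have h2 := toReal_uniQ (M := M) hQ hM hq x (ν x t) B
      rw [hKp, uniK_apply, ENNReal.toReal_mul, h2, ENNReal.toReal_inv, ENNReal.coe_toReal]
      field_simp
      ring
    have hgoal : (P[{ω | st (t + δ) ω ∈ B} | {ω | st t ω = x}]) =
      transProb.{u, v} M G (t + δ) B (t, x) := hc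
    rw [hgoal, ← hrate]
    refine hb.trans ?_
    have h3 : δ ≤ ε / (4 * M ^ 2) := hδ₀.trans (min_le_right _ _)
    have h4 : (M : ℝ) * (2 * (M * δ)) ≤ ε / 2 := by
      rw [le_div_iff₀ (by positivity)] at h3
      nlinarith
    have h5 : (M : ℝ) * (ε / (2 * M)) = ε / 2 := by field_simp
    calc (M : ℝ) * δ * (ε / (2 * M) + 2 * (M * δ))
        = (M * (ε / (2 * M)) + M * (2 * (M * δ))) * δ := by ring
      _ ≤ ε * δ := by
        refine mul_le_mul_of_nonneg_right ?_ hδ.le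
        linarith
  let α : RelaxedControl.{u, v, w} T ψ q Q s θ :=
    { time_mem := ⟨hs.1, hs.2.le⟩
      Ω := ℕ → Noise.{v}
      P := P
      F := F
      rightCont := inferInstance
      null_mem := fun N hN hN0 t => hFle t _ (measurableSet_augmentedFiltration.2
        ⟨⟨∅, @MeasurableSet.empty _ (pastAlgebra G _ _), ae_eq_empty.2 hN0⟩, hN⟩)
      state := st
      ctrl := fun t ω => ν (st t ω) t
      ctrl_adapted := fun t _ => measurable_comp_state (st t) fun x => ν x t
      ctrl_cadlag := by
        filter_upwards [hstep] with ω hω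
        constructor
        · intro t ht
          refine (((hν (st t ω)).tendsto_W1 hT hψ t).mono_left nhdsWithin_le_nhds).congr' ?_
          filter_upwards [hω.1 t ht.1] with r hr
          rw [hr]
        · intro t ht
          obtain ⟨y, hy⟩ := hω.2 t ht.1
          refine ⟨ν y t, (((hν y).tendsto_W1 hT hψ t).mono_left nhdsWithin_le_nhds).congr' ?_⟩
          filter_upwards [hy] with r hr
          rw [hr]
      ctrl_regular := fun x => by
        refine ⟨ν x, fun t _ ht => ?_, fun t₁ t₂ h0 _ h2 => (hν x).oscIco_le (by linarith)⟩
        have hD : MeasurableSet {ω | st t ω = x} := hst t (measurableSet_singleton x)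
        have := cond_isProbabilityMeasure (μ := P) ht
        have h1 : (fun ω => (ν (st t ω) t : Measure A)) =ᵐ[P[|{ω | st t ω = x}]]
            fun _ => (ν x t : Measure A) := by
          filter_upwards [ae_cond_mem hD] with ω hω
          have : st t ω = x := hω
          rw [this]
        rw [condLaw, Measure.bind_congr_right h1, Measure.bind_const, measure_univ, one_smul]
      state_adapted := fun t _ => measurable_iff_comap_le.2 (hadapt t)
      state_cadlag := by
        filter_upwards [hstep] with ω hω
        constructor
        · intro t ht
          exact tendsto_const_nhds.congr' ((hω.1 t ht.1).mono fun r hr => hr.symm)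
        · intro t ht
          obtain ⟨y, hy⟩ := hω.2 t ht.1
          exact ⟨y, tendsto_const_nhds.congr' (hy.mono fun r hr => hr.symm)⟩
      state_init := ae_jumpState_self hMr hG (s, θ)
      transition := htrans }
  refine ⟨α, fun t r hst htr B _ => ?_, fun _ _ => rfl⟩
  exact (condExp_jumpState hMr hG hst htr B le_rfl (hadapt t)).symm.trans
    (condExp_jumpState hMr hG hst htr B (hadapt t) le_rfl)

end Construction

/-! ### Feedbacks from relaxed controls -/

section Feedback

variable {S : Type u} [Countable S] [TopologicalSpace S] [DiscreteTopology S] [MeasurableSpace S]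
  [BorelSpace S]
  {A : Type w} [MetricSpace A] [CompactSpace A] [MeasurableSpace A] [BorelSpace A]

/-- A random probability measure that is measurable with respect to `σ(x)` is a function of `x`. -/
theorem eq_of_measurable_comap {Ω : Type*} {x : Ω → S} {m : Ω → ProbabilityMeasure A}
    (hm : Measurable[MeasurableSpace.comap x inferInstance] m) {ω ω' : Ω} (h : x ω = x ω') :
    m ω = m ω' := by
  refine Subtype.ext (Measure.ext fun B hB => ?_)
  have h1 : Measurable fun μ : ProbabilityMeasure A => (μ : Measure A) B :=
    (Measure.measurable_coe hB).comp measurable_subtype_coe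
  obtain ⟨C, -, hC⟩ := (h1.comp hm) (measurableSet_singleton ((m ω : Measure A) B))
  have h2 : ω ∈ x ⁻¹' C := by rw [hC]; rfl
  have h3 : ω' ∈ x ⁻¹' C := by rwa [mem_preimage, ← h]
  rw [hC] at h3
  exact h3.symm

variable {Q : A → S → Measure S} {q : A → S → ℝ≥0} {T : ℝ} {ψ : ℝ → ℝ} {s : ℝ} {θ : S}

theorem RelaxedControl.measurable_state (α : RelaxedControl.{u, v, w} T ψ q Q s θ) {t : ℝ}
    (ht : t ∈ Icc s T) : Measurable (α.state t) :=
  (α.state_adapted ⟨t, α.time_mem.1.trans ht.1, ht.2⟩ ht.1).mono (α.F.le _) le_rfl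

/-- Up to the terminal time, every relaxed control is given by a feedback with modulus `ψ`. -/
theorem RelaxedControl.exists_feedback (α : RelaxedControl.{u, v, w} T ψ q Q s θ) (hT : 0 < T) :
    ∃ ν : S → ℝ → ProbabilityMeasure A, (∀ x, HasModulus T ψ (ν x)) ∧
      ∀ t ∈ Ico s T, ∀ ω, α.P {ω' | α.state t ω' = α.state t ω} ≠ 0 →
        α.ctrl t ω = ν (α.state t ω) t := by
  have h : ∀ x, ∃ ν : ℝ → ProbabilityMeasure A, HasModulus T ψ ν ∧
      ∀ t ∈ Ico s T, ∀ ω, α.state t ω = x → α.P {ω' | α.state t ω' = x} ≠ 0 →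
        α.ctrl t ω = ν t := by
    intro x
    obtain ⟨ν, hν, hosc⟩ := α.ctrl_regular x
    obtain ⟨ν', hν', heq⟩ := exists_hasModulus_of_oscIco_le hT hosc
    refine ⟨ν', hν', fun t ht ω hω hP => ?_⟩
    have ht' : t ∈ Icc s T := ⟨ht.1, ht.2.le⟩
    rw [heq t ⟨α.time_mem.1.trans ht.1, ht.2⟩]
    refine Subtype.ext ?_
    have hD : MeasurableSet {ω' | α.state t ω' = x} :=
      α.measurable_state ht' (measurableSet_singleton x)
    have := cond_isProbabilityMeasure (μ := α.P) hP
    have h1 : (fun ω' => (α.ctrl t ω' : Measure A)) =ᵐ[α.P[|{ω' | α.state t ω' = x}]]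
        fun _ => (α.ctrl t ω : Measure A) := by
      filter_upwards [ae_cond_mem hD] with ω' hω'
      have h2 : α.state t ω' = x := hω'
      rw [eq_of_measurable_comap (α.ctrl_adapted t ht') (h2.trans hω.symm)]
    have h3 := hν t ht' hP
    rw [condLaw, Measure.bind_congr_right h1, Measure.bind_const, measure_univ, one_smul] at h3
    exact h3.symm
  choose ν hν hν' using h
  exact ⟨ν, hν, fun t ht ω hP => hν' _ t ht ω rfl hP⟩

end Feedback

/-! ### One-dimensional distributions of the state process -/

section Joint

variable {S : Type u} [Countable S] [TopologicalSpace S] [DiscreteTopology S] [MeasurableSpace S]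
  [BorelSpace S]
  {A : Type w} [MetricSpace A] [CompactSpace A] [MeasurableSpace A] [BorelSpace A]
  {Q : A → S → Measure S} {q : A → S → ℝ≥0} {T : ℝ} {ψ : ℝ → ℝ} {s : ℝ} {θ : S}

theorem RelaxedControl.ae_eventually_state_eq (α : RelaxedControl.{u, v, w} T ψ q Q s θ) :
    ∀ᵐ ω ∂α.P, ∀ t ∈ Ico s T, ∀ᶠ r in 𝓝[>] t, α.state r ω = α.state t ω := by
  filter_upwards [α.state_cadlag] with ω hω t ht
  have h := hω.1 t ht
  rw [nhds_discrete, tendsto_pure] at h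
  exact h

/-- The state process is jointly measurable in time and scenario: it is a limit of right
discretizations in time. -/
theorem RelaxedControl.aemeasurable_state (α : RelaxedControl.{u, v, w} T ψ q Q s θ) (hsT : s ≤ T) :
    AEMeasurable (fun p : ℝ × α.Ω => α.state p.1 p.2) ((volume.restrict (Icc s T)).prod α.P) := by
  let τ : ℕ → ℤ → ℝ := fun n k => max s (min T (s + (k + 1) / (n + 1)))
  have hτ : ∀ n k, τ n k ∈ Icc s T := fun n k =>
    ⟨le_max_left _ _, max_le hsT (min_le_left _ _)⟩
  let κ : ℕ → ℝ → ℤ := fun n t => ⌊(t - s) * (n + 1)⌋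
  have hκ : ∀ n, Measurable (κ n) := fun n => by fun_prop
  refine aemeasurable_of_tendsto_metrizable_ae atTop
    (f := fun n p => α.state (τ n (κ n p.1)) p.2) (fun n => ?_) ?_
  · have h1 : Measurable fun p : ℤ × α.Ω => α.state (τ n p.1) p.2 :=
      measurable_from_prod_countable_right fun k => α.measurable_state (hτ n k)
    exact (h1.comp (((hκ n).comp measurable_fst).prodMk measurable_snd)).aemeasurable
  · have hT : ∀ᵐ t ∂volume.restrict (Icc s T), t ∈ Ico s T := by
      filter_upwards [ae_restrict_mem measurableSet_Icc,
        ae_restrict_of_ae (Measure.ae_ne volume T)] with t ht hne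
      exact ⟨ht.1, lt_of_le_of_ne ht.2 hne⟩
    have h1 : ∀ᵐ p ∂(volume.restrict (Icc s T)).prod α.P, p.1 ∈ Ico s T :=
      Measure.quasiMeasurePreserving_fst.ae hT
    have h2 : ∀ᵐ p ∂(volume.restrict (Icc s T)).prod α.P, ∀ t ∈ Ico s T,
        ∀ᶠ r in 𝓝[>] t, α.state r p.2 = α.state t p.2 :=
      Measure.quasiMeasurePreserving_snd.ae α.ae_eventually_state_eq
    filter_upwards [h1, h2] with p hp hω
    have h3 := hω p.1 hp
    refine tendsto_const_nhds.congr' ?_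
    have hlim : Tendsto (fun n => τ n (κ n p.1)) atTop (𝓝[>] p.1) := by
      have hfl : ∀ n : ℕ, p.1 < s + (κ n p.1 + 1) / (n + 1) ∧
          s + (κ n p.1 + 1) / (n + 1) ≤ p.1 + 1 / (n + 1 : ℝ) := fun n => by
        have hn : (0 : ℝ) < n + 1 := by positivity
        have h4 := Int.floor_le ((p.1 - s) * (n + 1))
        have h5 := Int.lt_floor_add_one ((p.1 - s) * (n + 1))
        constructor
        · rw [← sub_lt_iff_lt_add', lt_div_iff₀ hn]
          exact h5
        · rw [← le_sub_iff_add_le', div_le_iff₀ hn]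
          have : (p.1 + 1 / (n + 1 : ℝ) - s) * (n + 1) = (p.1 - s) * (n + 1) + 1 := by
            field_simp
            ring
          rw [this]
          exact add_le_add_left h4 1
      refine tendsto_nhdsWithin_iff.2 ⟨?_, Eventually.of_forall fun n => ?_⟩
      · refine tendsto_of_tendsto_of_tendsto_of_le_of_le (g := fun _ => p.1)
          (h := fun n : ℕ => p.1 + 1 / (n + 1 : ℝ)) tendsto_const_nhds ?_ (fun n => ?_) fun n => ?_
        · simpa using tendsto_const_nhds.add (tendsto_one_div_add_atTop_nhds_zero_nat (𝕜 := ℝ))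
        · exact le_max_of_le_right (le_min hp.2.le (hfl n).1.le)
        · have : (0 : ℝ) ≤ 1 / (n + 1 : ℝ) := by positivity
          exact max_le (by linarith [hp.1]) ((min_le_right _ _).trans (hfl n).2)
      · exact lt_max_of_lt_right (lt_min hp.2 (hfl n).1)
    exact (hlim.eventually h3).mono fun n hn => hn.symm

/-- The one-dimensional distributions of the state process. -/
def RelaxedControl.stateProb (α : RelaxedControl.{u, v, w} T ψ q Q s θ) (t : ℝ) (x : S) : ℝ≥0∞ :=
  α.P {ω | α.state t ω = x}

theorem RelaxedControl.lintegral_state (α : RelaxedControl.{u, v, w} T ψ q Q s θ) {t : ℝ}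
    (ht : t ∈ Icc s T) (F : S → ℝ≥0∞) :
    ∫⁻ ω, F (α.state t ω) ∂α.P = ∑' x, α.stateProb t x * F x := by
  have hm := α.measurable_state ht
  rw [← lintegral_map (measurable_of_countable F) hm, lintegral_countable']
  refine tsum_congr fun x => ?_
  rw [Measure.map_apply hm (measurableSet_singleton x), mul_comm]
  rfl

theorem RelaxedControl.tsum_stateProb (α : RelaxedControl.{u, v, w} T ψ q Q s θ) {t : ℝ}
    (ht : t ∈ Icc s T) : ∑' x, α.stateProb t x = 1 := by
  have h := α.lintegral_state ht fun _ => 1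
  simpa using h.symm

theorem RelaxedControl.stateProb_le_one (α : RelaxedControl.{u, v, w} T ψ q Q s θ) (t : ℝ)
    (x : S) : α.stateProb t x ≤ 1 := prob_le_one

theorem RelaxedControl.stateProb_init (α : RelaxedControl.{u, v, w} T ψ q Q s θ) (x : S) :
    α.stateProb s x = ({θ} : Set S).indicator 1 x := by
  by_cases h : x = θ
  · subst h
    simp only [mem_singleton_iff, indicator_of_mem, Pi.one_apply]
    rw [RelaxedControl.stateProb, ← measure_univ (μ := α.P)]
    exact measure_congr (eventuallyEq_univ.2 α.state_init)
  · rw [indicator_of_notMem (by simpa using h)]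
    refine measure_mono_null (fun ω hω => ?_) α.state_init
    intro hω'
    exact h (hω.symm.trans hω')

theorem RelaxedControl.aemeasurable_comp_state (α : RelaxedControl.{u, v, w} T ψ q Q s θ)
    (hsT : s ≤ T) {F : ℝ → S → ℝ≥0∞} (hF : ∀ x, Measurable fun t => F t x) :
    AEMeasurable (fun p : ℝ × α.Ω => F p.1 (α.state p.1 p.2))
      ((volume.restrict (Icc s T)).prod α.P) := by
  have h1 : Measurable fun p : ℝ × S => F p.1 p.2 := measurable_from_prod_countable_left hF
  exact h1.comp_aemeasurable (measurable_fst.aemeasurable.prodMk (α.aemeasurable_state hsT))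

theorem RelaxedControl.aemeasurable_stateProb (α : RelaxedControl.{u, v, w} T ψ q Q s θ)
    (hsT : s ≤ T) (x : S) :
    AEMeasurable (fun t => α.stateProb t x) (volume.restrict (Icc s T)) := by
  have h := (α.aemeasurable_comp_state hsT (F := fun _ y => ({x} : Set S).indicator 1 y)
    fun _ => measurable_const).lintegral_prod_right'
  refine h.congr ?_
  filter_upwards [ae_restrict_mem measurableSet_Icc] with t ht
  rw [α.lintegral_state ht (({x} : Set S).indicator 1), tsum_eq_single x]
  · simp
  · intro y hy
    simp [hy]

end Joint

/-! ### Lower bounds from forward increments -/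

section Dini

/-- A right-continuous function whose forward increments are bounded below by those of the
integral of `g`, locally uniformly, grows at least as fast as the integral of `g`. -/
theorem add_integral_le_of_eventually {φ g : ℝ → ℝ} {s T : ℝ}
    (hφ : IntegrableOn φ (Icc s T)) (hg : IntegrableOn g (Icc s T)) (hg0 : ∀ t, 0 ≤ g t)
    (hrc : ∀ t ∈ Ico s T, Tendsto φ (𝓝[>] t) (𝓝 (φ t)))
    (hloc : ∀ ε > 0, ∀ᶠ δ in 𝓝[>] (0 : ℝ), ∀ t, s ≤ t → t + δ ≤ T →
      φ t + δ * (g t - ε) ≤ φ (t + δ)) {t : ℝ} (ht : t ∈ Icc s T) :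
    φ s + ∫ r in s..t, g r ≤ φ t := by
  have hint : ∀ {f : ℝ → ℝ}, IntegrableOn f (Icc s T) → ∀ {a b}, s ≤ a → a ≤ b → b ≤ T →
      IntervalIntegrable f volume a b := fun hf a b ha hab hb =>
    (intervalIntegrable_iff_integrableOn_Icc_of_le hab).2 (hf.mono_set (Icc_subset_Icc ha hb))
  have main : ∀ t ∈ Ico s T, φ s + ∫ r in s..t, g r ≤ φ t := by
    intro t ht
    have hsT : s < T := ht.1.trans_lt ht.2
    -- compare the averages of `φ` over short intervals to the right of `s` and of `t`
    have key : ∀ ε > 0, φ s + ∫ r in s..t, g r ≤ φ t + ε * (2 + (t - s)) := by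
      intro ε hε
      have hnear : ∀ a ∈ Ico s T, ∀ᶠ δ in 𝓝[>] (0 : ℝ), ∀ r ∈ Icc a (a + δ), |φ r - φ a| ≤ ε := by
        intro a ha
        have h1 := (hrc a ha).eventually (Metric.closedBall_mem_nhds (φ a) hε)
        obtain ⟨b, hb, hb'⟩ := mem_nhdsGT_iff_exists_Ioo_subset.1 h1
        have hb0 : (0 : ℝ) < b - a := sub_pos.2 hb
        filter_upwards [Ioo_mem_nhdsGT hb0] with δ hδ r hr
        rcases eq_or_lt_of_le hr.1 with rfl | hlt
        · simpa using hε.le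
        · have := hb' (⟨hlt, by linarith [hr.2, hδ.2]⟩ : r ∈ Ioo a b)
          simpa [Real.dist_eq] using this
      have hpos : ∀ᶠ δ in 𝓝[>] (0 : ℝ), 0 < δ ∧ t + δ ≤ T := by
        filter_upwards [Ioc_mem_nhdsGT (sub_pos.2 ht.2)] with δ hδ
        exact ⟨hδ.1, by linarith [hδ.2]⟩
      obtain ⟨δ, ⟨⟨h1, h2⟩, hδ, htδ⟩, h3⟩ :=
        (((hnear t ht).and (hnear s ⟨le_rfl, hsT⟩)).and hpos |>.and (hloc ε hε)).exists
      have i1 := hint hφ (le_refl s) ht.1 ht.2.le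
      have i2 := hint hφ ht.1 (by linarith : t ≤ t + δ) htδ
      have i3 := hint hφ (le_refl s) (by linarith : s ≤ s + δ) (by linarith [ht.1])
      have i4 := hint hφ (by linarith : s ≤ s + δ) (by linarith [ht.1] : s + δ ≤ t + δ) htδ
      have i5 := hint hg (le_refl s) ht.1 ht.2.le
      have e1 : (∫ r in s..t, φ (r + δ)) = ∫ r in (s + δ)..(t + δ), φ r := by simp
      have e2 := intervalIntegral.integral_add_adjacent_intervals i1 i2
      have e3 := intervalIntegral.integral_add_adjacent_intervals i3 i4
      have i6 : IntervalIntegrable (fun r => φ (r + δ)) volume s t := by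
        have := i4.comp_add_right δ
        simpa using this
      have l1 : (∫ r in s..t, (φ r + δ * (g r - ε))) ≤ ∫ r in s..t, φ (r + δ) := by
        refine intervalIntegral.integral_mono_on ht.1 (i1.add ((i5.sub (by simp)).const_mul δ)) i6
          fun r hr => h3 r hr.1 (by linarith [hr.2])
      have e4 : (∫ r in s..t, (φ r + δ * (g r - ε))) =
          (∫ r in s..t, φ r) + δ * ((∫ r in s..t, g r) - (t - s) * ε) := by
        rw [intervalIntegral.integral_add i1 ((i5.sub (by simp)).const_mul δ),
          intervalIntegral.integral_const_mul, intervalIntegral.integral_sub i5 (by simp)]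
        simp
      have l2 : (∫ r in t..(t + δ), φ r) ≤ δ * (φ t + ε) := by
        have := intervalIntegral.integral_mono_on (by linarith : t ≤ t + δ) i2
          (intervalIntegrable_const (c := φ t + ε)) fun r hr => by linarith [(abs_le.1 (h1 r hr)).2]
        simpa only [intervalIntegral.integral_const, add_sub_cancel_left, smul_eq_mul] using this
      have l3 : δ * (φ s - ε) ≤ ∫ r in s..(s + δ), φ r := by
        have := intervalIntegral.integral_mono_on (by linarith : s ≤ s + δ)
          (intervalIntegrable_const (c := φ s - ε)) i3
          fun r hr => by linarith [(abs_le.1 (h2 r hr)).1]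
        simpa only [intervalIntegral.integral_const, add_sub_cancel_left, smul_eq_mul] using this
      have l4 : δ * (φ s + ∫ r in s..t, g r) ≤ δ * (φ t + ε * (2 + (t - s))) := by
        rw [e4, e1] at l1
        linarith
      exact le_of_mul_le_mul_left l4 hδ
    refine le_of_forall_pos_le_add fun ε hε => ?_
    have hpos : 0 < 2 + (t - s) := by linarith [ht.1]
    have := key (ε / (2 + (t - s))) (by positivity)
    rwa [div_mul_cancel₀ _ hpos.ne'] at this
  rcases eq_or_lt_of_le ht.2 with rfl | hlt
  swap
  · exact main t ⟨ht.1, hlt⟩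
  rcases eq_or_lt_of_le ht.1 with rfl | hst
  · simp
  -- the endpoint is reached by continuity of the primitive
  have hprim : Tendsto (fun a => ∫ r in s..a, g r) (𝓝[<] t) (𝓝 (∫ r in s..t, g r)) := by
    have h1 : ContinuousOn (fun a => ∫ r in s..a, g r) (uIcc s t) :=
      intervalIntegral.continuousOn_primitive_interval (by rwa [uIcc_of_le ht.1])
    rw [uIcc_of_le ht.1] at h1
    exact (h1 t ⟨ht.1, le_rfl⟩).mono_left (nhdsWithin_le_iff.2 (Icc_mem_nhdsLT hst))
  have hsub : Tendsto (fun δ : ℝ => t - δ) (𝓝[>] 0) (𝓝[<] t) := by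
    refine tendsto_nhdsWithin_iff.2 ⟨?_, ?_⟩
    · have : Continuous fun δ : ℝ => t - δ := by fun_prop
      simpa using (this.tendsto 0).mono_left nhdsWithin_le_nhds
    · filter_upwards [self_mem_nhdsWithin] with δ hδ
      exact sub_lt_self t hδ
  have hlim : Tendsto (fun δ : ℝ => φ s + (∫ r in s..(t - δ), g r) - δ) (𝓝[>] 0)
      (𝓝 (φ s + (∫ r in s..t, g r) - 0)) :=
    (tendsto_const_nhds.add (hprim.comp hsub)).sub (tendsto_id.mono_left nhdsWithin_le_nhds)
  rw [sub_zero] at hlim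
  refine le_of_tendsto hlim ?_
  filter_upwards [hloc 1 one_pos, Ioo_mem_nhdsGT (sub_pos.2 hst)] with δ h1 h2
  have h3 := h1 (t - δ) (by linarith [h2.2]) (by linarith)
  have h4 := main (t - δ) ⟨by linarith [h2.2], by linarith [h2.1]⟩
  rw [sub_add_cancel] at h3
  nlinarith [hg0 (t - δ), h2.1]

end Dini

/-! ### Forward increments of the state probabilities -/

section Increments

variable {S : Type u} [Countable S] [TopologicalSpace S] [DiscreteTopology S] [MeasurableSpace S]
  [BorelSpace S]
  {A : Type w} [MetricSpace A] [CompactSpace A] [MeasurableSpace A] [BorelSpace A]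
  {M : ℝ≥0} {Q : A → S → Measure S} {q : A → S → ℝ≥0} {T : ℝ} {ψ : ℝ → ℝ} {s : ℝ} {θ : S}

theorem RelaxedControl.tendsto_stateProb (α : RelaxedControl.{u, v, w} T ψ q Q s θ) (x : S) {t : ℝ}
    (ht : t ∈ Ico s T) : Tendsto (fun r => α.stateProb r x) (𝓝[>] t) (𝓝 (α.stateProb t x)) := by
  have hsT : s ≤ T := ht.1.trans ht.2.le
  have hcl : ∀ r, max s (min T r) ∈ Icc s T := fun r =>
    ⟨le_max_left _ _, max_le hsT (min_le_left _ _)⟩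
  have heq : ∀ᶠ r in 𝓝[>] t, max s (min T r) = r := by
    filter_upwards [Ioc_mem_nhdsGT ht.2] with r hr
    rw [min_eq_right hr.2, max_eq_right (ht.1.trans hr.1.le)]
  have h := tendsto_measure_of_ae_tendsto_indicator_of_isFiniteMeasure (𝓝[>] t) (μ := α.P)
    (A := {ω | α.state t ω = x}) (As := fun r => {ω | α.state (max s (min T r)) ω = x})
    (α.measurable_state ⟨ht.1, ht.2.le⟩ (measurableSet_singleton x))
    (fun r => α.measurable_state (hcl r) (measurableSet_singleton x)) ?_
  · refine h.congr' ?_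
    filter_upwards [heq] with r hr
    rw [hr]
    rfl
  · filter_upwards [α.ae_eventually_state_eq] with ω hω
    filter_upwards [hω t ht, heq] with r hr hr'
    simp only [hr', hr]

/-- The feedback `ν` determines the control before the terminal time. -/
def RelaxedControl.IsFeedback (α : RelaxedControl.{u, v, w} T ψ q Q s θ)
    (ν : S → ℝ → ProbabilityMeasure A) : Prop :=
  ∀ t ∈ Ico s T, ∀ ω, α.P {ω' | α.state t ω' = α.state t ω} ≠ 0 →
    α.ctrl t ω = ν (α.state t ω) t

/-- The transition condition for a single target state `y`, as a lower bound in terms of the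
uniformized rates. -/
theorem RelaxedControl.eventually_transition (α : RelaxedControl.{u, v, w} T ψ q Q s θ)
    {ν : S → ℝ → ProbabilityMeasure A} (hν : α.IsFeedback ν)
    (hQ : ∀ x B, MeasurableSet B → Continuous fun a => Q a x B)
    (hM : ∀ a x, Q a x univ ≤ M) (hq : ∀ a x, Q a x univ = q a x) (x y : S) {ε : ℝ} (hε : 0 < ε) :
    ∀ᶠ δ in 𝓝[>] (0 : ℝ), ∀ t, s ≤ t → t + δ ≤ T →
      (α.stateProb t x).toReal * (({y} : Set S).indicator (fun _ => (1 : ℝ)) x * (1 - M * δ) +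
        ((uniQ M Q x (ν x t) {y}).toReal - ε) * δ) ≤
      (α.P ({ω | α.state t ω = x} ∩ {ω | α.state (t + δ) ω = y})).toReal := by
  obtain ⟨δ₀, hδ₀, h⟩ := α.transition x {y} (measurableSet_singleton y) ε hε
  filter_upwards [Ioc_mem_nhdsGT hδ₀] with δ hδ t hst htT
  have ht : t ∈ Ico s T := ⟨hst, by linarith [hδ.1]⟩
  have hD : MeasurableSet {ω | α.state t ω = x} :=
    α.measurable_state ⟨ht.1, ht.2.le⟩ (measurableSet_singleton x)
  by_cases hx : α.stateProb t x = 0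
  · rw [hx]
    simp
  have hset : {ω | α.state t ω = x ∧ α.ctrl t ω = ν x t} = {ω | α.state t ω = x} := by
    ext ω
    simp only [mem_ofPred_eq, and_iff_left_iff_imp]
    rintro rfl
    exact hν t ht ω hx
  have h1 := h t δ hst hδ.1 hδ.2 htT (ν x t) (by rw [hset]; exact hx)
  rw [hset, cond_apply hD, ENNReal.toReal_mul, ENNReal.toReal_inv] at h1
  have hp : 0 < (α.P {ω | α.state t ω = x}).toReal :=
    ENNReal.toReal_pos hx (measure_ne_top _ _)
  have h2 := (abs_le.1 h1).1
  rw [show kernelAvg Q x {y} (ν x t) = (uniQ M Q x (ν x t) {y}).toReal -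
    (M - rateAvg q x (ν x t)) * ({y} : Set S).indicator (fun _ => (1 : ℝ)) x by
      rw [toReal_uniQ hQ hM hq]; ring] at h2
  have h3 : ({y} : Set S).indicator (fun _ => (1 : ℝ)) x * (1 - M * δ) +
      ((uniQ M Q x (ν x t) {y}).toReal - ε) * δ ≤ (α.P {ω | α.state t ω = x}).toReal⁻¹ *
        (α.P ({ω | α.state t ω = x} ∩ {ω | α.state (t + δ) ω = y})).toReal := by
    refine le_of_sub_nonneg (le_trans (sub_nonneg.2 h2) (le_of_eq ?_))
    simp only [mem_singleton_iff]
    ring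
  have h4 := mul_le_mul_of_nonneg_left h3 hp.le
  rwa [mul_inv_cancel_left₀ hp.ne'] at h4

theorem RelaxedControl.sum_inter_le (α : RelaxedControl.{u, v, w} T ψ q Q s θ) {t : ℝ}
    (ht : t ∈ Icc s T) (r : ℝ) (y : S) (N : Finset S) :
    ∑ x ∈ N, (α.P ({ω | α.state t ω = x} ∩ {ω | α.state r ω = y})).toReal ≤
      (α.stateProb r y).toReal := by
  have hm : ∀ x, MeasurableSet {ω | α.state t ω = x} := fun x =>
    α.measurable_state ht (measurableSet_singleton x)
  have h := sum_measure_le_measure_univ (μ := α.P.restrict {ω | α.state r ω = y}) (s := N)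
    (t := fun x => {ω | α.state t ω = x}) (fun x _ => (hm x).nullMeasurableSet)
    (fun x _ x' _ hne => Disjoint.aedisjoint
      (disjoint_left.2 fun ω h1 h2 => hne (h1.symm.trans h2)))
  simp_rw [Measure.restrict_apply (hm _), Measure.restrict_apply_univ] at h
  rw [← ENNReal.toReal_sum fun x _ => measure_ne_top _ _]
  exact ENNReal.toReal_mono (measure_ne_top _ _) h

theorem RelaxedControl.sum_stateProb_le (α : RelaxedControl.{u, v, w} T ψ q Q s θ) {t : ℝ}
    (ht : t ∈ Icc s T) (N : Finset S) : ∑ x ∈ N, (α.stateProb t x).toReal ≤ 1 := by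
  rw [← ENNReal.toReal_sum fun x _ => ((α.stateProb_le_one t x).trans_lt ENNReal.one_lt_top).ne]
  refine ENNReal.toReal_le_of_le_ofReal zero_le_one ?_
  rw [ENNReal.ofReal_one, ← α.tsum_stateProb ht]
  exact ENNReal.sum_le_tsum N

/-- The lower bound on the increments of `exp (M t) P(Λ_t = y)` that results from the transitions
out of finitely many states. -/
theorem RelaxedControl.eventually_increment (α : RelaxedControl.{u, v, w} T ψ q Q s θ)
    {ν : S → ℝ → ProbabilityMeasure A} (hν : α.IsFeedback ν)
    (hQ : ∀ x B, MeasurableSet B → Continuous fun a => Q a x B)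
    (hM : ∀ a x, Q a x univ ≤ M) (hq : ∀ a x, Q a x univ = q a x) {y : S} {N : Finset S}
    (hy : y ∈ N) {ε : ℝ} (hε : 0 < ε) :
    ∀ᶠ δ in 𝓝[>] (0 : ℝ), ∀ t, s ≤ t → t + δ ≤ T →
      Real.exp (M * t) * (α.stateProb t y).toReal + δ *
        (Real.exp (M * t) * ∑ x ∈ N, (α.stateProb t x).toReal * (uniQ M Q x (ν x t) {y}).toReal
          - ε) ≤
      Real.exp (M * (t + δ)) * (α.stateProb (t + δ) y).toReal := by
  classical
  set c := Real.exp (M * T) with hc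
  have hc0 : 0 < c := Real.exp_pos _
  have hM0 : (0 : ℝ) ≤ M := M.coe_nonneg
  have hε' : 0 < ε / (2 * c) := by positivity
  have hev : ∀ᶠ δ in 𝓝[>] (0 : ℝ), ∀ x ∈ N, _ := (Finset.eventually_all N).2 fun x _ =>
    α.eventually_transition hν hQ hM hq x y hε'
  have hsmall : ∀ᶠ δ in 𝓝[>] (0 : ℝ), c * (M ^ 2 * δ) ≤ ε / 2 ∧ M * δ ≤ 1 := by
    have h1 : Continuous fun δ : ℝ => c * (M ^ 2 * δ) := by fun_prop
    have h2 : Continuous fun δ : ℝ => (M : ℝ) * δ := by fun_prop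
    have h1' := (h1.tendsto 0).mono_left (nhdsWithin_le_nhds (s := Ioi (0 : ℝ)))
    have h2' := (h2.tendsto 0).mono_left (nhdsWithin_le_nhds (s := Ioi (0 : ℝ)))
    simp only [mul_zero] at h1' h2'
    exact (h1'.eventually_le_const (by positivity)).and (h2'.eventually_le_const one_pos)
  filter_upwards [hev, hsmall, self_mem_nhdsWithin] with δ h1 h2 hδ t hst htT
  have hδ' : 0 < δ := hδ
  have ht : t ∈ Icc s T := ⟨hst, by linarith⟩
  set p : S → ℝ := fun x => (α.stateProb t x).toReal with hp
  set R : S → ℝ := fun x => (uniQ M Q x (ν x t) {y}).toReal with hR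
  have hp0 : ∀ x, 0 ≤ p x := fun x => ENNReal.toReal_nonneg
  have hR0 : ∀ x, 0 ≤ R x := fun x => ENNReal.toReal_nonneg
  have hpy : p y ≤ 1 := ENNReal.toReal_le_of_le_ofReal zero_le_one
    (by simpa using α.stateProb_le_one t y)
  have hsum : 0 ≤ ∑ x ∈ N, p x * R x := Finset.sum_nonneg fun x _ => mul_nonneg (hp0 x) (hR0 x)
  have h3 : p y * (1 - M * δ) + (∑ x ∈ N, p x * R x) * δ - ε / (2 * c) * δ ≤
      (α.stateProb (t + δ) y).toReal := by
    refine le_trans ?_ (α.sum_inter_le ht (t + δ) y N)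
    refine le_trans ?_ (Finset.sum_le_sum fun x hx => h1 x hx t hst htT)
    have e1 : ∀ x, (α.stateProb t x).toReal * (({y} : Set S).indicator (fun _ => (1 : ℝ)) x *
        (1 - M * δ) + ((uniQ M Q x (ν x t) {y}).toReal - ε / (2 * c)) * δ) =
        (if x = y then p x * (1 - M * δ) else 0) + p x * R x * δ - p x * (ε / (2 * c) * δ) := by
      intro x
      by_cases h : x = y
      · simp only [h, mem_singleton_iff, indicator_of_mem, if_true, hp, hR]; ring
      · simp only [mem_singleton_iff, h, not_false_eq_true, indicator_of_notMem, if_false, hp, hR]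
        ring
    simp_rw [e1]
    rw [Finset.sum_sub_distrib, Finset.sum_add_distrib, Finset.sum_ite_eq' N y, if_pos hy,
      ← Finset.sum_mul, ← Finset.sum_mul]
    have h4 : (∑ x ∈ N, p x) * (ε / (2 * c) * δ) ≤ ε / (2 * c) * δ :=
      mul_le_of_le_one_left (by positivity) (α.sum_stateProb_le ht N)
    linarith
  have hexp : 1 + M * δ ≤ Real.exp (M * δ) := by linarith [Real.add_one_le_exp (M * δ)]
  have he1 : Real.exp (M * (t + δ)) = Real.exp (M * t) * Real.exp (M * δ) := by
    rw [mul_add, Real.exp_add]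
  have he2 : Real.exp (M * (t + δ)) ≤ c :=
    Real.exp_le_exp.2 (mul_le_mul_of_nonneg_left htT hM0)
  have he3 : Real.exp (M * t) ≤ c :=
    Real.exp_le_exp.2 (mul_le_mul_of_nonneg_left ht.2 hM0)
  have het : 0 < Real.exp (M * t) := Real.exp_pos _
  have hMδ : 0 ≤ M * δ := by positivity
  -- `exp (M δ) (1 - M δ) ≥ 1 - (M δ) ^ 2`
  have h5 : p y - c⁻¹ * (ε / 2) * δ ≤ Real.exp (M * δ) * (p y * (1 - M * δ)) := by
    have h6 : p y * (1 - (M * δ) ^ 2) ≤ Real.exp (M * δ) * (p y * (1 - M * δ)) := by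
      have : p y * (1 - (M * δ) ^ 2) = (1 + M * δ) * (p y * (1 - M * δ)) := by ring
      rw [this]
      exact mul_le_mul_of_nonneg_right hexp (mul_nonneg (hp0 y) (by linarith [h2.2]))
    have h7 : (M * δ) ^ 2 ≤ c⁻¹ * (ε / 2) * δ := by
      have : M ^ 2 * δ ≤ c⁻¹ * (ε / 2) := by
        rw [inv_mul_eq_div, le_div_iff₀ hc0]; linarith [h2.1]
      nlinarith
    nlinarith [sq_nonneg ((M : ℝ) * δ)]
  have h8 : (∑ x ∈ N, p x * R x) * δ ≤ Real.exp (M * δ) * ((∑ x ∈ N, p x * R x) * δ) :=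
    le_mul_of_one_le_left (by positivity) (by linarith)
  calc Real.exp (M * t) * p y + δ * (Real.exp (M * t) * ∑ x ∈ N, p x * R x - ε)
      ≤ Real.exp (M * t) * (p y - c⁻¹ * (ε / 2) * δ + (∑ x ∈ N, p x * R x) * δ) - ε / 2 * δ := by
        have : Real.exp (M * t) * (c⁻¹ * (ε / 2) * δ) ≤ ε / 2 * δ := by
          have h9 : Real.exp (M * t) * c⁻¹ ≤ 1 := by
            rw [← div_eq_mul_inv, div_le_one hc0]; exact he3
          have : Real.exp (M * t) * (c⁻¹ * (ε / 2) * δ) =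
            Real.exp (M * t) * c⁻¹ * (ε / 2 * δ) := by ring
          rw [this]
          exact mul_le_of_le_one_left (by positivity) h9
        nlinarith
    _ ≤ Real.exp (M * (t + δ)) * (p y * (1 - M * δ) + (∑ x ∈ N, p x * R x) * δ) - ε / 2 * δ := by
        rw [he1, mul_assoc (Real.exp (M * t))]
        refine sub_le_sub_right (mul_le_mul_of_nonneg_left ?_ het.le) _
        linarith
    _ ≤ Real.exp (M * (t + δ)) *
          (p y * (1 - M * δ) + (∑ x ∈ N, p x * R x) * δ - ε / (2 * c) * δ) := by
        have : Real.exp (M * (t + δ)) * (ε / (2 * c) * δ) ≤ ε / 2 * δ := by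
          have h9 : Real.exp (M * (t + δ)) * (ε / (2 * c) * δ) =
            Real.exp (M * (t + δ)) / c * (ε / 2 * δ) := by field_simp
          rw [h9]
          exact mul_le_of_le_one_left (by positivity) ((div_le_one hc0).2 he2)
        linarith
    _ ≤ _ := mul_le_mul_of_nonneg_left h3 (Real.exp_pos _).le

end Increments

/-! ### The Kolmogorov forward equation -/

section Kolmogorov

variable {S : Type u} [Countable S] [MeasurableSpace S] [MeasurableSingletonClass S]
  {A : Type w} [MetricSpace A] [CompactSpace A] [MeasurableSpace A] [BorelSpace A]
  {M : ℝ≥0} {Q : A → S → Measure S} {ν : S → ℝ → ProbabilityMeasure A} {T : ℝ} {s : ℝ} {θ : S}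

/-- The right-hand side of the integrated Kolmogorov forward equation with initial state `θ` at
time `s` under the feedback `ν`. It is written for `w t y = exp (M t) P(Λ_t = y)`, which turns the
generator into the nonnegative operator `uniQ`. -/
def forwardMap (M : ℝ≥0) (Q : A → S → Measure S) (ν : S → ℝ → ProbabilityMeasure A) (s : ℝ) (θ : S)
    (w : ℝ → S → ℝ≥0∞) (t : ℝ) (y : S) : ℝ≥0∞ :=
  ENNReal.ofReal (Real.exp (M * s)) * ({θ} : Set S).indicator 1 y +
    ∫⁻ r in Ioc s t, ∑' x, w r x * uniQ M Q x (ν x r) {y}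

theorem measurable_uniQ_feedback (hQ : ∀ x B, MeasurableSet B → Continuous fun a => Q a x B)
    (hM : ∀ a x, Q a x univ ≤ M) (hν : ∀ x, Continuous (ν x)) (x y : S) :
    Measurable fun r => uniQ M Q x (ν x r) {y} :=
  ((continuous_uniQ hQ hM x {y}).comp (hν x)).measurable

theorem tsum_uniQ (hQ : ∀ x B, MeasurableSet B → Continuous fun a => Q a x B)
    (hM : ∀ a x, Q a x univ ≤ M) (x : S) (m : ProbabilityMeasure A) :
    ∑' y, uniQ M Q x m {y} = M := by
  rw [← uniQ_univ hQ hM x m, ← lintegral_one, lintegral_countable']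
  simp

theorem tsum_lintegral_uniQ (hQ : ∀ x B, MeasurableSet B → Continuous fun a => Q a x B)
    (hM : ∀ a x, Q a x univ ≤ M) (hν : ∀ x, Continuous (ν x)) {μ : Measure ℝ}
    {w : ℝ → S → ℝ≥0∞} (hw : ∀ x, AEMeasurable (fun r => w r x) μ) :
    ∑' y, ∫⁻ r, ∑' x, w r x * uniQ M Q x (ν x r) {y} ∂μ = ∫⁻ r, (∑' x, w r x) * M ∂μ := by
  have hm : ∀ y, AEMeasurable (fun r => ∑' x, w r x * uniQ M Q x (ν x r) {y}) μ := fun y => by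
    have h : ∀ x, AEMeasurable (fun r => w r x * uniQ M Q x (ν x r) {y}) μ := fun x =>
      (hw x).mul (measurable_uniQ_feedback hQ hM hν x y).aemeasurable
    exact AEMeasurable.tsum h
  rw [← lintegral_tsum hm]
  refine lintegral_congr fun r => ?_
  rw [ENNReal.tsum_comm]
  simp_rw [ENNReal.tsum_mul_left, tsum_uniQ hQ hM, ENNReal.tsum_mul_right]

theorem exp_add_lintegral_exp (K : ℝ≥0) {s t : ℝ} (hst : s ≤ t) :
    ENNReal.ofReal (Real.exp (K * s)) + ∫⁻ r in Ioc s t, ENNReal.ofReal (Real.exp (K * r)) * K =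
      ENNReal.ofReal (Real.exp (K * t)) := by
  have h1 : ∫ r in s..t, Real.exp (K * r) * K = Real.exp (K * t) - Real.exp (K * s) :=
    intervalIntegral.integral_eq_sub_of_hasDerivAt
      (fun r _ => by simpa using ((hasDerivAt_id r).const_mul (K : ℝ)).exp)
      (Continuous.intervalIntegrable (by fun_prop) _ _)
  have h2 : ∫⁻ r in Ioc s t, ENNReal.ofReal (Real.exp (K * r)) * K =
      ENNReal.ofReal (Real.exp (K * t) - Real.exp (K * s)) := by
    rw [← h1, intervalIntegral.integral_of_le hst, ofReal_integral_eq_lintegral_ofReal]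
    · refine lintegral_congr fun r => ?_
      rw [ENNReal.ofReal_mul (Real.exp_pos _).le, ENNReal.ofReal_coe_nnreal]
    · exact Continuous.integrableOn_Ioc (by fun_prop)
    · exact Eventually.of_forall fun r => by positivity
  have h3 : Real.exp (K * s) ≤ Real.exp (K * t) :=
    Real.exp_le_exp.2 (mul_le_mul_of_nonneg_left hst K.coe_nonneg)
  rw [h2, ← ENNReal.ofReal_add (Real.exp_pos _).le (sub_nonneg.2 h3), add_sub_cancel]

end Kolmogorov

section Forward

variable {S : Type u} [Countable S] [TopologicalSpace S] [DiscreteTopology S] [MeasurableSpace S]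
  [BorelSpace S]
  {A : Type w} [MetricSpace A] [CompactSpace A] [MeasurableSpace A] [BorelSpace A]
  {M : ℝ≥0} {Q : A → S → Measure S} {q : A → S → ℝ≥0} {T : ℝ} {ψ : ℝ → ℝ} {s : ℝ} {θ : S}

/-- The weighted one-dimensional distributions `exp (M t) P(Λ_t = y)`. -/
def RelaxedControl.expProb (α : RelaxedControl.{u, v, w} T ψ q Q s θ) (M : ℝ≥0) (t : ℝ) (y : S) :
    ℝ≥0∞ :=
  ENNReal.ofReal (Real.exp (M * t)) * α.stateProb t y

theorem RelaxedControl.aemeasurable_expProb (α : RelaxedControl.{u, v, w} T ψ q Q s θ)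
    (hsT : s ≤ T) (y : S) :
    AEMeasurable (fun t => α.expProb M t y) (volume.restrict (Icc s T)) :=
  (by fun_prop : Measurable fun t => ENNReal.ofReal (Real.exp (M * t))).aemeasurable.mul
    (α.aemeasurable_stateProb hsT y)

theorem RelaxedControl.tsum_expProb (α : RelaxedControl.{u, v, w} T ψ q Q s θ) {t : ℝ}
    (ht : t ∈ Icc s T) : ∑' y, α.expProb M t y = ENNReal.ofReal (Real.exp (M * t)) := by
  simp_rw [RelaxedControl.expProb, ENNReal.tsum_mul_left, α.tsum_stateProb ht, mul_one]

/-- The forward equation as an inequality, with the inflow from finitely many states only: the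
transition condition is uniform in time, but not in the state. -/
theorem RelaxedControl.add_sum_le_expProb (α : RelaxedControl.{u, v, w} T ψ q Q s θ)
    {ν : S → ℝ → ProbabilityMeasure A} (hν : α.IsFeedback ν) (hνc : ∀ x, Continuous (ν x))
    (hQ : ∀ x B, MeasurableSet B → Continuous fun a => Q a x B)
    (hM : ∀ a x, Q a x univ ≤ M) (hq : ∀ a x, Q a x univ = q a x) {t : ℝ} (ht : t ∈ Icc s T)
    {y : S} {N : Finset S} (hy : y ∈ N) :
    α.expProb M s y + ∑ x ∈ N, ∫⁻ r in Ioc s t, α.expProb M r x * uniQ M Q x (ν x r) {y} ≤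
      α.expProb M t y := by
  have hsT := ht.1.trans ht.2
  have hfin : ∀ r x, α.stateProb r x ≠ ∞ := fun r x =>
    ((α.stateProb_le_one r x).trans_lt ENNReal.one_lt_top).ne
  have hpm : ∀ x, AEMeasurable (fun r => (α.stateProb r x).toReal) (volume.restrict (Icc s T)) :=
    fun x => (α.aemeasurable_stateProb hsT x).ennreal_toReal
  have hp1 : ∀ r x, (α.stateProb r x).toReal ≤ 1 := fun r x =>
    ENNReal.toReal_le_of_le_ofReal zero_le_one (by simpa using α.stateProb_le_one r x)
  set g : ℝ → ℝ := fun r => Real.exp (M * r) *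
    ∑ x ∈ N, (α.stateProb r x).toReal * (uniQ M Q x (ν x r) {y}).toReal with hg
  have hexp : IntegrableOn (fun r => Real.exp (M * r)) (Icc s T) :=
    Continuous.integrableOn_Icc (by fun_prop)
  have hg0 : ∀ r, 0 ≤ g r := fun r => by positivity
  have hRM : ∀ x m, (uniQ M Q x m {y}).toReal ≤ M := fun x m =>
    ENNReal.toReal_le_of_le_ofReal M.coe_nonneg
      (by rw [ENNReal.ofReal_coe_nnreal, ← uniQ_univ hQ hM x m]; exact measure_mono (subset_univ _))
  have hgi : IntegrableOn g (Icc s T) := by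
    refine Integrable.mul_bdd (c := ∑ x ∈ N, (M : ℝ)) hexp ?_ (Eventually.of_forall fun r => ?_)
    · exact (Finset.aemeasurable_fun_sum N fun x _ => (hpm x).mul
        (measurable_uniQ_feedback hQ hM hνc x y).ennreal_toReal.aemeasurable).aestronglyMeasurable
    · rw [Real.norm_of_nonneg (Finset.sum_nonneg fun x _ => by positivity)]
      refine Finset.sum_le_sum fun x _ => ?_
      exact (mul_le_of_le_one_left ENNReal.toReal_nonneg (hp1 r x)).trans (hRM x _)
  have hφi : IntegrableOn (fun r => Real.exp (M * r) * (α.stateProb r y).toReal) (Icc s T) := by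
    refine Integrable.mul_bdd (c := 1) hexp (hpm y).aestronglyMeasurable
      (Eventually.of_forall fun r => ?_)
    rw [Real.norm_of_nonneg ENNReal.toReal_nonneg]
    exact hp1 r y
  have h := add_integral_le_of_eventually hφi hgi hg0 (fun r hr => ?_)
    (fun ε hε => α.eventually_increment hν hQ hM hq hy hε) ht
  · have h1 := ENNReal.ofReal_le_ofReal h
    have hexpProb : ∀ r x, ENNReal.ofReal (Real.exp (M * r) * (α.stateProb r x).toReal) =
        α.expProb M r x := fun r x => by
      rw [ENNReal.ofReal_mul (Real.exp_pos _).le, ENNReal.ofReal_toReal (hfin r x)]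
      rfl
    rw [ENNReal.ofReal_add (by positivity) (intervalIntegral.integral_nonneg ht.1 fun r _ => hg0 r),
      hexpProb, hexpProb, intervalIntegral.integral_of_le ht.1,
      ofReal_integral_eq_lintegral_ofReal (hgi.mono_set (Ioc_subset_Icc_self.trans
        (Icc_subset_Icc_right ht.2))) (Eventually.of_forall hg0)] at h1
    refine le_trans (le_of_eq ?_) h1
    congr 1
    rw [← lintegral_finsetSum']
    · refine lintegral_congr fun r => ?_
      rw [hg]
      simp only
      rw [ENNReal.ofReal_mul (Real.exp_pos _).le,
        ENNReal.ofReal_sum_of_nonneg fun x _ => by positivity, Finset.mul_sum]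
      refine Finset.sum_congr rfl fun x _ => ?_
      rw [ENNReal.ofReal_mul ENNReal.toReal_nonneg, ENNReal.ofReal_toReal (hfin r x),
        ENNReal.ofReal_toReal (uniQ_apply_ne_top hQ hM x _ _), ← mul_assoc]
      rfl
    · intro x _
      exact ((α.aemeasurable_expProb hsT x).mono_measure (Measure.restrict_mono
        (Ioc_subset_Icc_self.trans (Icc_subset_Icc_right ht.2)) le_rfl)).mul
        (measurable_uniQ_feedback hQ hM hνc x y).aemeasurable
  · refine Tendsto.mul ?_ ((ENNReal.tendsto_toReal (hfin r y)).comp (α.tendsto_stateProb y hr))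
    exact ((by fun_prop : Continuous fun r : ℝ => Real.exp (M * r)).tendsto r).mono_left
      nhdsWithin_le_nhds

theorem RelaxedControl.forwardMap_le_expProb (α : RelaxedControl.{u, v, w} T ψ q Q s θ)
    {ν : S → ℝ → ProbabilityMeasure A} (hν : α.IsFeedback ν) (hνc : ∀ x, Continuous (ν x))
    (hQ : ∀ x B, MeasurableSet B → Continuous fun a => Q a x B)
    (hM : ∀ a x, Q a x univ ≤ M) (hq : ∀ a x, Q a x univ = q a x) {t : ℝ} (ht : t ∈ Icc s T)
    (y : S) : forwardMap M Q ν s θ (α.expProb M) t y ≤ α.expProb M t y := by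
  classical
  have hsT := ht.1.trans ht.2
  rw [forwardMap, ← α.stateProb_init, lintegral_tsum, ENNReal.tsum_eq_iSup_sum, ENNReal.add_iSup]
  · refine iSup_le fun N => ?_
    refine le_trans (add_le_add_right ?_ _)
      (α.add_sum_le_expProb hν hνc hQ hM hq ht (Finset.mem_insert_self y N))
    exact Finset.sum_le_sum_of_subset (Finset.subset_insert y N)
  · intro x
    exact ((α.aemeasurable_expProb hsT x).mono_measure (Measure.restrict_mono
        (Ioc_subset_Icc_self.trans (Icc_subset_Icc_right ht.2)) le_rfl)).mul
        (measurable_uniQ_feedback hQ hM hνc x y).aemeasurable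

/-- The Kolmogorov forward equation. One inequality comes from the transition condition; since both
sides have the same total mass, they are equal. -/
theorem RelaxedControl.forwardMap_expProb (α : RelaxedControl.{u, v, w} T ψ q Q s θ)
    {ν : S → ℝ → ProbabilityMeasure A} (hν : α.IsFeedback ν) (hνc : ∀ x, Continuous (ν x))
    (hQ : ∀ x B, MeasurableSet B → Continuous fun a => Q a x B)
    (hM : ∀ a x, Q a x univ ≤ M) (hq : ∀ a x, Q a x univ = q a x) {t : ℝ} (ht : t ∈ Icc s T)
    (y : S) : forwardMap M Q ν s θ (α.expProb M) t y = α.expProb M t y := by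
  have hsT := ht.1.trans ht.2
  have hsub : Ioc s t ⊆ Icc s T := Ioc_subset_Icc_self.trans (Icc_subset_Icc_right ht.2)
  have hle := fun y => α.forwardMap_le_expProb hν hνc hQ hM hq ht y
  have hmass : ∑' y, forwardMap M Q ν s θ (α.expProb M) t y =
      ENNReal.ofReal (Real.exp (M * t)) := by
    simp_rw [forwardMap]
    rw [ENNReal.tsum_add, ENNReal.tsum_mul_left, tsum_lintegral_uniQ hQ hM hνc fun x =>
      (α.aemeasurable_expProb hsT x).mono_measure (Measure.restrict_mono hsub le_rfl),
      tsum_eq_single θ fun y hy => by simp [hy]]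
    rw [setLIntegral_congr_fun measurableSet_Ioc (g := fun r =>
      ENNReal.ofReal (Real.exp (M * r)) * M) fun r hr => by
        simp only; rw [α.tsum_expProb (hsub hr)]]
    simpa using exp_add_lintegral_exp M ht.1
  by_contra hne
  have hlt := ENNReal.tsum_lt_tsum (by rw [hmass]; exact ENNReal.ofReal_ne_top) hle
    (lt_of_le_of_ne (hle y) hne)
  rw [hmass, α.tsum_expProb ht] at hlt
  exact lt_irrefl _ hlt

end Forward

/-! ### Lower limits of series and sums -/

section Liminf

/-- Fatou's lemma for series. -/
theorem tsum_liminf_le {ι : Type*} (f : ℕ → ι → ℝ≥0∞) :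
    ∑' x, liminf (fun n => f n x) atTop ≤ liminf (fun n => ∑' x, f n x) atTop := by
  let _ : MeasurableSpace ι := ⊤
  have h := lintegral_liminf_le (μ := Measure.count) (f := f) (u := atTop)
    fun n => measurable_from_top
  simpa only [lintegral_count' measurable_from_top] using h

theorem liminf_add_liminf_le (a b : ℕ → ℝ≥0∞) :
    liminf a atTop + liminf b atTop ≤ liminf (fun n => a n + b n) atTop := by
  have h := tsum_liminf_le fun n (i : Bool) => if i then a n else b n
  simpa [tsum_bool, add_comm] using h

end Liminf

/-! ### Solutions and supersolutions of the forward equation -/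

section Comparison

variable {S : Type u} [Countable S] [MeasurableSpace S] [MeasurableSingletonClass S]
  {A : Type w} [MetricSpace A] [CompactSpace A] [MeasurableSpace A] [BorelSpace A]
  {M : ℝ≥0} {Q : A → S → Measure S} {ν : S → ℝ → ProbabilityMeasure A} {T : ℝ} {s : ℝ} {θ : S}

/-- Solutions of the forward equation lie below supersolutions: by a Gronwall argument, the total
mass of the positive part of the difference vanishes. -/
theorem le_of_forwardMap_le (hQ : ∀ x B, MeasurableSet B → Continuous fun a => Q a x B)
    (hM : ∀ a x, Q a x univ ≤ M) (hν : ∀ x, Continuous (ν x)) {w w' : ℝ → S → ℝ≥0∞}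
    (hw : ∀ x, AEMeasurable (fun t => w t x) (volume.restrict (Icc s T)))
    (hw' : ∀ x, AEMeasurable (fun t => w' t x) (volume.restrict (Icc s T)))
    (hsol : ∀ t ∈ Icc s T, ∀ y, w t y ≤ forwardMap M Q ν s θ w t y)
    (hsup : ∀ t ∈ Icc s T, ∀ y, forwardMap M Q ν s θ w' t y ≤ w' t y) {C : ℝ≥0∞} (hC : C ≠ ∞)
    (hwC : ∀ t ∈ Icc s T, ∑' y, w t y ≤ C) {t : ℝ} (ht : t ∈ Icc s T) (y : S) :
    w t y ≤ w' t y := by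
  set H : ℝ → ℝ≥0∞ := fun t => ∑' y, (w t y - w' t y) with hH
  have hHC : ∀ t ∈ Icc s T, H t ≤ C := fun t ht =>
    (ENNReal.tsum_le_tsum fun y => tsub_le_self).trans (hwC t ht)
  have hrec : ∀ t ∈ Icc s T, H t ≤ ∫⁻ r in Ioc s t, H r * M := by
    intro t ht
    have hres : volume.restrict (Ioc s t) ≤ volume.restrict (Icc s T) := Measure.restrict_mono
      (Ioc_subset_Icc_self.trans (Icc_subset_Icc_right ht.2)) le_rfl
    refine le_of_le_of_eq ?_ (tsum_lintegral_uniQ hQ hM hν (w := fun r x => w r x - w' r x)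
      fun x => ((hw x).sub (hw' x)).mono_measure hres)
    refine ENNReal.tsum_le_tsum fun y => ?_
    have hm : AEMeasurable (fun r => ∑' x, w' r x * uniQ M Q x (ν x r) {y})
        (volume.restrict (Ioc s t)) := by
      have h : ∀ x, AEMeasurable (fun r => w' r x * uniQ M Q x (ν x r) {y})
          (volume.restrict (Ioc s t)) := fun x =>
        ((hw' x).mono_measure hres).mul (measurable_uniQ_feedback hQ hM hν x y).aemeasurable
      exact AEMeasurable.tsum h
    calc w t y - w' t y
        ≤ forwardMap M Q ν s θ w t y - forwardMap M Q ν s θ w' t y :=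
          tsub_le_tsub (hsol t ht y) (hsup t ht y)
      _ ≤ (∫⁻ r in Ioc s t, ∑' x, w r x * uniQ M Q x (ν x r) {y}) -
            ∫⁻ r in Ioc s t, ∑' x, w' r x * uniQ M Q x (ν x r) {y} :=
          add_tsub_add_le_tsub_left
      _ ≤ ∫⁻ r in Ioc s t, ((∑' x, w r x * uniQ M Q x (ν x r) {y}) -
            ∑' x, w' r x * uniQ M Q x (ν x r) {y}) := lintegral_sub_le' _ _ hm
      _ ≤ ∫⁻ r in Ioc s t, ∑' x, (w r x - w' r x) * uniQ M Q x (ν x r) {y} := by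
          refine lintegral_mono fun r => ?_
          rw [tsub_le_iff_right, ← ENNReal.tsum_add]
          refine ENNReal.tsum_le_tsum fun x => ?_
          rw [← add_mul]
          exact mul_le_mul_left (le_tsub_add) _
  -- the smallest `L` with `H t ≤ L exp (2 M t)` satisfies `2 L ≤ L`
  set e : ℝ → ℝ≥0∞ := fun t => ENNReal.ofReal (Real.exp ((2 * M : ℝ≥0) * t)) with he
  have he0 : ∀ t, e t ≠ 0 := fun t => by simp [he, Real.exp_pos]
  have hetop : ∀ t, e t ≠ ∞ := fun t => ENNReal.ofReal_ne_top
  set L : ℝ≥0∞ := ⨆ t ∈ Icc s T, H t / e t with hL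
  have hHL : ∀ t ∈ Icc s T, H t ≤ L * e t := fun t ht => by
    rw [← ENNReal.div_le_iff (he0 t) (hetop t)]
    exact le_iSup₂ (f := fun t (_ : t ∈ Icc s T) => H t / e t) t ht
  have hLtop : L ≠ ∞ := by
    refine ne_top_of_le_ne_top (ENNReal.div_ne_top hC (he0 s)) (iSup₂_le fun t ht => ?_)
    refine ENNReal.div_le_div (hHC t ht) (ENNReal.ofReal_le_ofReal (Real.exp_le_exp.2 ?_))
    exact mul_le_mul_of_nonneg_left ht.1 (NNReal.coe_nonneg _)
  have h2 : ∀ t ∈ Icc s T, 2 * H t ≤ L * e t := by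
    intro t ht
    have h3 : ∫⁻ r in Ioc s t, H r * M ≤ L * ∫⁻ r in Ioc s t, e r * M := by
      rw [← lintegral_const_mul' _ _ hLtop]
      refine setLIntegral_mono' measurableSet_Ioc fun r hr => ?_
      rw [← mul_assoc]
      exact mul_le_mul_left (hHL r ⟨hr.1.le, hr.2.trans ht.2⟩) _
    have h4 : 2 * ∫⁻ r in Ioc s t, e r * M ≤ e t := by
      have h5 := exp_add_lintegral_exp (2 * M) ht.1
      rw [← lintegral_const_mul' _ _ ENNReal.ofNat_ne_top]
      refine le_trans (le_of_eq (lintegral_congr fun r => ?_)) (le_add_self.trans h5.le)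
      push_cast
      simp only [he]
      push_cast
      ring
    calc 2 * H t ≤ 2 * (L * ∫⁻ r in Ioc s t, e r * M) := mul_le_mul_right ((hrec t ht).trans h3) _
      _ = L * (2 * ∫⁻ r in Ioc s t, e r * M) := by ring
      _ ≤ L * e t := mul_le_mul_right h4 _
  have hLL : 2 * L ≤ L := by
    rw [hL, ENNReal.mul_iSup, ← hL]
    refine iSup_le fun t => ?_
    rw [ENNReal.mul_iSup]
    refine iSup_le fun ht => ?_
    rw [← mul_div_assoc, ENNReal.div_le_iff (he0 t) (hetop t)]
    exact h2 t ht
  have hL0 : L = 0 := by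
    by_contra h0
    rw [two_mul] at hLL
    exact (ENNReal.lt_add_right hLtop h0).not_ge hLL
  have hH0 := hHL t ht
  rw [hL0, zero_mul, nonpos_iff_eq_zero, hH, ENNReal.tsum_eq_zero] at hH0
  exact tsub_eq_zero_iff_le.1 (hH0 y)

/-- By Fatou's lemma, the lower limit of solutions of the forward equations of a convergent sequence
of feedbacks is a supersolution of the forward equation of the limit. -/
theorem forwardMap_liminf_le (hQ : ∀ x B, MeasurableSet B → Continuous fun a => Q a x B)
    (hM : ∀ a x, Q a x univ ≤ M) {νn : ℕ → S → ℝ → ProbabilityMeasure A}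
    (hνn : ∀ n x, Continuous (νn n x))
    (hlim : ∀ x t, Tendsto (fun n => νn n x t) atTop (𝓝 (ν x t))) {w : ℕ → ℝ → S → ℝ≥0∞}
    (hw : ∀ n x, AEMeasurable (fun t => w n t x) (volume.restrict (Icc s T)))
    (hsol : ∀ n, ∀ t ∈ Icc s T, ∀ y, forwardMap M Q (νn n) s θ (w n) t y ≤ w n t y) {t : ℝ}
    (ht : t ∈ Icc s T) (y : S) :
    forwardMap M Q ν s θ (fun t x => liminf (fun n => w n t x) atTop) t y ≤
      liminf (fun n => w n t y) atTop := by
  have hres : volume.restrict (Ioc s t) ≤ volume.restrict (Icc s T) := Measure.restrict_mono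
    (Ioc_subset_Icc_self.trans (Icc_subset_Icc_right ht.2)) le_rfl
  have hm : ∀ n, AEMeasurable (fun r => ∑' x, w n r x * uniQ M Q x (νn n x r) {y})
      (volume.restrict (Ioc s t)) := fun n => by
    have h : ∀ x, AEMeasurable (fun r => w n r x * uniQ M Q x (νn n x r) {y})
        (volume.restrict (Ioc s t)) := fun x =>
      ((hw n x).mono_measure hres).mul (measurable_uniQ_feedback hQ hM (hνn n) x y).aemeasurable
    exact AEMeasurable.tsum h
  have h1 : ∀ r x, liminf (fun n => w n r x) atTop * uniQ M Q x (ν x r) {y} ≤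
      liminf (fun n => w n r x * uniQ M Q x (νn n x r) {y}) atTop := fun r x => by
    rw [← (((continuous_uniQ hQ hM x {y}).tendsto _).comp (hlim x r)).liminf_eq]
    exact ENNReal.le_liminf_mul
  have h2 : ∫⁻ r in Ioc s t, ∑' x, liminf (fun n => w n r x) atTop * uniQ M Q x (ν x r) {y} ≤
      liminf (fun n => ∫⁻ r in Ioc s t, ∑' x, w n r x * uniQ M Q x (νn n x r) {y}) atTop :=
    (lintegral_mono fun r => (ENNReal.tsum_le_tsum fun x => h1 r x).trans (tsum_liminf_le _)).trans
      (lintegral_liminf_le' hm)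
  refine le_trans ?_ (liminf_le_liminf (Eventually.of_forall fun n => hsol n t ht y))
  refine le_trans (add_le_add_right h2 _) ?_
  conv_lhs => arg 1; rw [← liminf_const (f := (atTop : Filter ℕ))
    (ENNReal.ofReal (Real.exp (M * s)) * ({θ} : Set S).indicator 1 y)]
  exact liminf_add_liminf_le _ _

end Comparison

/-! ### Lower semicontinuity of the state probabilities -/

section StateProb

variable {S : Type u} [Countable S] [TopologicalSpace S] [DiscreteTopology S] [MeasurableSpace S]
  [BorelSpace S]
  {A : Type w} [MetricSpace A] [CompactSpace A] [MeasurableSpace A] [BorelSpace A]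
  {M : ℝ≥0} {Q : A → S → Measure S} {q : A → S → ℝ≥0} {T : ℝ} {ψ : ℝ → ℝ} {s : ℝ} {θ : S}

/-- The one-dimensional distributions of a controlled process are lower semicontinuous in the
feedback. -/
theorem RelaxedControl.stateProb_le_liminf
    (hQ : ∀ x B, MeasurableSet B → Continuous fun a => Q a x B)
    (hM : ∀ a x, Q a x univ ≤ M) (hq : ∀ a x, Q a x univ = q a x)
    (α : RelaxedControl.{u, v, w} T ψ q Q s θ) (β : ℕ → RelaxedControl.{u, v, w} T ψ q Q s θ)
    {ν : S → ℝ → ProbabilityMeasure A} (hν : α.IsFeedback ν) (hνc : ∀ x, Continuous (ν x))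
    {νn : ℕ → S → ℝ → ProbabilityMeasure A} (hνn : ∀ n, (β n).IsFeedback (νn n))
    (hνnc : ∀ n x, Continuous (νn n x))
    (hlim : ∀ x t, Tendsto (fun n => νn n x t) atTop (𝓝 (ν x t))) {t : ℝ} (ht : t ∈ Icc s T)
    (y : S) : α.stateProb t y ≤ liminf (fun n => (β n).stateProb t y) atTop := by
  have hsT := ht.1.trans ht.2
  have h := le_of_forwardMap_le hQ hM hνc (θ := θ) (w := α.expProb M)
    (w' := fun t x => liminf (fun n => (β n).expProb M t x) atTop)
    (fun x => α.aemeasurable_expProb hsT x)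
    (fun x => by
      simp_rw [liminf_eq_iSup_iInf_of_nat]
      exact AEMeasurable.iSup fun n => AEMeasurable.biInf _ (to_countable _)
        fun i _ => (β i).aemeasurable_expProb hsT x)
    (fun t ht y => (α.forwardMap_expProb hν hνc hQ hM hq ht y).ge)
    (fun t ht y => forwardMap_liminf_le hQ hM hνnc hlim
      (fun n x => (β n).aemeasurable_expProb hsT x)
      (fun n t ht y => ((β n).forwardMap_expProb (hνn n) (hνnc n) hQ hM hq ht y).le) ht y)
    (C := ENNReal.ofReal (Real.exp (M * T))) ENNReal.ofReal_ne_top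
    (fun t ht => (α.tsum_expProb ht).le.trans (ENNReal.ofReal_le_ofReal (Real.exp_le_exp.2
      (mul_le_mul_of_nonneg_left ht.2 M.coe_nonneg)))) ht y
  have he0 : ENNReal.ofReal (Real.exp (M * t)) ≠ 0 := by simp [Real.exp_pos]
  simp only [RelaxedControl.expProb] at h
  rw [ENNReal.liminf_const_mul_of_ne_top ENNReal.ofReal_ne_top] at h
  exact (ENNReal.mul_le_mul_iff_right he0 ENNReal.ofReal_ne_top).1 h

end StateProb

/-! ### Integrals of lower semicontinuous functions -/

section LowerSemicontinuity

variable {A : Type w} [MetricSpace A] [CompactSpace A] [MeasurableSpace A] [BorelSpace A]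

/-- A weakly continuous curve is measurable, since the masses of open sets are lower
semicontinuous. -/
theorem measurable_of_continuous_probabilityMeasure {ν : ℝ → ProbabilityMeasure A}
    (hν : Continuous ν) : Measurable fun t => (ν t : Measure A) := by
  refine Measurable.measure_of_isPiSystem_of_isProbabilityMeasure
    (BorelSpace.measurable_eq.trans rfl) isPiSystem_isOpen fun G hG => ?_
  refine LowerSemicontinuous.measurable (lowerSemicontinuous_iff_le_liminf.2 fun t => ?_)
  exact ProbabilityMeasure.le_liminf_measure_open_of_tendsto (hν.tendsto t) hG

/-- The integral of a nonnegative lower semicontinuous function is lower semicontinuous for weak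
convergence. -/
theorem lintegral_ofReal_le_liminf {h : A → ℝ} (hh : LowerSemicontinuous h) (h0 : ∀ a, 0 ≤ h a)
    {m : ProbabilityMeasure A} {mn : ℕ → ProbabilityMeasure A} (hm : Tendsto mn atTop (𝓝 m)) :
    ∫⁻ a, ENNReal.ofReal (h a) ∂(m : Measure A) ≤
      liminf (fun n => ∫⁻ a, ENNReal.ofReal (h a) ∂(mn n : Measure A)) atTop := by
  have hmeas : Measurable h := hh.measurable
  have hcake : ∀ μ : Measure A, ∫⁻ a, ENNReal.ofReal (h a) ∂μ = ∫⁻ t in Ioi 0, μ {a | t < h a} :=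
    fun μ => lintegral_eq_lintegral_meas_lt μ (Eventually.of_forall h0) hmeas.aemeasurable
  simp_rw [hcake]
  refine le_trans (lintegral_mono fun t => ?_) (lintegral_liminf_le fun n => ?_)
  · exact ProbabilityMeasure.le_liminf_measure_open_of_tendsto hm (hh.isOpen_preimage t)
  · exact Antitone.measurable fun t t' h => measure_mono fun a ha => h.trans_lt ha

theorem measurable_lintegral_feedback {h : ℝ → A → ℝ} (hh : Measurable (Function.uncurry h))
    {ν : ℝ → ProbabilityMeasure A} (hν : Continuous ν) :
    Measurable fun t => ∫⁻ a, ENNReal.ofReal (h t a) ∂(ν t : Measure A) := by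
  let κ : Kernel ℝ A := ⟨fun t => (ν t : Measure A), measurable_of_continuous_probabilityMeasure hν⟩
  have hκ : IsMarkovKernel κ := ⟨fun t => inferInstanceAs (IsProbabilityMeasure (ν t : Measure A))⟩
  exact Measurable.lintegral_kernel_prod_right (κ := κ) hh.ennreal_ofReal

end LowerSemicontinuity

/-! ### Extended integrals of functions that are bounded below -/

section ExtIntegral

theorem extIntegral_congr_ae {X : Type*} [MeasurableSpace X] {m : Measure X} {h h' : X → EReal}
    (hh : h =ᵐ[m] h') : extIntegral m h = extIntegral m h' := by
  have h1 : ∫⁻ x, (h x).toENNReal ∂m = ∫⁻ x, (h' x).toENNReal ∂m :=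
    lintegral_congr_ae (hh.mono fun x hx => by simp only [hx])
  have h2 : ∫⁻ x, (-h x).toENNReal ∂m = ∫⁻ x, (-h' x).toENNReal ∂m :=
    lintegral_congr_ae (hh.mono fun x hx => by simp only [hx])
  rw [extIntegral, extIntegral, h1, h2]

/-- The extended integral of a function that is bounded below, written as a nonnegative function
minus a constant. -/
theorem extIntegral_eq_sub {X : Type*} [MeasurableSpace X] {m : Measure X} [IsFiniteMeasure m]
    {h : X → EReal} {k : X → ℝ≥0∞} (hk : AEMeasurable k m) {c : ℝ≥0∞} (hc : c ≠ ∞)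
    (hh : ∀ᵐ x ∂m, h x = k x - c) :
    extIntegral m h = ((∫⁻ x, k x ∂m : ℝ≥0∞) : EReal) - ((c * m univ : ℝ≥0∞) : EReal) := by
  rw [extIntegral_congr_ae hh, extIntegral]
  have h1 : ∀ x, ((k x : EReal) - c).toENNReal = k x - c := fun x => by
    rw [EReal.toENNReal_sub (EReal.coe_ennreal_nonneg _), EReal.toENNReal_coe, EReal.toENNReal_coe]
  have h2 : ∀ x, (-((k x : EReal) - c)).toENNReal = c - k x := fun x => by
    rw [EReal.neg_sub, add_comm, ← sub_eq_add_neg, EReal.toENNReal_sub (EReal.coe_ennreal_nonneg _),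
      EReal.toENNReal_coe, EReal.toENNReal_coe]
    · right; simp
    · right; simpa using hc
  simp_rw [h1, h2]
  have h3 : (∫⁻ x, (k x - c) ∂m) + c * m univ = (∫⁻ x, k x ∂m) + ∫⁻ x, (c - k x) ∂m := by
    rw [← lintegral_const, ← lintegral_add_right _ measurable_const, ← lintegral_add_left' hk]
    refine lintegral_congr fun x => ?_
    rcases le_total (k x) c with hle | hle
    · rw [tsub_eq_zero_of_le hle, zero_add, add_tsub_cancel_of_le hle]
    · rw [tsub_add_cancel_of_le hle, tsub_eq_zero_of_le hle, add_zero]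
  have hcm : c * m univ ≠ ∞ := ENNReal.mul_ne_top hc (measure_ne_top _ _)
  have h4 : ∫⁻ x, (c - k x) ∂m ≠ ∞ := by
    refine ne_top_of_le_ne_top hcm ?_
    rw [← lintegral_const]
    exact lintegral_mono fun x => tsub_le_self
  generalize (∫⁻ x, (k x - c) ∂m) = a at h3 ⊢
  generalize (∫⁻ x, (c - k x) ∂m) = b at h3 h4 ⊢
  generalize (∫⁻ x, k x ∂m) = d at h3 ⊢
  generalize c * m univ = e at h3 hcm ⊢
  lift b to ℝ≥0 using h4
  lift e to ℝ≥0 using hcm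
  induction a with
  | top =>
    have : d = ∞ := by simpa using h3.symm
    subst this
    simp
  | coe a =>
    have hd : d ≠ ∞ := by
      rintro rfl
      simp [← ENNReal.coe_add] at h3
    lift d to ℝ≥0 using hd
    have h5 : (a : ℝ) + e = d + b := by exact_mod_cast h3
    have : (a : ℝ) - b = d - e := by linarith
    simp only [EReal.coe_nnreal_eq_coe_real]
    rw [← EReal.coe_sub, ← EReal.coe_sub, this]

theorem coe_eq_ofReal_add_sub {r : ℝ} {c : ℝ≥0} (h : 0 ≤ r + c) :
    (r : EReal) = ((ENNReal.ofReal (r + c) : ℝ≥0∞) : EReal) - ((c : ℝ≥0∞) : EReal) := by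
  rw [EReal.coe_ennreal_ofReal, max_eq_left h]
  rw [EReal.coe_nnreal_eq_coe_real, ← EReal.coe_sub, add_sub_cancel_right]

theorem coe_sub_add_coe_sub (a d : ℝ≥0∞) {b e : ℝ≥0∞} (hb : b ≠ ∞) (he : e ≠ ∞) :
    ((a : EReal) - b) + ((d : EReal) - e) =
      ((a + d : ℝ≥0∞) : EReal) - ((b + e : ℝ≥0∞) : EReal) := by
  lift b to ℝ≥0 using hb
  lift e to ℝ≥0 using he
  rw [EReal.coe_ennreal_add, EReal.coe_ennreal_add]
  simp only [EReal.coe_nnreal_eq_coe_real, sub_eq_add_neg]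
  rw [EReal.neg_add (Or.inl (EReal.coe_ne_bot _)) (Or.inl (EReal.coe_ne_top _)), sub_eq_add_neg]
  exact add_add_add_comm _ _ _ _

end ExtIntegral

/-! ### The expected cost as a functional of the feedback -/

section Cost

variable {S : Type u} [Countable S] [TopologicalSpace S] [DiscreteTopology S] [MeasurableSpace S]
  [BorelSpace S]
  {A : Type w} [MetricSpace A] [CompactSpace A] [MeasurableSpace A] [BorelSpace A]
  {Q : A → S → Measure S} {q : A → S → ℝ≥0} {T : ℝ} {ψ : ℝ → ℝ} {s : ℝ} {θ : S}

theorem RelaxedControl.ae_stateProb_ne_zero (α : RelaxedControl.{u, v, w} T ψ q Q s θ) {t : ℝ}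
    (ht : t ∈ Icc s T) : ∀ᵐ ω ∂α.P, α.stateProb t (α.state t ω) ≠ 0 := by
  have h := α.lintegral_state ht fun x => if α.stateProb t x = 0 then 1 else 0
  have h0 : ∀ x, α.stateProb t x * (if α.stateProb t x = 0 then 1 else 0) = 0 := fun x => by
    split_ifs with hx <;> simp [hx]
  simp_rw [h0, tsum_zero] at h
  have hm : Measurable fun ω => if α.stateProb t (α.state t ω) = 0 then (1 : ℝ≥0∞) else 0 :=
    (measurable_of_countable fun x => if α.stateProb t x = 0 then (1 : ℝ≥0∞) else 0).comp
      (α.measurable_state ht)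
  filter_upwards [(lintegral_eq_zero_iff hm).1 h] with ω hω hne
  simp [hne] at hω

/-- Almost every path spends almost all its time in states that have positive probability. -/
theorem RelaxedControl.ae_ae_stateProb_ne_zero (α : RelaxedControl.{u, v, w} T ψ q Q s θ)
    (hsT : s ≤ T) :
    ∀ᵐ ω ∂α.P, ∀ᵐ t ∂volume.restrict (Icc s T), α.stateProb t (α.state t ω) ≠ 0 := by
  have hp := fun x => α.aemeasurable_stateProb hsT x
  -- a version of the one-dimensional distributions that is measurable in time
  set p' : ℝ → S → ℝ≥0∞ := fun t x => (hp x).mk _ t with hp'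
  have hpp : ∀ᵐ t ∂volume.restrict (Icc s T), ∀ x, α.stateProb t x = p' t x :=
    ae_all_iff.2 fun x => (hp x).ae_eq_mk
  have hZ : ∀ x, Measurable fun t => if p' t x = 0 then (1 : ℝ≥0∞) else 0 := fun x =>
    Measurable.ite ((hp x).measurable_mk (measurableSet_singleton 0)) measurable_const
      measurable_const
  have hjoint := α.aemeasurable_comp_state hsT hZ
  have hnull : ∀ᵐ z ∂(volume.restrict (Icc s T)).prod α.P,
      (if p' z.1 (α.state z.1 z.2) = 0 then (1 : ℝ≥0∞) else 0) = 0 := by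
    refine (lintegral_eq_zero_iff' hjoint).1 ?_
    rw [lintegral_prod _ hjoint]
    refine (lintegral_eq_zero_iff' hjoint.lintegral_prod_right').2 ?_
    filter_upwards [hpp, ae_restrict_mem measurableSet_Icc] with t h1 ht
    refine (lintegral_congr_ae ?_).trans lintegral_zero
    filter_upwards [α.ae_stateProb_ne_zero ht] with ω hω
    rw [h1] at hω
    simp [hω]
  have hswap := (Measure.measurePreserving_swap (μ := α.P)
    (ν := volume.restrict (Icc s T))).quasiMeasurePreserving.ae hnull
  filter_upwards [Measure.ae_ae_of_ae_prod hswap] with ω hω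
  filter_upwards [hω, hpp] with t h1 h2 h3
  rw [h2] at h3
  simp [h3] at h1

/-- The running cost under a relaxed action, shifted by a constant. Time is projected to `[0,T]`. -/
def runningCost (f : ℝ → S → A → ℝ) (hT : 0 ≤ T) (c : ℝ≥0) (t : ℝ) (x : S)
    (m : ProbabilityMeasure A) : ℝ≥0∞ :=
  ∫⁻ a, ENNReal.ofReal (f (projIcc 0 T hT t) x a + c) ∂(m : Measure A)

variable {f : ℝ → S → A → ℝ} {g : S → ℝ}

theorem lowerSemicontinuous_proj (hf : LowerSemicontinuousOn
    (fun p : ℝ × S × A => f p.1 p.2.1 p.2.2) (Icc 0 T ×ˢ univ)) (hT : 0 ≤ T) (c : ℝ≥0) (x : S) :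
    LowerSemicontinuous fun p : ℝ × A => f (projIcc 0 T hT p.1) x p.2 + c := by
  have h1 : Continuous fun p : ℝ × A => (((projIcc 0 T hT p.1 : Icc 0 T) : ℝ), x, p.2) :=
    (continuous_subtype_val.comp (continuous_projIcc.comp continuous_fst)).prodMk
      (continuous_const.prodMk continuous_snd)
  have h2 : LowerSemicontinuous fun p : ℝ × A => f (projIcc 0 T hT p.1) x p.2 := by
    rw [← lowerSemicontinuousOn_univ_iff]
    exact hf.comp h1.continuousOn fun p _ => ⟨Subtype.coe_prop _, mem_univ _⟩
  exact h2.add continuous_const.lowerSemicontinuous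

theorem measurable_runningCost (hf : LowerSemicontinuousOn
    (fun p : ℝ × S × A => f p.1 p.2.1 p.2.2) (Icc 0 T ×ˢ univ)) (hT : 0 ≤ T) (c : ℝ≥0)
    {ν : S → ℝ → ProbabilityMeasure A} (hν : ∀ x, Continuous (ν x)) (x : S) :
    Measurable fun t => runningCost f hT c t x (ν x t) :=
  measurable_lintegral_feedback (h := fun t a => f (projIcc 0 T hT t) x a + c)
    (lowerSemicontinuous_proj hf hT c x).measurable (hν x)

theorem extIntegral_action (hf : LowerSemicontinuousOn
    (fun p : ℝ × S × A => f p.1 p.2.1 p.2.2) (Icc 0 T ×ˢ univ)) (hT : 0 ≤ T) {c : ℝ≥0}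
    (hc : ∀ t ∈ Icc 0 T, ∀ x a, 0 ≤ f t x a + c) {t : ℝ} (ht : t ∈ Icc 0 T) (x : S)
    (m : ProbabilityMeasure A) :
    extIntegral (m : Measure A) (fun a => (f t x a : EReal)) =
      runningCost f hT c t x m - ((c : ℝ≥0∞) : EReal) := by
  have hproj : (projIcc 0 T hT t : ℝ) = t := by rw [projIcc_of_mem hT ht]
  have h1 : LowerSemicontinuous fun a : A => f t x a + c := by
    have := (lowerSemicontinuous_proj hf hT c x).comp (g := fun a : A => (t, a)) (by fun_prop)
    simpa only [Function.comp_def, hproj] using this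
  rw [extIntegral_eq_sub (k := fun a => ENNReal.ofReal (f t x a + c)) (c := c)
    h1.measurable.ennreal_ofReal.aemeasurable ENNReal.coe_ne_top
    (Eventually.of_forall fun a => coe_eq_ofReal_add_sub (hc t ht x a)), measure_univ, mul_one,
    runningCost, hproj]

/-- The expected cost as a functional of the feedback and of the one-dimensional distributions of
the state process, for costs that have been shifted by constants to make them nonnegative. -/
def RelaxedControl.distCost (α : RelaxedControl.{u, v, w} T ψ q Q s θ) (f : ℝ → S → A → ℝ)
    (g : S → ℝ) (hT : 0 ≤ T) (c c' : ℝ≥0) (ν : S → ℝ → ProbabilityMeasure A) : ℝ≥0∞ :=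
  (∫⁻ t in Icc s T, ∑' x, α.stateProb t x * runningCost f hT c t x (ν x t)) +
    ∑' x, α.stateProb T x * ENNReal.ofReal (g x + c')

theorem RelaxedControl.cost_eq_distCost (α : RelaxedControl.{u, v, w} T ψ q Q s θ)
    {ν : S → ℝ → ProbabilityMeasure A} (hν : α.IsFeedback ν) (hνc : ∀ x, Continuous (ν x))
    (hf : LowerSemicontinuousOn (fun p : ℝ × S × A => f p.1 p.2.1 p.2.2) (Icc 0 T ×ˢ univ))
    (hT : 0 ≤ T) {c c' : ℝ≥0} (hc : ∀ t ∈ Icc 0 T, ∀ x a, 0 ≤ f t x a + c)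
    (hc' : ∀ x, 0 ≤ g x + c') :
    cost f g α = (α.distCost f g hT c c' ν : EReal) -
      ((c * ENNReal.ofReal (T - s) + c' : ℝ≥0∞) : EReal) := by
  have hs := α.time_mem
  have hT' : T ∈ Icc s T := ⟨hs.2, le_rfl⟩
  have hF := fun x => measurable_runningCost hf hT c hνc x
  have hjoint := α.aemeasurable_comp_state hs.2 hF
  have hG : AEMeasurable (fun ω => ∫⁻ t in Icc s T,
      runningCost f hT c t (α.state t ω) (ν (α.state t ω) t)) α.P := hjoint.lintegral_prod_left'
  have hg : Measurable fun ω => ENNReal.ofReal (g (α.state T ω) + c') :=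
    (measurable_of_countable fun x => ENNReal.ofReal (g x + c')).comp (α.measurable_state hT')
  have hpath : ∀ᵐ ω ∂α.P,
      extIntegral (volume.restrict (Icc s T)) (fun t =>
        extIntegral (α.ctrl t ω : Measure A) fun a => (f t (α.state t ω) a : EReal))
      + (g (α.state T ω) : EReal) =
      (((∫⁻ t in Icc s T, runningCost f hT c t (α.state t ω) (ν (α.state t ω) t)) +
        ENNReal.ofReal (g (α.state T ω) + c') : ℝ≥0∞) : EReal) -
          ((c * ENNReal.ofReal (T - s) + c' : ℝ≥0∞) : EReal) := by
    filter_upwards [α.ae_ae_stateProb_ne_zero hs.2,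
      hjoint.prod_swap.aestronglyMeasurable.prodMk_left] with ω h1 h2
    rw [extIntegral_eq_sub (k := fun t => runningCost f hT c t (α.state t ω) (ν (α.state t ω) t))
      (c := c) h2.aemeasurable ENNReal.coe_ne_top, coe_eq_ofReal_add_sub (hc' (α.state T ω)),
      Measure.restrict_apply_univ, Real.volume_Icc, coe_sub_add_coe_sub _ _
        (ENNReal.mul_ne_top ENNReal.coe_ne_top ENNReal.ofReal_ne_top) ENNReal.coe_ne_top]
    -- the feedback is not available at the terminal time, which is a null set
    filter_upwards [h1, ae_restrict_mem measurableSet_Icc,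
      ae_restrict_of_ae (Measure.ae_ne volume T)] with t h3 ht hne
    rw [hν t ⟨ht.1, lt_of_le_of_ne ht.2 hne⟩ ω h3]
    exact extIntegral_action hf hT hc ⟨hs.1.trans ht.1, ht.2⟩ _ _
  rw [cost, extIntegral_eq_sub (k := fun ω => (∫⁻ t in Icc s T,
      runningCost f hT c t (α.state t ω) (ν (α.state t ω) t)) +
      ENNReal.ofReal (g (α.state T ω) + c')) (hG.add hg.aemeasurable) ?_ hpath, measure_univ,
    mul_one, lintegral_add_right _ hg, α.lintegral_state hT' fun x => ENNReal.ofReal (g x + c'),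
    lintegral_lintegral_swap (f := fun ω t =>
      runningCost f hT c t (α.state t ω) (ν (α.state t ω) t)) hjoint.prod_swap,
    RelaxedControl.distCost]
  · congr 3
    refine setLIntegral_congr_fun measurableSet_Icc fun t ht => ?_
    exact (α.lintegral_state ht fun x => runningCost f hT c t x (ν x t))
  · exact ENNReal.add_ne_top.2 ⟨ENNReal.mul_ne_top ENNReal.coe_ne_top ENNReal.ofReal_ne_top,
      ENNReal.coe_ne_top⟩

end Cost

/-! ### Existence of an optimal control -/

section Existence

variable {S : Type u} [Countable S] [TopologicalSpace S] [DiscreteTopology S] [MeasurableSpace S]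
  [BorelSpace S]
  {A : Type w} [MetricSpace A] [CompactSpace A] [MeasurableSpace A] [BorelSpace A]
  {M : ℝ≥0} {Q : A → S → Measure S} {q : A → S → ℝ≥0} {T : ℝ} {ψ : ℝ → ℝ} {s : ℝ} {θ : S}
  {f : ℝ → S → A → ℝ} {g : S → ℝ}

/-- Lower semicontinuity of the expected cost in the feedback. -/
theorem RelaxedControl.distCost_le_liminf
    (hQ : ∀ x B, MeasurableSet B → Continuous fun a => Q a x B)
    (hM : ∀ a x, Q a x univ ≤ M) (hq : ∀ a x, Q a x univ = q a x)
    (hf : LowerSemicontinuousOn (fun p : ℝ × S × A => f p.1 p.2.1 p.2.2) (Icc 0 T ×ˢ univ))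
    (hT : 0 ≤ T) {c : ℝ≥0} (hc : ∀ t ∈ Icc 0 T, ∀ x a, 0 ≤ f t x a + c) (c' : ℝ≥0)
    (α : RelaxedControl.{u, v, w} T ψ q Q s θ) (β : ℕ → RelaxedControl.{u, v, w} T ψ q Q s θ)
    {ν : S → ℝ → ProbabilityMeasure A} (hν : α.IsFeedback ν) (hνc : ∀ x, Continuous (ν x))
    {νn : ℕ → S → ℝ → ProbabilityMeasure A} (hνn : ∀ n, (β n).IsFeedback (νn n))
    (hνnc : ∀ n x, Continuous (νn n x))
    (hlim : ∀ x t, Tendsto (fun n => νn n x t) atTop (𝓝 (ν x t))) :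
    α.distCost f g hT c c' ν ≤ liminf (fun n => (β n).distCost f g hT c c' (νn n)) atTop := by
  have hsT := α.time_mem.2
  have hp : ∀ t ∈ Icc s T, ∀ x, α.stateProb t x ≤ liminf (fun n => (β n).stateProb t x) atTop :=
    fun t ht x => α.stateProb_le_liminf hQ hM hq β hν hνc hνn hνnc hlim ht x
  have hF : ∀ t x, runningCost f hT c t x (ν x t) ≤
      liminf (fun n => runningCost f hT c t x (νn n x t)) atTop := fun t x => by
    refine lintegral_ofReal_le_liminf (h := fun a => f (projIcc 0 T hT t) x a + c) ?_
      (fun a => hc _ (Subtype.coe_prop _) x a) (hlim x t)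
    exact (lowerSemicontinuous_proj hf hT c x).comp (g := fun a : A => (t, a)) (by fun_prop)
  have hm : ∀ n, AEMeasurable (fun t => ∑' x, (β n).stateProb t x *
      runningCost f hT c t x (νn n x t)) (volume.restrict (Icc s T)) := fun n => by
    have h : ∀ x, AEMeasurable (fun t => (β n).stateProb t x *
        runningCost f hT c t x (νn n x t)) (volume.restrict (Icc s T)) := fun x =>
      ((β n).aemeasurable_stateProb hsT x).mul
        (measurable_runningCost hf hT c (hνnc n) x).aemeasurable
    exact AEMeasurable.tsum h
  refine (add_le_add ?_ ?_).trans (liminf_add_liminf_le _ _)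
  · refine (setLIntegral_mono' measurableSet_Icc fun t ht => ?_).trans (lintegral_liminf_le' hm)
    refine (ENNReal.tsum_le_tsum fun x => ?_).trans (tsum_liminf_le _)
    exact (mul_le_mul' (hp t ht x) (hF t x)).trans ENNReal.le_liminf_mul
  · refine (ENNReal.tsum_le_tsum fun x => ?_).trans (tsum_liminf_le _)
    refine (mul_le_mul_left (hp T ⟨hsT, le_rfl⟩ x) _).trans ?_
    rw [mul_comm, ← ENNReal.liminf_mul_const_of_ne_top ENNReal.ofReal_ne_top]

/-- A limit point of a minimizing sequence of feedbacks yields an optimal control. -/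
theorem exists_isOptimal [Nonempty A]
    (hQ : ∀ x B, MeasurableSet B → Continuous fun a => Q a x B)
    (hM : ∀ a x, Q a x univ ≤ M) (hM0 : M ≠ 0) (hq : ∀ a x, Q a x univ = q a x)
    (hψ : Tendsto ψ (𝓝[>] 0) (𝓝 0))
    (hf : LowerSemicontinuousOn (fun p : ℝ × S × A => f p.1 p.2.1 p.2.2) (Icc 0 T ×ˢ univ))
    {c c' : ℝ≥0} (hc : ∀ t ∈ Icc 0 T, ∀ x a, 0 ≤ f t x a + c) (hc' : ∀ x, 0 ≤ g x + c')
    (hs : s ∈ Ico 0 T) (θ : S) :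
    ∃ α : RelaxedControl.{u, v, w} T ψ q Q s θ, α.IsOptimal f g ∧ α.IsMarkov := by
  have hT : 0 < T := hs.1.trans_lt hs.2
  let m₀ : ProbabilityMeasure A :=
    ⟨Measure.dirac (Classical.arbitrary A), Measure.dirac.isProbabilityMeasure⟩
  -- constant feedbacks show that there are controls
  obtain ⟨α₀, -⟩ := exists_relaxedControl.{u, v, w} hQ hM hM0 hq hψ
    (fun _ => hasModulus_const T ψ m₀) hs θ
  obtain ⟨c₁, -, hc₁, hmem⟩ := exists_seq_tendsto_sInf
    (S := range fun α : RelaxedControl.{u, v, w} T ψ q Q s θ => cost f g α) ⟨_, α₀, rfl⟩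
    (OrderBot.bddBelow _)
  choose β hβ using hmem
  choose νn hνn hfb using fun n => (β n).exists_feedback hT
  obtain ⟨ν, hν, φ, hφ, hlim⟩ := exists_subseq_tendsto_of_hasModulus hT hψ hνn
  obtain ⟨α, hα, hctrl⟩ := exists_relaxedControl.{u, v, w} hQ hM hM0 hq hψ hν hs θ
  refine ⟨α, le_antisymm (iInf_le _ α) ?_, hα⟩
  have hαν : α.IsFeedback ν := fun t _ ω _ => hctrl t ω
  have hνc : ∀ x, Continuous (ν x) := fun x => (hν x).continuous hT hψ
  have hνnc : ∀ n x, Continuous (νn n x) := fun n x => (hνn n x).continuous hT hψ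
  set K : ℝ≥0∞ := c * ENNReal.ofReal (T - s) + c' with hK
  have hKtop : K ≠ ∞ := ENNReal.add_ne_top.2
    ⟨ENNReal.mul_ne_top ENNReal.coe_ne_top ENNReal.ofReal_ne_top, ENNReal.coe_ne_top⟩
  have hmono : Monotone fun x : ℝ≥0∞ => (x : EReal) - (K : EReal) := fun x y hxy =>
    EReal.sub_le_sub (EReal.coe_ennreal_le_coe_ennreal_iff.2 hxy) le_rfl
  have hcont : Continuous fun x : ℝ≥0∞ => (x : EReal) - (K : EReal) := by
    refine continuous_iff_continuousAt.2 fun x => ?_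
    have h1 : ContinuousAt (fun p : EReal × EReal => p.1 + p.2) ((x : EReal), -(K : EReal)) :=
      EReal.continuousAt_add (Or.inr (by simpa using hKtop)) (Or.inl (EReal.coe_ennreal_ne_bot _))
    exact h1.comp (f := fun x : ℝ≥0∞ => ((x : EReal), -(K : EReal)))
      (continuous_coe_ennreal_ereal.prodMk continuous_const).continuousAt
  have hcost := α.cost_eq_distCost hαν hνc hf hT.le hc hc'
  have hcostn := fun n => (β (φ n)).cost_eq_distCost (hfb (φ n)) (hνnc (φ n)) hf hT.le hc hc'
  have hle := hmono (RelaxedControl.distCost_le_liminf hQ hM hq hf hT.le hc c' α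
    (fun n => β (φ n)) hαν hνc (fun n => hfb (φ n)) (fun n => hνnc (φ n)) hlim (g := g))
  rw [hcost]
  refine (hle.trans_eq (hmono.map_liminf_of_continuousAt _ hcont.continuousAt)).trans (le_of_eq ?_)
  rw [value, iInf, ← (hc₁.comp hφ.tendsto_atTop).liminf_eq]
  congr 1
  ext n
  rw [Function.comp_apply, Function.comp_apply, ← hβ (φ n)]
  exact (hcostn n).symm

end Existence
end CTMDP
end

theorem mainTheorem1
    {S : Type u} [Countable S] [TopologicalSpace S] [DiscreteTopology S]
    [MeasurableSpace S] [BorelSpace S]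
    {k : ℕ} (U : Set (EuclideanSpace ℝ (Fin k))) (hU : IsCompact U) (hU_ne : U.Nonempty)
    (T : ℝ) (hT : 0 < T)
    (q : U → S → ℝ≥0) (Q : U → S → Measure S)
    (h_pair : ∀ a, CTMDP.IsConservativeQPair (q a) (Q a))
    (h_bdd : (⨆ a, ⨆ θ, Q a θ univ) < ∞)
    (h_cont_action : ∀ θ B, MeasurableSet B → Continuous fun a => Q a θ B)
    (h_cont_state : ∀ B a, MeasurableSet B → Continuous fun θ => Q a θ B)
    (h_drift : CTMDP.DriftCondition q Q)
    (ψ : ℝ → ℝ) (hψ_nonneg : ∀ r ∈ Icc 0 T, 0 ≤ ψ r) (hψ_mono : MonotoneOn ψ (Icc 0 T))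
    (hψ_lim : Tendsto ψ (𝓝[>] 0) (𝓝 0))
    (f : ℝ → S → U → ℝ) (g : S → ℝ)
    (hf_lsc : LowerSemicontinuousOn (fun p : ℝ × S × U => f p.1 p.2.1 p.2.2) (Icc 0 T ×ˢ univ))
    (hf_bdd : ∃ c : ℝ, ∀ t ∈ Icc 0 T, ∀ θ a, c ≤ f t θ a)
    (hg_lsc : LowerSemicontinuous g) (hg_bdd : ∃ c : ℝ, ∀ θ, c ≤ g θ)
    (s : ℝ) (hs : s ∈ Ico 0 T) (θ : S) :
    ∃ α : CTMDP.RelaxedControl.{u, v, 0} T ψ q Q s θ, α.IsOptimal f g ∧ α.IsMarkov := by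
  have : CompactSpace U := isCompact_iff_compactSpace.1 hU
  have : Nonempty U := hU_ne.to_subtype
  obtain ⟨c, hc⟩ := hf_bdd
  obtain ⟨c', hc'⟩ := hg_bdd
  -- the uniformization rate has to be positive, also if all transition rates vanish
  refine CTMDP.exists_isOptimal (M := (⨆ a, ⨆ θ, Q a θ univ).toNNReal + 1) (c := (-c).toNNReal)
    (c' := (-c').toNNReal) h_cont_action (fun a x => ?_) (by positivity)
    (fun a => (h_pair a).conservative) hψ_lim hf_lsc (fun t ht x a => ?_) (fun x => ?_) hs θ
  · rw [ENNReal.coe_add, ENNReal.coe_toNNReal h_bdd.ne]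
    exact (le_iSup₂ (f := fun a θ => Q a θ univ) a x).trans le_self_add
  · linarith [hc t ht x a, Real.le_coe_toNNReal (-c)]
  · linarith [hc' x, Real.le_coe_toNNReal (-c')]
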